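/- A locally C*-algebra is a complete Hausdorff complex topological $*$-algebra $A$ whose topology is given by the set $S(A)$ of its continuous C*-seminorms. A Hilbert $A$-module $E$ (a right module with $A$-valued inner product $\langle\cdot,\cdot\rangle$, $A$-linear in the second variable) is complete for the seminorms $\bar p_E(x)=p(\langle x,x\rangle)^{1/2}$, $p\in S(A)$; $\langle E,E\rangle$ denotes the closed linear span in $A$ of the inner products, and $E$ is full if $\langle E,E\rangle=A$. $L_A(E)$ is the $*$-algebra of bounded adjointable module maps with the topology of the operator seminorms $\tilde p$, $p\in S(A)$, and $K_A(E)\subseteq L_A(E)$ is the closed linear span of the operators $\theta_{x,y}(z)=x\langle y,z\rangle$. Locally C*-algebras $A$ and $B$ are strongly Morita equivalent if there is a full Hilbert $A$-module $E$ with an isomorphism of topological $*$-algebras $\alpha:B\to K_A(E)$; we then say that $(E,\alpha)$ gives the equivalence. Hilbert modules $V$ over $A$ and $W$ over $B$ are Morita equivalent if $K_A(V)$ and $K_B(W)$ are strongly Morita equivalent. A representation of a Hilbert $A$-module $V$ is a map $\Phi:V\to B(H,K)$, with $H,K$ Hilbert spaces, for which there is a continuous $*$-homomorphism $\varphi:A\to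 B(H)$ with $\Phi(x)^*\Phi(y)=\varphi(\langle x,y\rangle)$ for all $x,y\in V$. It is non-degenerate if the closed linear span of $\Phi(V)H$ is $K$ and that of $\Phi(V)^*K$ is $H$. Representations $\Phi_i:V\to B(H_i,K_i)$, $i=1,2$, are unitarily equivalent if there are unitaries $U_1:H_1\to H_2$ and $U_2:K_1\to K_2$ with $U_2\Phi_1(v)=\Phi_2(v)U_1$ for all $v\in V$. Theorem. Let $V$ and $W$ be Morita equivalent Hilbert modules over locally C*-algebras $A$ and $B$. Then the locally C*-algebras $\langle V,V\rangle$ and $\langle W,W\rangle$ are strongly Morita equivalent. Moreover, for every $(E,\alpha)$ giving this equivalence, where $E$ is a full Hilbert $\langle V,V\rangle$-module and $\alpha:\langle W,W\rangle\to K_{\langle V,V\rangle}(E)$ is an isomorphism, every non-degenerate representation $\Phi:V\to B(H,K)$ of $V$ has a Rieffel induced representation ${}_E^W\Phi$, which is a non-degenerate representation of $W$, and $\Phi\mapsto{}_E^W\Phi$ induces a bijection from the unitary equivalence classes of non-degenerate representations of $V$ onto those of $W$. Here ${}_E^W\Phi:W\to B({}_EH,{}_{W\otimes E}H)$ is given by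 ${}_E^W\Phi(w)(x\otimes h)=w\otimes x\otimes h$, where ${}_EH$ is the Hausdorff completion of the algebraic tensor product $E\otimes H$ for the form $\langle x\otimes h,y\otimes k\rangle=\langle h,\varphi(\langle x,y\rangle)k\rangle$, and ${}_{W\otimes E}H$ is the Hausdorff completion of $W\otimes E\otimes H$ for the form $\langle w\otimes x\otimes h,w'\otimes y\otimes k\rangle=\langle h,\varphi(\langle x,\alpha(\langle w,w'\rangle)y\rangle)k\rangle$; the associated representation of $B$ restricts to $\langle W,W\rangle$ as $b\,(x\otimes h)=\alpha(b)x\otimes h$. -/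

import Mathlib

open scoped InnerProductSpace TensorProduct

universe u

/-! ### Continuous C*-seminorms and locally C*-algebras -/

section CStarSeminorm

variable (A : Type*) [NonUnitalRing A] [StarRing A] [Module ℂ A] [TopologicalSpace A]

/-- A continuous C*-seminorm on a topological `*`-algebra `A`. The type `CStarSeminorm A` is the
set `S(A)` of all of them. -/
structure CStarSeminorm extends Seminorm ℂ A where
  mul_le' : ∀ a b : A, toFun (a * b) ≤ toFun a * toFun b
  star_mul_self' : ∀ a : A, toFun (star a * a) = toFun a ^ 2
  continuous' : Continuous toFun

end CStarSeminorm

namespace CStarSeminorm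

variable {A : Type*} [NonUnitalRing A] [StarRing A] [Module ℂ A] [TopologicalSpace A]

noncomputable instance : CoeFun (CStarSeminorm A) (fun _ => A → ℝ) := ⟨fun p => p.toSeminorm⟩

theorem mul_le (p : CStarSeminorm A) (a b : A) : p (a * b) ≤ p a * p b := p.mul_le' a b

theorem star_mul_self (p : CStarSeminorm A) (a : A) : p (star a * a) = p a ^ 2 :=
  p.star_mul_self' a

theorem nonneg (p : CStarSeminorm A) (a : A) : 0 ≤ p a := apply_nonneg p.toSeminorm a

instance : Nonempty (CStarSeminorm A) :=
  ⟨{ (0 : Seminorm ℂ A) with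
      mul_le' := fun _ _ => le_of_eq (mul_zero (0 : ℝ)).symm
      star_mul_self' := fun _ => (zero_pow two_ne_zero).symm
      continuous' := continuous_const }⟩

theorem star_eq (p : CStarSeminorm A) (a : A) : p (star a) = p a := by
  have key : ∀ a : A, p a ≤ p (star a) := by
    intro a
    have h1 := p.star_mul_self a
    have h2 := p.mul_le (star a) a
    rw [h1] at h2
    by_contra hc
    push Not at hc
    nlinarith [p.nonneg a, p.nonneg (star a)]
  exact le_antisymm (by simpa using key (star a)) (key a)

end CStarSeminorm

/-- A locally C*-algebra: a complete Hausdorff complex topological `*`-algebra whose topology is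
the one given by all its continuous C*-seminorms. (Continuity of the product and of the involution
follows from the last condition.) -/
class LocallyCStarAlgebra (A : Type*) extends NonUnitalRing A, StarRing A, Module ℂ A,
    IsScalarTower ℂ A A, SMulCommClass ℂ A A, StarModule ℂ A, UniformSpace A,
    IsUniformAddGroup A, CompleteSpace A, T2Space A where
  withSeminorms : WithSeminorms (fun p : CStarSeminorm A => p.toSeminorm)

/-! ### Hilbert modules -/

section Modules

variable (A : Type*) [NonUnitalRing A] [StarRing A] [Module ℂ A]

/-- A (right) pre-Hilbert module over a topological `*`-algebra `A`. The right action of `a` on `x`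
is `rsmul x a`. An element of `A` is positive when it is of the form `star b * b`. -/
class PreHilbertModule (E : Type*) [AddCommGroup E] [Module ℂ E] extends Inner A E where
  rsmul : E → A → E
  add_rsmul : ∀ (x y : E) (a : A), rsmul (x + y) a = rsmul x a + rsmul y a
  rsmul_add : ∀ (x : E) (a b : A), rsmul x (a + b) = rsmul x a + rsmul x b
  rsmul_mul : ∀ (x : E) (a b : A), rsmul x (a * b) = rsmul (rsmul x a) b
  smul_rsmul : ∀ (c : ℂ) (x : E) (a : A), rsmul (c • x) a = c • rsmul x a
  rsmul_smul : ∀ (c : ℂ) (x : E) (a : A), rsmul x (c • a) = c • rsmul x a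
  ip_add_right : ∀ x y z : E, ⟪x, y + z⟫_A = ⟪x, y⟫_A + ⟪x, z⟫_A
  ip_smul_right : ∀ (c : ℂ) (x y : E), ⟪x, c • y⟫_A = c • ⟪x, y⟫_A
  ip_rsmul_right : ∀ (x y : E) (a : A), ⟪x, rsmul y a⟫_A = ⟪x, y⟫_A * a
  star_ip : ∀ x y : E, star ⟪y, x⟫_A = ⟪x, y⟫_A
  ip_self_nonneg : ∀ x : E, ∃ b : A, ⟪x, x⟫_A = star b * b
  ip_self_eq_zero : ∀ x : E, ⟪x, x⟫_A = 0 → x = 0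

end Modules

/-! ### The Cauchy-Schwarz inequality -/

section CauchySchwarz

open UniformSpace

theorem exists_cstar_completion (R : Type u) [NonUnitalSeminormedRing R] [StarRing R]
    [NormedSpace ℂ R] [IsScalarTower ℂ R R] [SMulCommClass ℂ R R] [StarModule ℂ R]
    (h : ∀ a : R, ‖star a * a‖ = ‖a‖ ^ 2) :
    ∃ (C : Type u) (_ : NonUnitalCStarAlgebra C) (f : R →ₗ[ℂ] C),
      (∀ a b, f (a * b) = f a * f b) ∧ (∀ a, f (star a) = star (f a)) ∧ ∀ a, ‖f a‖ = ‖a‖ := by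
  have hstar : ∀ a : R, ‖star a‖ ≤ ‖a‖ := by
    intro a
    have h1 := h (star a)
    rw [star_star] at h1
    have h2 := norm_mul_le a (star a)
    rw [h1] at h2
    by_contra hc
    push Not at hc
    nlinarith [norm_nonneg a]
  have hsc : UniformContinuous (star : R → R) := by
    refine LipschitzWith.uniformContinuous (K := 1) (LipschitzWith.of_dist_le_mul ?_)
    intro a b
    rw [dist_eq_norm, dist_eq_norm, ← star_sub]
    simpa using hstar (a - b)
  let iMul : Mul (Completion R) :=
    ⟨Function.curry <| (Completion.isDenseInducing_coe.prodMap Completion.isDenseInducing_coe).extend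
      ((↑) ∘ Function.uncurry (fun a b : R => a * b))⟩
  let iStar : Star (Completion R) := ⟨Completion.map star⟩
  have cm : Continuous (fun q : Completion R × Completion R => q.1 * q.2) := by
    let m := (AddMonoidHom.mul : R →+ R →+ R).compr₂ Completion.toCompl
    have : Continuous fun p : R × R => m p.1 p.2 := (Completion.continuous_coe R).comp continuous_mul
    have di : IsDenseInducing (Completion.toCompl : R → Completion R) :=
      Completion.isDenseInducing_coe
    exact (di.extend_Z_bilin di this :)
  have : ContinuousMul (Completion R) := ⟨cm⟩
  have cs : Continuous (star : Completion R → Completion R) := Completion.continuous_map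
  have : ContinuousStar (Completion R) := ⟨cs⟩
  have coe_mul : ∀ a b : R, ((a * b : R) : Completion R) = a * b := by
    intro a b
    have hc : Continuous ((fun r : R => (r : Completion R)) ∘
        Function.uncurry (fun a b : R => a * b)) :=
      (Completion.continuous_coe R).comp continuous_mul
    exact ((Completion.isDenseInducing_coe.prodMap Completion.isDenseInducing_coe).extend_eq
      hc (a, b)).symm
  have coe_star : ∀ a : R, ((star a : R) : Completion R) = star (a : Completion R) := fun a =>
    (Completion.map_coe hsc a).symm
  refine ⟨Completion R,
  { (inferInstance : NormedAddCommGroup (Completion R)),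
    (inferInstance : NormedSpace ℂ (Completion R)),
    (inferInstance : CompleteSpace (Completion R)) with
    mul := iMul.mul
    star := iStar.star
    zero_mul a := Completion.induction_on a (isClosed_eq (by fun_prop) continuous_const)
        fun a => by rw [← Completion.coe_zero, ← coe_mul, zero_mul]
    mul_zero a := Completion.induction_on a (isClosed_eq (by fun_prop) continuous_const)
        fun a => by rw [← Completion.coe_zero, ← coe_mul, mul_zero]
    mul_assoc a b c := Completion.induction_on₃ a b c
        (isClosed_eq (by fun_prop) (by fun_prop))
        fun a b c => by rw [← coe_mul, ← coe_mul, ← coe_mul, ← coe_mul, mul_assoc]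
    left_distrib a b c := Completion.induction_on₃ a b c
        (isClosed_eq (by fun_prop) (by fun_prop))
        fun a b c => by
          rw [← Completion.coe_add, ← coe_mul, ← coe_mul, ← coe_mul, ← Completion.coe_add, mul_add]
    right_distrib a b c := Completion.induction_on₃ a b c
        (isClosed_eq (by fun_prop) (by fun_prop))
        fun a b c => by
          rw [← Completion.coe_add, ← coe_mul, ← coe_mul, ← coe_mul, ← Completion.coe_add, add_mul]
    norm_mul_le a b := Completion.induction_on₂ a b
        (isClosed_le (by fun_prop) (by fun_prop))
        fun a b => by rw [← coe_mul]; simpa using norm_mul_le a b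
    star_involutive a := Completion.induction_on a (isClosed_eq (by fun_prop) (by fun_prop))
        fun a => by rw [← coe_star, ← coe_star, star_star]
    star_mul a b := Completion.induction_on₂ a b (isClosed_eq (by fun_prop) (by fun_prop))
        fun a b => by rw [← coe_mul, ← coe_star, ← coe_star, ← coe_star, ← coe_mul, star_mul]
    star_add a b := Completion.induction_on₂ a b (isClosed_eq (by fun_prop) (by fun_prop))
        fun a b => by
          rw [← Completion.coe_add, ← coe_star, ← coe_star, ← coe_star, ← Completion.coe_add,
            star_add]
    norm_mul_self_le a := Completion.induction_on a (isClosed_le (by fun_prop) (by fun_prop))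
        fun a => by
          rw [← coe_star, ← coe_mul, Completion.norm_coe, Completion.norm_coe, h, sq]
    smul_assoc z a b := Completion.induction_on₂ a b (isClosed_eq
          ((cm.comp ((continuous_fst.const_smul z).prodMk continuous_snd)))
          ((cm.comp (continuous_fst.prodMk continuous_snd)).const_smul z))
        fun a b => by
          change (z • (a : Completion R)) * b = z • ((a : Completion R) * b)
          rw [← Completion.coe_smul, ← coe_mul, ← coe_mul, ← Completion.coe_smul, smul_mul_assoc]
    smul_comm z a b := Completion.induction_on₂ a b (isClosed_eq
          ((cm.comp (continuous_fst.prodMk continuous_snd)).const_smul z)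
          ((cm.comp (continuous_fst.prodMk (continuous_snd.const_smul z)))))
        fun a b => by
          change z • ((a : Completion R) * b) = (a : Completion R) * (z • b)
          rw [← Completion.coe_smul, ← coe_mul, ← coe_mul, ← Completion.coe_smul, mul_smul_comm]
    star_smul z a := Completion.induction_on a (isClosed_eq (cs.comp (continuous_const_smul z))
          ((continuous_const_smul (star z)).comp cs))
        fun a => by
          rw [← Completion.coe_smul, ← coe_star, ← coe_star, ← Completion.coe_smul, star_smul] },
    { toFun := fun a => (a : Completion R)
      map_add' := fun a b => Completion.coe_add a b
      map_smul' := fun c a => Completion.coe_smul c a }, coe_mul, coe_star, ?_⟩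
  intro a
  exact Completion.norm_coe a

theorem cstar_norm_sq_le {C : Type*} [NonUnitalCStarAlgebra C] {a u v : C} (hu : IsSelfAdjoint u)
    (h : ∀ t : ℝ, ∃ b : C, ((t ^ 2 : ℝ) : ℂ) • (star a * u * a)
      - ((2 * t : ℝ) : ℂ) • (star a * a) + v = star b * b) : ‖a‖ ^ 2 ≤ ‖u‖ * ‖v‖ := by
  let _ := CStarAlgebra.spectralOrder C
  have _ := CStarAlgebra.spectralOrderedRing C
  have key : ∀ s : ℝ, ‖u‖ < s → ‖a‖ ^ 2 ≤ s * ‖v‖ := by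
    intro s hs
    have hs0 : 0 < s := (norm_nonneg u).trans_lt hs
    obtain ⟨b, hb⟩ := h s⁻¹
    have h1 : star a * u * a ≤ ‖u‖ • (star a * a) :=
      CStarAlgebra.star_left_conjugate_le_norm_smul
    have h0 : 0 ≤ star a * a := star_mul_self_nonneg a
    have h2 : star a * u * a ≤ s • (star a * a) :=
      h1.trans (smul_le_smul_of_nonneg_right hs.le h0)
    have h3 : 0 ≤ star b * b := star_mul_self_nonneg b
    rw [← hb, Complex.coe_smul, Complex.coe_smul] at h3
    have h4 : (s⁻¹ ^ 2) • (star a * u * a) ≤ (s⁻¹ ^ 2) • (s • (star a * a)) :=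
      smul_le_smul_of_nonneg_left h2 (by positivity)
    have h5 : (s⁻¹ ^ 2) • (s • (star a * a)) = s⁻¹ • (star a * a) := by
      rw [smul_smul]; congr 1; field_simp
    rw [h5] at h4
    have h6 : s⁻¹ • (star a * a) ≤ v := by
      have h7 : (0 : C) ≤ s⁻¹ • (star a * a) - (2 * s⁻¹) • (star a * a) + v :=
        h3.trans (by gcongr)
      have h8 : s⁻¹ • (star a * a) - (2 * s⁻¹) • (star a * a) + v = v - s⁻¹ • (star a * a) := by
        rw [two_mul, add_smul]; abel
      rw [h8] at h7
      exact sub_nonneg.mp h7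
    have h9 := CStarAlgebra.norm_le_norm_of_nonneg_of_le (smul_nonneg (by positivity) h0) h6
    rw [norm_smul, CStarRing.norm_star_mul_self, Real.norm_of_nonneg (by positivity)] at h9
    rw [inv_mul_le_iff₀ hs0] at h9
    nlinarith
  by_cases hv : ‖v‖ = 0
  · have := key (‖u‖ + 1) (by linarith)
    rw [hv] at this ⊢
    simpa using this
  · have hv' : 0 < ‖v‖ := lt_of_le_of_ne (norm_nonneg v) (Ne.symm hv)
    rw [← div_le_iff₀ hv']
    refine le_of_forall_gt_imp_ge_of_dense ?_
    intro s hs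
    rw [div_le_iff₀ hv']
    exact key s hs

theorem CStarSeminorm.sq_le {A : Type u} [NonUnitalRing A] [StarRing A] [Module ℂ A]
    [IsScalarTower ℂ A A] [SMulCommClass ℂ A A] [StarModule ℂ A] [TopologicalSpace A]
    (p : CStarSeminorm A) {a u v : A} (hu : star u = u)
    (h : ∀ t : ℝ, ∃ b : A, ((t ^ 2 : ℝ) : ℂ) • (star a * u * a)
      - ((2 * t : ℝ) : ℂ) • (star a * a) + v = star b * b) : p a ^ 2 ≤ p u * p v := by
  let iG : SeminormedAddCommGroup A := p.toSeminorm.toSeminormedAddCommGroup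
  let iR : NonUnitalSeminormedRing A :=
    { (inferInstance : NonUnitalRing A), iG with
      norm_mul_le := p.mul_le }
  let iN : NormedSpace ℂ A :=
    { (inferInstance : Module ℂ A) with
      norm_smul_le := fun c a => (map_smul_eq_mul p.toSeminorm c a).le }
  obtain ⟨C, _, f, hm, hs, hn⟩ := exists_cstar_completion A p.star_mul_self
  have := cstar_norm_sq_le (a := f a) (u := f u) (v := f v)
    (by rw [IsSelfAdjoint, ← hs, hu]) (by
      intro t
      obtain ⟨b, hb⟩ := h t
      refine ⟨f b, ?_⟩
      rw [← hs, ← hs, ← hm, ← hm, ← hm, ← hm, ← hb]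
      simp only [map_add, map_sub, map_smul])
  rw [hn, hn, hn] at this
  exact this

end CauchySchwarz

namespace PreHilbertModule

section Algebra

variable {A : Type*} [NonUnitalRing A] [StarRing A] [Module ℂ A]
variable {E : Type*} [AddCommGroup E] [Module ℂ E] [PreHilbertModule A E]

theorem ip_add_left (x y z : E) : ⟪x + y, z⟫_A = ⟪x, z⟫_A + ⟪y, z⟫_A := by
  rw [← star_ip, ip_add_right, star_add, star_ip, star_ip]

theorem ip_smul_left [StarModule ℂ A] (c : ℂ) (x y : E) :
    ⟪c • x, y⟫_A = star c • ⟪x, y⟫_A := by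
  rw [← star_ip, ip_smul_right, star_smul, star_ip]

theorem ip_rsmul_left (x y : E) (a : A) : ⟪rsmul x a, y⟫_A = star a * ⟪x, y⟫_A := by
  rw [← star_ip, ip_rsmul_right, star_mul, star_ip]

theorem ip_sub_right [StarModule ℂ A] (x y z : E) : ⟪x, y - z⟫_A = ⟪x, y⟫_A - ⟪x, z⟫_A := by
  rw [sub_eq_add_neg, ← neg_one_smul ℂ z, ip_add_right, ip_smul_right, neg_one_smul,
    sub_eq_add_neg]

theorem ip_sub_left [StarModule ℂ A] (x y z : E) : ⟪x - y, z⟫_A = ⟪x, z⟫_A - ⟪y, z⟫_A := by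
  rw [← star_ip, ip_sub_right, star_sub, star_ip, star_ip]

variable (A) in
theorem ext_ip [StarModule ℂ A] {x y : E} (h : ∀ z : E, ⟪z, x⟫_A = ⟪z, y⟫_A) : x = y := by
  rw [← sub_eq_zero]
  apply ip_self_eq_zero (A := A)
  rw [ip_sub_right, h, sub_self]

end Algebra

variable {A : Type*} [NonUnitalRing A] [StarRing A] [Module ℂ A] [IsScalarTower ℂ A A]
  [SMulCommClass ℂ A A] [StarModule ℂ A] [TopologicalSpace A]
variable {E : Type*} [AddCommGroup E] [Module ℂ E] [PreHilbertModule A E]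

theorem cauchySchwarz_sq (p : CStarSeminorm A) (x y : E) :
    p ⟪x, y⟫_A ^ 2 ≤ p ⟪x, x⟫_A * p ⟪y, y⟫_A := by
  refine p.sq_le (star_ip x x) (fun t => ?_)
  obtain ⟨b, hb⟩ := ip_self_nonneg (A := A) (rsmul ((t : ℂ) • x) ⟪x, y⟫_A - y)
  refine ⟨b, hb ▸ ?_⟩
  simp only [ip_sub_left, ip_sub_right, ip_rsmul_left, ip_rsmul_right, ip_smul_left,
    ip_smul_right, star_ip, smul_mul_assoc, mul_smul_comm, smul_smul, sub_mul,
    RCLike.star_def, Complex.conj_ofReal, mul_assoc, smul_sub]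
  have h2 : ((t ^ 2 : ℝ) : ℂ) = (t : ℂ) * t := by push_cast; ring
  have h3 : ((2 * t : ℝ) : ℂ) = (t : ℂ) + t := by push_cast; ring
  rw [h2, h3]
  module

/-- The seminorm `x ↦ √(p ⟪x, x⟫)` on a pre-Hilbert module. -/
noncomputable def seminorm (E : Type*) [AddCommGroup E] [Module ℂ E] [PreHilbertModule A E]
    (p : CStarSeminorm A) : Seminorm ℂ E :=
  Seminorm.of (fun x : E => √(p ⟪x, x⟫_A))
    (by
      intro x y
      have hxy : p ⟪x, y⟫_A ≤ √(p ⟪x, x⟫_A) * √(p ⟪y, y⟫_A) := by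
        rw [← Real.sqrt_mul (p.nonneg _)]
        exact Real.le_sqrt_of_sq_le (cauchySchwarz_sq p x y)
      have hyx : p ⟪y, x⟫_A = p ⟪x, y⟫_A := by rw [← star_ip, p.star_eq]
      refine Real.sqrt_le_iff.mpr ⟨by positivity, ?_⟩
      rw [ip_add_left, ip_add_right, ip_add_right]
      have h1 := map_add_le_add p.toSeminorm (⟪x, x⟫_A + ⟪x, y⟫_A) (⟪y, x⟫_A + ⟪y, y⟫_A)
      have h2 := map_add_le_add p.toSeminorm ⟪x, x⟫_A ⟪x, y⟫_A
      have h3 := map_add_le_add p.toSeminorm ⟪y, x⟫_A ⟪y, y⟫_A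
      have h4 := Real.sq_sqrt (p.nonneg ⟪x, x⟫_A)
      have h5 := Real.sq_sqrt (p.nonneg ⟪y, y⟫_A)
      nlinarith)
    (by
      intro c x
      rw [ip_smul_left, ip_smul_right, smul_smul, map_smul_eq_mul, RCLike.star_def,
        RCLike.conj_mul]
      rw [Real.sqrt_mul (norm_nonneg _)]
      congr 1
      rw [← RCLike.ofReal_pow, RCLike.norm_ofReal, abs_of_nonneg (by positivity),
        Real.sqrt_sq (norm_nonneg _)])

theorem seminorm_apply (p : CStarSeminorm A) (x : E) : seminorm E p x = √(p ⟪x, x⟫_A) := rfl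

theorem seminorm_sq (p : CStarSeminorm A) (x : E) : seminorm E p x ^ 2 = p ⟪x, x⟫_A :=
  Real.sq_sqrt (p.nonneg _)

theorem cauchySchwarz (p : CStarSeminorm A) (x y : E) :
    p ⟪x, y⟫_A ≤ seminorm E p x * seminorm E p y := by
  rw [seminorm_apply, seminorm_apply, ← Real.sqrt_mul (p.nonneg _)]
  exact Real.le_sqrt_of_sq_le (cauchySchwarz_sq p x y)

end PreHilbertModule

section HilbertModule

variable (A : Type*) [NonUnitalRing A] [StarRing A] [Module ℂ A] [IsScalarTower ℂ A A]
  [SMulCommClass ℂ A A] [StarModule ℂ A] [TopologicalSpace A]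

/-- A Hilbert `A`-module: a pre-Hilbert `A`-module which is complete for the uniform structure given
by the seminorms `x ↦ √(p ⟪x, x⟫)`, with `p` a continuous C*-seminorm on `A`. -/
class HilbertModule (E : Type*) [AddCommGroup E] [Module ℂ E] [UniformSpace E]
    extends PreHilbertModule A E where
  isUniformAddGroup : IsUniformAddGroup E
  withSeminorms : WithSeminorms (fun p : CStarSeminorm A => PreHilbertModule.seminorm E p)
  complete : CompleteSpace E

/-- The linear span of the inner products `⟪x, y⟫`. -/
def innerSpan (E : Type*) [AddCommGroup E] [Module ℂ E] [PreHilbertModule A E] : Submodule ℂ A :=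
  Submodule.span ℂ {a : A | ∃ x y : E, ⟪x, y⟫_A = a}

/-- A Hilbert `A`-module is full when the closed linear span of its inner products is `A`. -/
def IsFull (E : Type*) [AddCommGroup E] [Module ℂ E] [PreHilbertModule A E] : Prop :=
  closure (innerSpan A E : Set A) = Set.univ

end HilbertModule

/-! ### Adjointable operators -/

section Adjointable

open PreHilbertModule

/-- `T` commutes with the right action of `A`. -/
def IsModuleMap (A : Type*) [NonUnitalRing A] [StarRing A] [Module ℂ A] {E : Type*}
    [AddCommGroup E] [Module ℂ E] [PreHilbertModule A E] (T : Module.End ℂ E) : Prop :=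
  ∀ (x : E) (a : A), T (rsmul x a) = rsmul (T x) a

/-- `S` is an adjoint of `T`. -/
def IsAdjointPair (A : Type*) [NonUnitalRing A] [StarRing A] [Module ℂ A] {E : Type*}
    [AddCommGroup E] [Module ℂ E] [PreHilbertModule A E] (T S : Module.End ℂ E) : Prop := ∀ x y : E, ⟪T x, y⟫_A = ⟪x, S y⟫_A

theorem IsAdjointPair.symm {A : Type*} [NonUnitalRing A] [StarRing A] [Module ℂ A]
    {E : Type*} [AddCommGroup E] [Module ℂ E] [PreHilbertModule A E] {T S : Module.End ℂ E} (h : IsAdjointPair A T S) :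
    IsAdjointPair A S T := by
  intro x y
  rw [← star_ip, ← h, star_ip]

variable (A : Type*) [NonUnitalRing A] [StarRing A] [Module ℂ A] [IsScalarTower ℂ A A]
  [SMulCommClass ℂ A A] [StarModule ℂ A] [TopologicalSpace A]
variable (E : Type*) [AddCommGroup E] [Module ℂ E] [PreHilbertModule A E]

variable {E} in
/-- `T` is bounded for each of the seminorms of `E`. -/
def IsBoundedMap (T : Module.End ℂ E) : Prop :=
  ∀ p : CStarSeminorm A, ∃ k : ℝ, 0 < k ∧ ∀ x : E, seminorm E p (T x) ≤ k * seminorm E p x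

variable {A E} in
theorem IsAdjointPair.isBoundedMap {T S : Module.End ℂ E} (h : IsAdjointPair A T S)
    {p : CStarSeminorm A} {k : ℝ} (hT : ∀ x : E, seminorm E p (T x) ≤ k * seminorm E p x) (x : E) :
    seminorm E p (S x) ≤ k * seminorm E p x := by
  have h1 : seminorm E p (S x) ^ 2 ≤ (k * seminorm E p x) * seminorm E p (S x) := by
    rw [seminorm_sq, ← h]
    refine (cauchySchwarz p _ _).trans ?_
    have := mul_le_mul_of_nonneg_right (hT (S x)) (apply_nonneg (seminorm E p) x)
    linarith
  by_contra hc
  push Not at hc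
  rcases (apply_nonneg (seminorm E p) (S x)).eq_or_lt with h0 | h0
  · have h2 := hT x
    rcases (apply_nonneg (seminorm E p) x).eq_or_lt with h3 | h3
    · rw [← h0, ← h3] at hc; simp at hc
    · have h4 : 0 ≤ k * seminorm E p x := (apply_nonneg (seminorm E p) (T x)).trans h2
      linarith
  · nlinarith

/-- The algebra of all bounded adjointable `A`-module maps on `E`. -/
def adjointableSubalgebra : Subalgebra ℂ (Module.End ℂ E) where
  carrier := {T | IsModuleMap A T ∧ IsBoundedMap A T ∧
    ∃ S : Module.End ℂ E, IsModuleMap A S ∧ IsAdjointPair A T S}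
  mul_mem' := by
    rintro T₁ T₂ ⟨hm₁, hb₁, S₁, hS₁, ha₁⟩ ⟨hm₂, hb₂, S₂, hS₂, ha₂⟩
    refine ⟨fun x a => ?_, fun p => ?_, S₂ * S₁, fun x a => ?_, fun x y => ?_⟩
    · simp [hm₁ _ _, hm₂ _ _]
    · obtain ⟨k₁, hk₁, h₁⟩ := hb₁ p
      obtain ⟨k₂, hk₂, h₂⟩ := hb₂ p
      refine ⟨k₁ * k₂, mul_pos hk₁ hk₂, fun x => ?_⟩
      calc seminorm E p (T₁ (T₂ x)) ≤ k₁ * seminorm E p (T₂ x) := h₁ _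
        _ ≤ k₁ * (k₂ * seminorm E p x) := by gcongr; exact h₂ x
        _ = k₁ * k₂ * seminorm E p x := by ring
    · simp [hS₁ _ _, hS₂ _ _]
    · simp [ha₁ _ _, ha₂ _ _]
  add_mem' := by
    rintro T₁ T₂ ⟨hm₁, hb₁, S₁, hS₁, ha₁⟩ ⟨hm₂, hb₂, S₂, hS₂, ha₂⟩
    refine ⟨fun x a => ?_, fun p => ?_, S₁ + S₂, fun x a => ?_, fun x y => ?_⟩
    · simp [hm₁ _ _, hm₂ _ _, add_rsmul]
    · obtain ⟨k₁, hk₁, h₁⟩ := hb₁ p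
      obtain ⟨k₂, hk₂, h₂⟩ := hb₂ p
      refine ⟨k₁ + k₂, add_pos hk₁ hk₂, fun x => ?_⟩
      have := map_add_le_add (seminorm E p) (T₁ x) (T₂ x)
      have := h₁ x
      have := h₂ x
      rw [LinearMap.add_apply]
      linarith
    · simp [hS₁ _ _, hS₂ _ _, add_rsmul]
    · simp [ha₁ _ _, ha₂ _ _, ip_add_left, ip_add_right]
  algebraMap_mem' := by
    intro c
    refine ⟨fun x a => ?_, fun p => ?_, algebraMap ℂ _ (star c), fun x a => ?_, fun x y => ?_⟩
    · simp [Module.algebraMap_end_apply, smul_rsmul]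
    · refine ⟨‖c‖ + 1, by positivity, fun x => ?_⟩
      rw [Module.algebraMap_end_apply, map_smul_eq_mul]
      have := apply_nonneg (seminorm E p) x
      nlinarith
    · simp [Module.algebraMap_end_apply, smul_rsmul]
    · simp [Module.algebraMap_end_apply, ip_smul_left, ip_smul_right]

/-- `L_A(E)`, the bounded adjointable `A`-module maps on `E`. -/
def Adjointable : Type _ := ↥(adjointableSubalgebra A E)

namespace Adjointable

noncomputable instance : Ring (Adjointable A E) := inferInstanceAs (Ring ↥(adjointableSubalgebra A E))

noncomputable instance : Algebra ℂ (Adjointable A E) :=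
  inferInstanceAs (Algebra ℂ ↥(adjointableSubalgebra A E))

variable {A E}

/-- The underlying linear map of an adjointable operator. -/
def toEnd (T : Adjointable A E) : Module.End ℂ E := T.1

theorem ext {S T : Adjointable A E} (h : ∀ x, S.toEnd x = T.toEnd x) : S = T :=
  Subtype.ext (LinearMap.ext h)

theorem toEnd_add (S T : Adjointable A E) : (S + T).toEnd = S.toEnd + T.toEnd := rfl
theorem toEnd_mul (S T : Adjointable A E) : (S * T).toEnd = S.toEnd * T.toEnd := rfl
theorem toEnd_smul (c : ℂ) (T : Adjointable A E) : (c • T).toEnd = c • T.toEnd := rfl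

/-- The adjoint. -/
noncomputable instance : Star (Adjointable A E) where
  star T := ⟨T.2.2.2.choose, T.2.2.2.choose_spec.1, fun p => by
      obtain ⟨k, hk, h⟩ := T.2.2.1 p
      exact ⟨k, hk, T.2.2.2.choose_spec.2.isBoundedMap h⟩,
    T.1, T.2.1, T.2.2.2.choose_spec.2.symm⟩

theorem inner_toEnd_left (T : Adjointable A E) (x y : E) :
    ⟪T.toEnd x, y⟫_A = ⟪x, (star T).toEnd y⟫_A := T.2.2.2.choose_spec.2 x y

theorem inner_toEnd_right (T : Adjointable A E) (x y : E) :
    ⟪x, T.toEnd y⟫_A = ⟪(star T).toEnd x, y⟫_A := by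
  rw [← star_ip, inner_toEnd_left, star_ip]

noncomputable instance : StarRing (Adjointable A E) where
  star_involutive T := ext fun x => ext_ip A fun z => by
    rw [← inner_toEnd_left, ← inner_toEnd_right]
  star_mul S T := ext fun x => ext_ip A fun z => by
    rw [← inner_toEnd_left, toEnd_mul, toEnd_mul, Module.End.mul_apply, Module.End.mul_apply,
      inner_toEnd_left, inner_toEnd_left]
  star_add S T := ext fun x => ext_ip A fun z => by
    rw [← inner_toEnd_left, toEnd_add, toEnd_add, LinearMap.add_apply, LinearMap.add_apply,
      ip_add_left, ip_add_right, inner_toEnd_left, inner_toEnd_left]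

instance : StarModule ℂ (Adjointable A E) where
  star_smul c T := ext fun x => ext_ip A fun z => by
    rw [← inner_toEnd_left, toEnd_smul, toEnd_smul, LinearMap.smul_apply, LinearMap.smul_apply,
      ip_smul_left, ip_smul_right, inner_toEnd_left]

theorem toEnd_rsmul (T : Adjointable A E) (x : E) (a : A) :
    T.toEnd (rsmul x a) = rsmul (T.toEnd x) a := T.2.1 x a

/-- The constants `k ≥ 0` with `p (T x) ≤ k * p x` for all `x`, for the seminorm of `E` given
by `p`. -/
def bounds (p : CStarSeminorm A) (T : Adjointable A E) : Set ℝ :=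
  {k | 0 ≤ k ∧ ∀ x : E, seminorm E p (T.toEnd x) ≤ k * seminorm E p x}

theorem bounds_nonempty (p : CStarSeminorm A) (T : Adjointable A E) : (bounds p T).Nonempty := by
  obtain ⟨k, hk, h⟩ := T.2.2.1 p
  exact ⟨k, hk.le, h⟩

theorem bounds_bddBelow (p : CStarSeminorm A) (T : Adjointable A E) : BddBelow (bounds p T) :=
  ⟨0, fun _ hk => hk.1⟩

theorem sInf_mem_bounds (p : CStarSeminorm A) (T : Adjointable A E) :
    sInf (bounds p T) ∈ bounds p T := by
  refine IsClosed.csInf_mem ?_ (bounds_nonempty p T) (bounds_bddBelow p T)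
  have : bounds p T = {k | 0 ≤ k} ∩ ⋂ x : E, {k | seminorm E p (T.toEnd x) ≤ k * seminorm E p x} := by
    ext k; simp [bounds]
  rw [this]
  exact (isClosed_le continuous_const continuous_id).inter (isClosed_iInter fun x =>
    isClosed_le continuous_const (continuous_id.mul continuous_const))

/-- The operator seminorm of `T`: the least `k ≥ 0` such that `p (T x) ≤ k * p x` for all `x`, that
is, the operator norm of the map induced by `T` on the quotient of `E` by the kernel of the seminorm
given by `p`. -/
noncomputable def opSeminorm (p : CStarSeminorm A) : Seminorm ℂ (Adjointable A E) :=
  Seminorm.ofSMulLE (fun T => sInf (bounds p T))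
    (by
      refine le_antisymm (csInf_le (bounds_bddBelow p _) ⟨le_rfl, fun x => ?_⟩)
        (sInf_mem_bounds p _).1
      have : (0 : Adjointable A E).toEnd x = 0 := rfl
      rw [this, map_zero, zero_mul])
    (by
      intro S T
      have hS := sInf_mem_bounds p S
      have hT := sInf_mem_bounds p T
      refine csInf_le (bounds_bddBelow p _) ⟨add_nonneg hS.1 hT.1, fun x => ?_⟩
      have h1 := map_add_le_add (seminorm E p) (S.toEnd x) (T.toEnd x)
      have h2 := hS.2 x
      have h3 := hT.2 x
      rw [toEnd_add, LinearMap.add_apply, add_mul]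
      linarith)
    (by
      intro c T
      have hT := sInf_mem_bounds p T
      refine csInf_le (bounds_bddBelow p _) ⟨mul_nonneg (norm_nonneg _) hT.1, fun x => ?_⟩
      rw [toEnd_smul, LinearMap.smul_apply, map_smul_eq_mul, mul_assoc]
      exact mul_le_mul_of_nonneg_left (hT.2 x) (norm_nonneg _))

theorem le_opSeminorm (p : CStarSeminorm A) (T : Adjointable A E) (x : E) :
    seminorm E p (T.toEnd x) ≤ opSeminorm p T * seminorm E p x := (sInf_mem_bounds p T).2 x

theorem opSeminorm_le (p : CStarSeminorm A) (T : Adjointable A E) {k : ℝ} (hk : 0 ≤ k)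
    (h : ∀ x : E, seminorm E p (T.toEnd x) ≤ k * seminorm E p x) : opSeminorm p T ≤ k :=
  csInf_le (bounds_bddBelow p T) ⟨hk, h⟩

theorem opSeminorm_star_le (p : CStarSeminorm A) (T : Adjointable A E) :
    opSeminorm p (star T) ≤ opSeminorm p T :=
  opSeminorm_le p _ (apply_nonneg _ _) (IsAdjointPair.isBoundedMap (T := T.toEnd)
    (fun x y => inner_toEnd_left T x y) (le_opSeminorm p T))

theorem opSeminorm_mul_le (p : CStarSeminorm A) (S T : Adjointable A E) :
    opSeminorm p (S * T) ≤ opSeminorm p S * opSeminorm p T := by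
  refine opSeminorm_le p _ (mul_nonneg (apply_nonneg _ _) (apply_nonneg _ _)) (fun x => ?_)
  calc seminorm E p (S.toEnd (T.toEnd x)) ≤ opSeminorm p S * seminorm E p (T.toEnd x) :=
        le_opSeminorm p S _
    _ ≤ opSeminorm p S * (opSeminorm p T * seminorm E p x) := by
        exact mul_le_mul_of_nonneg_left (le_opSeminorm p T x) (apply_nonneg _ _)
    _ = _ := by ring

/-- The topology of `L_A(E)`, given by the operator seminorms. -/
noncomputable instance : TopologicalSpace (Adjointable A E) :=
  (SeminormFamily.moduleFilterBasis
    (fun p : CStarSeminorm A => (opSeminorm p : Seminorm ℂ (Adjointable A E)))).topology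

theorem withSeminorms :
    WithSeminorms (fun p : CStarSeminorm A => (opSeminorm p : Seminorm ℂ (Adjointable A E))) :=
  ⟨rfl⟩

/-- The rank-one operator `θ_{x,y} : z ↦ x ⟪y, z⟫`. -/
def theta (x y : E) : Adjointable A E :=
  have hb : ∀ x y : E, ∀ p : CStarSeminorm A, ∀ z : E,
      seminorm E p (rsmul x ⟪y, z⟫_A) ≤ seminorm E p x * seminorm E p y * seminorm E p z := by
    intro x y p z
    have h1 : seminorm E p (rsmul x ⟪y, z⟫_A) ≤ seminorm E p x * p ⟪y, z⟫_A := by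
      refine (sq_le_sq₀ (apply_nonneg _ _) (mul_nonneg (apply_nonneg _ _) (p.nonneg _))).mp ?_
      rw [mul_pow, seminorm_sq, seminorm_sq, ip_rsmul_right, ip_rsmul_left]
      refine (p.mul_le _ _).trans ?_
      have h2 := p.mul_le (star ⟪y, z⟫_A) ⟪x, x⟫_A
      rw [p.star_eq] at h2
      nlinarith [p.nonneg ⟪y, z⟫_A]
    have h3 := mul_le_mul_of_nonneg_left (cauchySchwarz p y z) (apply_nonneg (seminorm E p) x)
    linarith
  have hl : ∀ x y : E, ∃ T : Module.End ℂ E, ∀ z, T z = rsmul x ⟪y, z⟫_A := fun x y =>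
    ⟨{ toFun := fun z => rsmul x ⟪y, z⟫_A
       map_add' := fun z w => by rw [ip_add_right, rsmul_add]
       map_smul' := fun c z => by rw [ip_smul_right, rsmul_smul, RingHom.id_apply] },
      fun _ => rfl⟩
  ⟨{ toFun := fun z => rsmul x ⟪y, z⟫_A
     map_add' := fun z w => by rw [ip_add_right, rsmul_add]
     map_smul' := fun c z => by rw [ip_smul_right, rsmul_smul, RingHom.id_apply] },
    fun z a => by
      change rsmul x ⟪y, rsmul z a⟫_A = rsmul (rsmul x ⟪y, z⟫_A) a
      rw [ip_rsmul_right, rsmul_mul],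
    fun p => ⟨seminorm E p x * seminorm E p y + 1,
      add_pos_of_nonneg_of_pos (mul_nonneg (apply_nonneg _ _) (apply_nonneg _ _)) one_pos,
      fun z => (hb x y p z).trans (by
        have := apply_nonneg (seminorm E p) z
        linarith)⟩,
    (hl y x).choose, fun z a => by
      rw [(hl y x).choose_spec, (hl y x).choose_spec, ip_rsmul_right, rsmul_mul],
    fun z w => by
      rw [(hl y x).choose_spec, ip_rsmul_right]
      change ⟪rsmul x ⟪y, z⟫_A, w⟫_A = _
      rw [ip_rsmul_left, star_ip]⟩

theorem theta_toEnd (x y z : E) : (theta x y : Adjointable A E).toEnd z = rsmul x ⟪y, z⟫_A := rfl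

theorem star_theta (x y : E) : star (theta x y : Adjointable A E) = theta y x :=
  ext fun z => ext_ip A fun w => by
    rw [← inner_toEnd_left, theta_toEnd, theta_toEnd, ip_rsmul_left, ip_rsmul_right, star_ip]

theorem theta_mul (x y : E) (T : Adjointable A E) : theta x y * T = theta x ((star T).toEnd y) :=
  ext fun z => by
    rw [toEnd_mul, Module.End.mul_apply, theta_toEnd, theta_toEnd, inner_toEnd_right]

end Adjointable

end Adjointable

/-! ### Compact operators and the ideal generated by the inner products -/

section Closed

theorem continuous_of_seminorm_bound {X Y ι κ : Type*} [AddCommGroup X] [Module ℂ X]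
    [TopologicalSpace X] [AddCommGroup Y] [Module ℂ Y] [TopologicalSpace Y] [Nonempty ι]
    [Nonempty κ] {σ : ℂ →+* ℂ} [RingHomIsometric σ] {p : SeminormFamily ℂ X ι}
    {q : SeminormFamily ℂ Y κ} (hp : WithSeminorms p) (hq : WithSeminorms q) (f : X →ₛₗ[σ] Y)
    (h : ∀ i, ∃ (C : ℝ) (j : ι), ∀ x, q i (f x) ≤ C * p j x) : Continuous f := by
  refine WithSeminorms.continuous_of_isBounded hp hq f (Seminorm.IsBounded.of_real fun i => ?_)
  obtain ⟨C, j, hC⟩ := h i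
  refine ⟨{j}, C, fun x => ?_⟩
  simpa using hC x

/-- The closure of a linear subspace which is a right ideal stable under the involution. -/
def closedStarSubalgebra {R : Type*} [NonUnitalRing R] [StarRing R] [Module ℂ R]
    [IsScalarTower ℂ R R] [SMulCommClass ℂ R R] [StarModule ℂ R] [TopologicalSpace R]
    {ι : Type*} [Nonempty ι] {p : SeminormFamily ℂ R ι} (hp : WithSeminorms p)
    (hmul : ∀ i a b, p i (a * b) ≤ p i a * p i b) (hstar : ∀ i a, p i (star a) ≤ p i a)
    (S : Submodule ℂ R) (hS : ∀ s ∈ S, ∀ r, s * r ∈ S) (hS' : ∀ s ∈ S, star s ∈ S) :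
    NonUnitalStarSubalgebra ℂ R :=
  have := hp.topologicalAddGroup
  have := hp.continuousSMul
  { S.topologicalClosure with
    carrier := closure S
    mul_mem' := by
      intro a b ha _
      have hc : Continuous (LinearMap.mulRight ℂ b) :=
        continuous_of_seminorm_bound hp hp _ (fun i => ⟨p i b, i, fun x => by
          rw [LinearMap.mulRight_apply, mul_comm (p i b)]; exact hmul i x b⟩)
      exact map_mem_closure (f := fun x => x * b) hc ha (fun s hs => hS s hs b)
    star_mem' := by
      intro a ha
      have hc : Continuous (starLinearEquiv ℂ : R ≃ₗ⋆[ℂ] R) :=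
        continuous_of_seminorm_bound hp hp (starLinearEquiv ℂ : R ≃ₗ⋆[ℂ] R).toLinearMap
          (fun i => ⟨1, i, fun x => by rw [one_mul]; exact hstar i x⟩)
      exact map_mem_closure (f := fun x => star x) hc ha hS' }

end Closed

section Compact

open PreHilbertModule Adjointable

variable (A : Type*) [NonUnitalRing A] [StarRing A] [Module ℂ A] [IsScalarTower ℂ A A]
  [SMulCommClass ℂ A A] [StarModule ℂ A] [TopologicalSpace A]
variable (E : Type*) [AddCommGroup E] [Module ℂ E] [PreHilbertModule A E]

/-- `K_A(E)`, the compact operators on `E`: the closed linear span in `L_A(E)` of the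
operators `θ_{x,y}`. It carries the topology induced by `L_A(E)`. -/
noncomputable def compactOperators : NonUnitalStarSubalgebra ℂ (Adjointable A E) :=
  closedStarSubalgebra (Adjointable.withSeminorms (A := A) (E := E)) opSeminorm_mul_le
    opSeminorm_star_le (Submodule.span ℂ {T | ∃ x y : E, theta x y = T})
    (by
      intro s hs T
      induction hs using Submodule.span_induction with
      | mem s h =>
        obtain ⟨x, y, rfl⟩ := h
        exact Submodule.subset_span ⟨x, _, (theta_mul x y T).symm⟩
      | zero => rw [zero_mul]; exact Submodule.zero_mem _
      | add s t _ _ h₁ h₂ => rw [add_mul]; exact Submodule.add_mem _ h₁ h₂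
      | smul c s _ h => rw [smul_mul_assoc]; exact Submodule.smul_mem _ c h)
    (by
      intro s hs
      induction hs using Submodule.span_induction with
      | mem s h =>
        obtain ⟨x, y, rfl⟩ := h
        exact Submodule.subset_span ⟨y, x, (star_theta x y).symm⟩
      | zero => rw [star_zero]; exact Submodule.zero_mem _
      | add s t _ _ h₁ h₂ => rw [star_add]; exact Submodule.add_mem _ h₁ h₂
      | smul c s _ h => rw [star_smul]; exact Submodule.smul_mem _ _ h)

end Compact

/-- `⟨V, V⟩`, the closed linear span of the inner products of a Hilbert module `V` over a locally
C*-algebra `A`. It carries the topology induced by `A`. -/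
noncomputable def innerIdeal (A : Type*) [LocallyCStarAlgebra A] (V : Type*) [AddCommGroup V]
    [Module ℂ V] [PreHilbertModule A V] : NonUnitalStarSubalgebra ℂ A :=
  closedStarSubalgebra LocallyCStarAlgebra.withSeminorms (fun p => p.mul_le)
    (fun p a => (p.star_eq a).le) (innerSpan A V)
    (by
      intro s hs a
      unfold innerSpan at hs ⊢
      induction hs using Submodule.span_induction with
      | mem s h =>
        obtain ⟨x, y, rfl⟩ := h
        exact Submodule.subset_span ⟨x, _, PreHilbertModule.ip_rsmul_right x y a⟩
      | zero => rw [zero_mul]; exact Submodule.zero_mem _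
      | add s t _ _ h₁ h₂ => rw [add_mul]; exact Submodule.add_mem _ h₁ h₂
      | smul c s _ h => rw [smul_mul_assoc]; exact Submodule.smul_mem _ c h)
    (by
      intro s hs
      unfold innerSpan at hs ⊢
      induction hs using Submodule.span_induction with
      | mem s h =>
        obtain ⟨x, y, rfl⟩ := h
        exact Submodule.subset_span ⟨y, x, (PreHilbertModule.star_ip y x).symm⟩
      | zero => rw [star_zero]; exact Submodule.zero_mem _
      | add s t _ _ h₁ h₂ => rw [star_add]; exact Submodule.add_mem _ h₁ h₂
      | smul c s _ h => rw [star_smul]; exact Submodule.smul_mem _ _ h)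

theorem inner_mem_innerIdeal (A : Type*) [LocallyCStarAlgebra A] {V : Type*} [AddCommGroup V]
    [Module ℂ V] [PreHilbertModule A V] (x y : V) : ⟪x, y⟫_A ∈ innerIdeal A V :=
  subset_closure (Submodule.subset_span ⟨x, y, rfl⟩)

/-! ### Morita equivalence -/

/-- A full Hilbert `A`-module `E` together with an isomorphism of topological `*`-algebras
from `B` onto `K_A(E)`. -/
structure ImprimitivityModule (A B : Type u) [NonUnitalRing A] [StarRing A] [Module ℂ A]
    [IsScalarTower ℂ A A] [SMulCommClass ℂ A A] [StarModule ℂ A] [TopologicalSpace A]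
    [NonUnitalRing B] [StarRing B] [Module ℂ B] [TopologicalSpace B] : Type (u + 1) where
  E : Type u
  [addCommGroup : AddCommGroup E]
  [module : Module ℂ E]
  [uniformSpace : UniformSpace E]
  [hilbertModule : HilbertModule A E]
  isFull : IsFull A E
  iso : B ≃⋆ₐ[ℂ] compactOperators A E
  continuous_iso : Continuous iso
  continuous_iso_symm : Continuous iso.symm

attribute [instance] ImprimitivityModule.addCommGroup ImprimitivityModule.module
  ImprimitivityModule.uniformSpace ImprimitivityModule.hilbertModule

/-- Strong Morita equivalence: there is a full Hilbert `A`-module `E` such that `B` and `K_A(E)`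
are isomorphic. -/
def StronglyMoritaEquivalent (A B : Type u) [NonUnitalRing A] [StarRing A] [Module ℂ A]
    [IsScalarTower ℂ A A] [SMulCommClass ℂ A A] [StarModule ℂ A] [TopologicalSpace A]
    [NonUnitalRing B] [StarRing B] [Module ℂ B] [TopologicalSpace B] : Prop :=
  Nonempty (ImprimitivityModule A B)

/-- The Hilbert modules `V` over `A` and `W` over `B` are Morita equivalent when `K_A(V)` and
`K_B(W)` are strongly Morita equivalent. -/
def MoritaEquivalent (A B V W : Type u) [LocallyCStarAlgebra A] [LocallyCStarAlgebra B]
    [AddCommGroup V] [Module ℂ V] [UniformSpace V] [HilbertModule A V]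
    [AddCommGroup W] [Module ℂ W] [UniformSpace W] [HilbertModule B W] : Prop :=
  StronglyMoritaEquivalent (compactOperators A V) (compactOperators B W)

/-! ### Representations -/

section Representations

variable (A V : Type u) [LocallyCStarAlgebra A] [AddCommGroup V] [Module ℂ V] [UniformSpace V]
  [HilbertModule A V]

/-- A representation `Φ : V → B(H, K)` of a Hilbert `A`-module `V`, with its associated
representation `φ : A → B(H)`. -/
structure ModuleRep : Type (u + 1) where
  H : Type u
  K : Type u
  [normedAddCommGroupH : NormedAddCommGroup H]
  [innerProductSpaceH : InnerProductSpace ℂ H]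
  [completeSpaceH : CompleteSpace H]
  [normedAddCommGroupK : NormedAddCommGroup K]
  [innerProductSpaceK : InnerProductSpace ℂ K]
  [completeSpaceK : CompleteSpace K]
  φ : A →⋆ₙₐ[ℂ] (H →L[ℂ] H)
  continuous_φ : Continuous φ
  Φ : V → (H →L[ℂ] K)
  adjoint_comp : ∀ x y : V, (ContinuousLinearMap.adjoint (Φ x)) ∘L (Φ y) = φ ⟪x, y⟫_A

attribute [instance] ModuleRep.normedAddCommGroupH ModuleRep.innerProductSpaceH
  ModuleRep.completeSpaceH ModuleRep.normedAddCommGroupK ModuleRep.innerProductSpaceK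
  ModuleRep.completeSpaceK

variable {A V}

/-- `Φ` is non-degenerate: the closed linear span of `Φ(V)H` is `K` and the closed linear span
of `Φ(V)* K` is `H`. -/
def ModuleRep.IsNondegenerate (Φ : ModuleRep A V) : Prop :=
  closure (Submodule.span ℂ {k : Φ.K | ∃ (v : V) (h : Φ.H), Φ.Φ v h = k} : Set Φ.K) = Set.univ ∧
  closure (Submodule.span ℂ {h : Φ.H | ∃ (v : V) (k : Φ.K),
    ContinuousLinearMap.adjoint (Φ.Φ v) k = h} : Set Φ.H) = Set.univ

/-- Unitary equivalence of representations of `V`. -/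
def ModuleRep.UnitarilyEquivalent (Φ₁ Φ₂ : ModuleRep A V) : Prop :=
  ∃ (U₁ : Φ₁.H ≃ₗᵢ[ℂ] Φ₂.H) (U₂ : Φ₁.K ≃ₗᵢ[ℂ] Φ₂.K),
    ∀ (v : V) (h : Φ₁.H), U₂ (Φ₁.Φ v h) = Φ₂.Φ v (U₁ h)

variable (A V) in
/-- The non-degenerate representations of `V`. -/
def NondegRep : Type (u + 1) := {Φ : ModuleRep A V // Φ.IsNondegenerate}

variable (A V) in
/-- Unitary equivalence, as an equivalence relation on the non-degenerate representations. -/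
instance NondegRep.setoid : Setoid (NondegRep A V) where
  r Φ₁ Φ₂ := Φ₁.1.UnitarilyEquivalent Φ₂.1
  iseqv :=
    { refl := fun Φ => ⟨LinearIsometryEquiv.refl ℂ _, LinearIsometryEquiv.refl ℂ _, fun _ _ => rfl⟩
      symm := by
        rintro Φ₁ Φ₂ ⟨U₁, U₂, h⟩
        refine ⟨U₁.symm, U₂.symm, fun v x => ?_⟩
        rw [LinearIsometryEquiv.symm_apply_eq, h, LinearIsometryEquiv.apply_symm_apply]
      trans := by
        rintro Φ₁ Φ₂ Φ₃ ⟨U₁, U₂, h⟩ ⟨U₁', U₂', h'⟩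
        refine ⟨U₁.trans U₁', U₂.trans U₂', fun v x => ?_⟩
        rw [LinearIsometryEquiv.trans_apply, LinearIsometryEquiv.trans_apply, h, h'] }

variable (A V) in
/-- The unitary equivalence classes of non-degenerate representations of `V`. -/
def RepClass : Type (u + 1) := Quotient (NondegRep.setoid A V)

/-- The unitary equivalence class of a non-degenerate representation. -/
def NondegRep.toClass (Φ : NondegRep A V) : RepClass A V := Quotient.mk _ Φ

end Representations

section Induction

variable {A B V W : Type u} [LocallyCStarAlgebra A] [LocallyCStarAlgebra B]
  [AddCommGroup V] [Module ℂ V] [UniformSpace V] [HilbertModule A V]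
  [AddCommGroup W] [Module ℂ W] [UniformSpace W] [HilbertModule B W]

/-- The action of `⟨W, W⟩` on an imprimitivity module `X` from `⟨V, V⟩` to `⟨W, W⟩`, through the
isomorphism of `⟨W, W⟩` with the compact operators on `X`. -/
noncomputable def ImprimitivityModule.act
    (X : ImprimitivityModule (innerIdeal A V) (innerIdeal B W)) (b : innerIdeal B W) (x : X.E) :
    X.E :=
  (X.iso b : Adjointable (innerIdeal A V) X.E).toEnd x

/-- `Θ` is the representation of `W` Rieffel induced by the representation `Φ` of `V` via `X`:
* its first Hilbert space is the Hausdorff completion of the algebraic tensor product `X ⊗ H`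
  for the form `⟪x ⊗ h, y ⊗ k⟫ = ⟪h, φ(⟪x, y⟫) k⟫`, with canonical map `t`;
* its second one is the Hausdorff completion of the algebraic tensor product `W ⊗ (X ⊗ H)` for the
  form `⟪w ⊗ x ⊗ h, w' ⊗ y ⊗ k⟫ = ⟪h, φ(⟪x, ⟪w, w'⟫ y⟫) k⟫`, with canonical map `s`;
* the associated representation of `⟨W, W⟩` is `b (x ⊗ h) = b x ⊗ h`;
* `Θ w (x ⊗ h) = w ⊗ x ⊗ h`. -/
def IsRieffelInduced (X : ImprimitivityModule (innerIdeal A V) (innerIdeal B W))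
    (Φ : ModuleRep A V) (Θ : ModuleRep B W) : Prop :=
  ∃ (t : X.E ⊗[ℂ] Φ.H →ₗ[ℂ] Θ.H) (s : W ⊗[ℂ] (X.E ⊗[ℂ] Φ.H) →ₗ[ℂ] Θ.K),
    DenseRange t ∧
    (∀ (x y : X.E) (h k : Φ.H), ⟪t (x ⊗ₜ h), t (y ⊗ₜ k)⟫_ℂ =
      ⟪h, Φ.φ ((⟪x, y⟫_(innerIdeal A V) : innerIdeal A V) : A) k⟫_ℂ) ∧
    DenseRange s ∧
    (∀ (w w' : W) (x y : X.E) (h k : Φ.H), ⟪s (w ⊗ₜ (x ⊗ₜ h)), s (w' ⊗ₜ (y ⊗ₜ k))⟫_ℂ =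
      ⟪h, Φ.φ ((⟪x, X.act ⟨⟪w, w'⟫_B, inner_mem_innerIdeal B w w'⟩ y⟫_(innerIdeal A V) :
        innerIdeal A V) : A) k⟫_ℂ) ∧
    (∀ (b : innerIdeal B W) (x : X.E) (h : Φ.H),
      Θ.φ (b : B) (t (x ⊗ₜ h)) = t (X.act b x ⊗ₜ h)) ∧
    (∀ (w : W) (x : X.E) (h : Φ.H), Θ.Φ w (t (x ⊗ₜ h)) = s (w ⊗ₜ (x ⊗ₜ h)))

end Induction

/-!
Write `I = ⟨V, V⟩` and `J = ⟨W, W⟩`. The proof has two halves.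

*The ideals are equivalent.* A Hilbert module `V` is full over `I`, and `K(V)` is the same algebra of
operators over `A` and over `I`; so `V` itself is an equivalence of `I` and `K(V)`
(`stronglyMoritaEquivalent_compactOperators`). What is left is that strong Morita equivalence is
symmetric and transitive. For symmetry (`ImprimitivityModule.symm`) the conjugate of `E` carries the
inner product `θ_{x,y}` with values in `K(E)`. For transitivity
(`StronglyMoritaEquivalent.of_common`) no interior tensor product is needed: if `X` and `Y` are full
`C`-modules with compact operators `A` and `B`, the compact operators from `X` to `Y`, seen in the
corner of the operators on `X ⊕ Y`, form a ternary ring `F` with `F* F` dense in `A` and `F F*` dense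
in `B`, and a ternary ring is an imprimitivity module (`TernaryRing.imprimitivityModule`). Positivity
of the inner products comes from a functional calculus (`IsPos.exists_cfc`). That a C*-seminorm is
dominated by another one, with constant one, always comes from iterating an inequality
`u b ^ 2 ≤ N * u (b* b)` (`le_mul_of_sq_le_mul_star_mul`).

*Induction is a bijection.* A non-degenerate representation of `V` amounts to a non-degenerate
representation of `I`, with the same unitary equivalence (`exists_nondegRep`,
`ModuleRep.unitarilyEquivalent_iff`). Representations `π` of `I` on `H` and `ρ` of `J` on `L`
correspond to each other under Rieffel induction if and only if there are operators `T x : H → L`,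
for `x ∈ E`, with total ranges, adjoints with total ranges, and

  `(T x)* T y = π ⟪x, y⟫`,  `T x (T y)* = ρ ⟪x, y⟫`

(`ImprimitivityModule.Intertwines`, `IsRieffelInduced.exists_intertwines`,
`ImprimitivityModule.Intertwines.isRieffelInduced`); `T x h` plays the role of `x ⊗ h`. This relation
is symmetric: the operators `(T x)*` exhibit `π` as induced from `ρ` along the conjugate module. Hence
it is enough to prove existence and uniqueness of `ρ` for a given `π`. Both hold because total
families of operators are determined up to a unitary by their Gram kernel
(`HasTotalRange.exists_unitary`), and every positive kernel is one: the positivity of `π ⟪x, y⟫` is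
`re_sum_inner_rep_nonneg`, and the space `L` is the Hilbert space with this reproducing kernel
(`exists_dilation`).
-/

open Filter Topology

set_option linter.unusedSectionVars false

/-! ### Completeness and seminorms of locally C*-algebras -/

/-- Completeness of a commutative topological group, phrased without a uniform structure: every
Cauchy filter converges. -/
def IsFilterComplete (X : Type*) [AddCommGroup X] [TopologicalSpace X] : Prop :=
  ∀ F : Filter X, F.NeBot → Tendsto (fun x : X × X => x.1 - x.2) (F ×ˢ F) (𝓝 0) →
    ∃ a, F ≤ 𝓝 a

section FilterComplete

variable {X : Type*} [AddCommGroup X]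

theorem cauchy_iff_tendsto_sub [UniformSpace X] [IsUniformAddGroup X] {F : Filter X} :
    Cauchy F ↔ F.NeBot ∧ Tendsto (fun x : X × X => x.1 - x.2) (F ×ˢ F) (𝓝 0) := by
  unfold Cauchy
  refine and_congr_right fun _ => ?_
  rw [uniformity_eq_comap_nhds_zero_swapped, ← tendsto_iff_comap]

theorem isFilterComplete_iff [UniformSpace X] [IsUniformAddGroup X] :
    IsFilterComplete X ↔ CompleteSpace X := by
  constructor
  · intro h
    refine ⟨fun {F} hF => ?_⟩
    obtain ⟨h1, h2⟩ := cauchy_iff_tendsto_sub.mp hF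
    exact h F h1 h2
  · intro h F h1 h2
    exact CompleteSpace.complete (cauchy_iff_tendsto_sub.mpr ⟨h1, h2⟩)

theorem IsFilterComplete.completeSpace_rightUniformSpace [TopologicalSpace X]
    [IsTopologicalAddGroup X] (h : IsFilterComplete X) :
    @CompleteSpace X (IsTopologicalAddGroup.rightUniformSpace X) := by
  let _ := IsTopologicalAddGroup.rightUniformSpace X
  have := isUniformAddGroup_of_addCommGroup (G := X)
  exact isFilterComplete_iff.mp h

/-- A group which embeds as a closed subgroup of a complete one is complete. -/
theorem IsFilterComplete.of_isClosedEmbedding {Y : Type*} [AddCommGroup Y] [TopologicalSpace X]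
    [TopologicalSpace Y] (h : IsFilterComplete Y) (f : X →+ Y)
    (hf : IsClosedEmbedding f) : IsFilterComplete X := by
  intro F hF hF'
  have h1 : Tendsto (fun y : Y × Y => y.1 - y.2) (F.map f ×ˢ F.map f) (𝓝 0) := by
    rw [prod_map_map_eq, tendsto_map'_iff]
    have h2 : Tendsto f (𝓝 0) (𝓝 0) := by
      have := hf.continuous.tendsto 0
      rwa [map_zero] at this
    refine (h2.comp hF').congr fun x => ?_
    simp
  obtain ⟨y, hy⟩ := h (F.map f) (hF.map f) h1
  obtain ⟨x, rfl⟩ : y ∈ Set.range f := by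
    refine hf.isClosed_range.mem_of_tendsto (f := id) (b := F.map f) hy ?_
    exact eventually_map.mpr (Eventually.of_forall fun x => ⟨x, rfl⟩)
  refine ⟨x, ?_⟩
  rw [hf.isInducing.nhds_eq_comap]
  exact map_le_iff_le_comap.mp hy

/-- A complete subgroup is closed: an inducing homomorphism from a complete group into a Hausdorff
group has closed range. -/
theorem IsFilterComplete.isClosed_range {Y : Type*} [AddCommGroup Y] [TopologicalSpace X]
    [TopologicalSpace Y] [IsTopologicalAddGroup Y] [T2Space Y]
    (h : IsFilterComplete X) (f : X →+ Y) (hf : IsInducing f) : IsClosed (Set.range f) := by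
  rw [isClosed_iff_clusterPt]
  intro y hy
  have hne : (comap f (𝓝 y)).NeBot := by
    rw [comap_neBot_iff]
    intro t ht
    obtain ⟨z, hz, x, rfl⟩ := mem_closure_iff_nhds.mp (mem_closure_iff_clusterPt.mpr hy) t ht
    exact ⟨x, hz⟩
  obtain ⟨x, hx⟩ := h (comap f (𝓝 y)) hne (by
    rw [hf.nhds_eq_comap, tendsto_comap_iff, map_zero]
    have h1 : Tendsto (fun p : Y × Y => p.1 - p.2) (𝓝 y ×ˢ 𝓝 y) (𝓝 0) := by
      rw [← nhds_prod_eq]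
      have := (continuous_fst.sub continuous_snd : Continuous fun p : Y × Y => p.1 - p.2).tendsto
        (y, y)
      rwa [Pi.sub_apply, sub_self] at this
    have h2 : Tendsto f (comap f (𝓝 y)) (𝓝 y) := tendsto_comap
    refine (h1.comp (h2.prodMap h2)).congr fun p => ?_
    simp)
  refine ⟨x, ?_⟩
  have h3 : Tendsto f (comap f (𝓝 y)) (𝓝 (f x)) := (hf.continuous.tendsto x).mono_left hx
  exact tendsto_nhds_unique h3 tendsto_comap

end FilterComplete

/-- The properties of a locally C*-algebra, as a mixin on a topological `*`-algebra. In contrast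
to the class `LocallyCStarAlgebra`, it can be used for subalgebras and for algebras of operators
without choosing a uniform structure. -/
class IsLocallyCStar (A : Type*) [NonUnitalRing A] [StarRing A] [Module ℂ A]
    [TopologicalSpace A] : Prop where
  withSeminorms : WithSeminorms (fun p : CStarSeminorm A => p.toSeminorm)
  t2 : T2Space A
  complete : IsFilterComplete A

namespace CStarSeminorm

section

variable {A : Type*} [NonUnitalRing A] [StarRing A] [Module ℂ A] [TopologicalSpace A]

theorem continuous (p : CStarSeminorm A) : Continuous (fun a => p a) := p.continuous'

/-- The maximum of two C*-seminorms. -/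
noncomputable def sup (p q : CStarSeminorm A) : CStarSeminorm A :=
  { p.toSeminorm ⊔ q.toSeminorm with
    mul_le' := fun a b => by
      refine max_le ((p.mul_le a b).trans ?_) ((q.mul_le a b).trans ?_)
      · exact mul_le_mul (le_max_left _ _) (le_max_left _ _) (p.nonneg b)
          ((p.nonneg a).trans (le_max_left _ _))
      · exact mul_le_mul (le_max_right _ _) (le_max_right _ _) (q.nonneg b)
          ((q.nonneg a).trans (le_max_right _ _))
    star_mul_self' := fun a => by
      change max (p (star a * a)) (q (star a * a)) = max (p a) (q a) ^ 2
      rw [p.star_mul_self, q.star_mul_self]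
      rcases le_total (p a) (q a) with h | h
      · rw [max_eq_right h, max_eq_right (pow_le_pow_left₀ (p.nonneg a) h 2)]
      · rw [max_eq_left h, max_eq_left (pow_le_pow_left₀ (q.nonneg a) h 2)]
    continuous' := p.continuous.max q.continuous }

theorem le_sup_left (p q : CStarSeminorm A) (a : A) : p a ≤ p.sup q a := le_max_left _ _

theorem le_sup_right (p q : CStarSeminorm A) (a : A) : q a ≤ p.sup q a := le_max_right _ _

theorem exists_finset_sup_le (s : Finset (CStarSeminorm A)) :
    ∃ p : CStarSeminorm A, ∀ a, s.sup (fun q => q.toSeminorm) a ≤ p a := by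
  classical
  induction s using Finset.induction_on with
  | empty => exact ⟨Classical.arbitrary _, fun a => by simp⟩
  | insert q s _ ih =>
    obtain ⟨p, hp⟩ := ih
    refine ⟨q.sup p, fun a => ?_⟩
    rw [Finset.sup_insert]
    exact max_le (q.le_sup_left p a) ((hp a).trans (q.le_sup_right p a))

/-- If a family of continuous C*-seminorms generates the topology, so do all of them. -/
theorem withSeminorms_of_family {ι : Type*} (P : ι → CStarSeminorm A)
    (h : WithSeminorms (fun i => (P i).toSeminorm)) :
    WithSeminorms (fun p : CStarSeminorm A => p.toSeminorm) := by
  classical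
  refine h.congr (fun q => ?_) (fun i => ⟨{P i}, 1, fun a => ?_⟩)
  · obtain ⟨s, C, _, hC⟩ := Seminorm.bound_of_continuous h q.toSeminorm q.continuous
    exact ⟨s, C, hC⟩
  · simp

end

/-- The pullback of a C*-seminorm along a continuous `*`-homomorphism. -/
noncomputable def comap {A B : Type*} [NonUnitalRing A] [StarRing A] [Module ℂ A]
    [TopologicalSpace A] [NonUnitalRing B] [StarRing B] [Module ℂ B] [TopologicalSpace B]
    (p : CStarSeminorm B) (f : A →⋆ₙₐ[ℂ] B) (hf : Continuous f) : CStarSeminorm A :=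
  { p.toSeminorm.comp (f : A →ₗ[ℂ] B) with
    mul_le' := fun a b => by
      change p (f (a * b)) ≤ p (f a) * p (f b)
      rw [map_mul]; exact p.mul_le _ _
    star_mul_self' := fun a => by
      change p (f (star a * a)) = p (f a) ^ 2
      rw [map_mul, map_star]; exact p.star_mul_self _
    continuous' := p.continuous.comp hf }

@[simp] theorem comap_apply {A B : Type*} [NonUnitalRing A] [StarRing A] [Module ℂ A]
    [TopologicalSpace A] [NonUnitalRing B] [StarRing B] [Module ℂ B] [TopologicalSpace B]
    (p : CStarSeminorm B) (f : A →⋆ₙₐ[ℂ] B) (hf : Continuous f) (a : A) :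
    p.comap f hf a = p (f a) := rfl

end CStarSeminorm

namespace IsLocallyCStar

theorem eq_zero {A : Type*} [NonUnitalRing A] [StarRing A] [Module ℂ A] [TopologicalSpace A]
    [IsLocallyCStar A] {a : A} (h : ∀ p : CStarSeminorm A, p a = 0) : a = 0 := by
  have := t2 (A := A)
  by_contra ha
  obtain ⟨p, hp⟩ := (withSeminorms (A := A)).separating_of_T1 a ha
  exact hp (h p)

instance (A : Type*) [LocallyCStarAlgebra A] : IsLocallyCStar A :=
  ⟨LocallyCStarAlgebra.withSeminorms, inferInstance, isFilterComplete_iff.mpr inferInstance⟩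

theorem isTopologicalAddGroup (A : Type*) [NonUnitalRing A] [StarRing A] [Module ℂ A]
    [TopologicalSpace A] [IsLocallyCStar A] : IsTopologicalAddGroup A :=
  (withSeminorms (A := A)).topologicalAddGroup

/-- A closed `*`-subalgebra of a locally C*-algebra is one. -/
theorem of_isClosed {A : Type*} [NonUnitalRing A] [StarRing A] [Module ℂ A] [IsScalarTower ℂ A A]
    [SMulCommClass ℂ A A] [StarModule ℂ A] [TopologicalSpace A] [IsLocallyCStar A]
    (S : NonUnitalStarSubalgebra ℂ A) (hS : IsClosed (S : Set A)) : IsLocallyCStar S where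
  withSeminorms := by
    have h := (withSeminorms (A := A))
    let f : S →⋆ₙₐ[ℂ] A := NonUnitalStarSubalgebraClass.subtype S
    exact CStarSeminorm.withSeminorms_of_family (fun p : CStarSeminorm A =>
      p.comap f continuous_subtype_val)
      (IsInducing.withSeminorms h (f := (f : S →ₗ[ℂ] A)) IsInducing.subtypeVal)
  t2 := by
    have := t2 (A := A)
    infer_instance
  complete := complete (A := A).of_isClosedEmbedding (AddSubgroupClass.subtype S)
    hS.isClosedEmbedding_subtypeVal

end IsLocallyCStar

/-! ### An iteration argument -/

theorem le_of_pow_two_pow_le {x y K : ℝ} (hy : 0 ≤ y)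
    (h : ∀ n : ℕ, x ^ 2 ^ n ≤ K * y ^ 2 ^ n) : x ≤ y := by
  by_contra hc
  push Not at hc
  rcases hy.eq_or_lt with rfl | hy0
  · have := h 0
    simp only [pow_zero, pow_one, mul_zero] at this
    linarith
  · obtain ⟨n, hn⟩ := pow_unbounded_of_one_lt K ((one_lt_div hy0).mpr hc)
    have h1 : (x / y) ^ n ≤ (x / y) ^ 2 ^ n :=
      pow_le_pow_right₀ ((one_lt_div hy0).mpr hc).le Nat.lt_two_pow_self.le
    have h2 : (x / y) ^ 2 ^ n ≤ K := by
      rw [div_pow, div_le_iff₀ (by positivity)]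
      exact h n
    linarith

/-- If `u b ^ 2 ≤ N * u (b* b)` and `u` is bounded by a multiple of a function `r` with
`r (b* b) ≤ r b ^ 2`, then iterating the first inequality along `b, b* b, (b* b)* (b* b), …` makes
the multiple disappear. -/
theorem le_mul_of_sq_le_mul_star_mul {B : Type*} [Mul B] [Star B] {u r : B → ℝ} {N M : ℝ}
    (hr : ∀ b, 0 ≤ r b) (hN : 0 ≤ N) (hsq : ∀ b, u b ^ 2 ≤ N * u (star b * b))
    (hM : ∀ b, u b ≤ M * r b) (hrr : ∀ b, r (star b * b) ≤ r b ^ 2) (b : B) :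
    u b ≤ N * r b := by
  rcases hN.eq_or_lt with rfl | hN0
  · have := hsq b
    rw [zero_mul] at this ⊢
    nlinarith
  have key : ∀ (n : ℕ) (b : B), (u b / N) ^ 2 ^ n ≤ |M| / N * r b ^ 2 ^ n := by
    intro n
    induction n with
    | zero =>
      intro b
      rw [pow_zero, pow_one, pow_one, div_mul_eq_mul_div]
      exact div_le_div_of_nonneg_right ((hM b).trans
        (mul_le_mul_of_nonneg_right (le_abs_self M) (hr b))) hN
    | succ n ih =>
      intro b
      have h1 : (u b / N) ^ 2 ≤ u (star b * b) / N := by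
        rw [div_pow, div_le_div_iff₀ (by positivity) hN0]
        nlinarith [hsq b]
      rw [pow_succ', pow_mul, pow_mul]
      refine (pow_le_pow_left₀ (by positivity) h1 _).trans ((ih _).trans ?_)
      exact mul_le_mul_of_nonneg_left (pow_le_pow_left₀ (hr _) (hrr b) _) (by positivity)
  have h := le_of_pow_two_pow_le (hr b) (fun n => key n b)
  rwa [div_le_iff₀' hN0] at h

section Comparison

variable {B : Type*} [NonUnitalRing B] [StarRing B] [Module ℂ B] [IsScalarTower ℂ B B]
  [SMulCommClass ℂ B B] [StarModule ℂ B] [TopologicalSpace B]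

theorem IsLocallyCStar.continuous_mul_left [IsLocallyCStar B] (b : B) :
    Continuous (fun x : B => b * x) :=
  continuous_of_seminorm_bound (withSeminorms (A := B)) withSeminorms (LinearMap.mulLeft ℂ b)
    (fun p => ⟨p b, p, fun x => p.mul_le b x⟩)

theorem IsLocallyCStar.continuous_mul_right [IsLocallyCStar B] (b : B) :
    Continuous (fun x : B => x * b) :=
  continuous_of_seminorm_bound (withSeminorms (A := B)) withSeminorms (LinearMap.mulRight ℂ b)
    (fun p => ⟨p b, p, fun x => by
      rw [LinearMap.mulRight_apply, mul_comm (p b)]; exact p.mul_le x b⟩)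

theorem IsLocallyCStar.continuous_star [IsLocallyCStar B] : Continuous (star : B → B) :=
  continuous_of_seminorm_bound (withSeminorms (A := B)) withSeminorms
    (starLinearEquiv ℂ : B ≃ₗ⋆[ℂ] B).toLinearMap
    (fun p => ⟨1, p, fun x => by rw [one_mul]; exact (p.star_eq x).le⟩)

/-- A C*-seminorm `q` is dominated by `r` as soon as `b ↦ q (b * k)` is dominated by a multiple of
`r` for a set of elements `k` with dense linear span. -/
theorem CStarSeminorm.le_of_mul_le [IsLocallyCStar B] (q : CStarSeminorm B) {r : B → ℝ}
    (hr : ∀ b, 0 ≤ r b) (hrr : ∀ b, r (star b * b) ≤ r b ^ 2) {D : Set B}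
    (hD : closure (Submodule.span ℂ D : Set B) = Set.univ)
    (h : ∀ k ∈ D, ∃ M, ∀ b, q (b * k) ≤ M * r b) (b : B) : q b ≤ r b := by
  have h1 : ∀ k ∈ Submodule.span ℂ D, ∃ M, ∀ b, q (b * k) ≤ M * r b := by
    intro k hk
    induction hk using Submodule.span_induction with
    | mem k hk => exact h k hk
    | zero => exact ⟨0, fun b => by rw [mul_zero, zero_mul]; exact (map_zero q.toSeminorm).le⟩
    | add k l _ _ hk hl =>
      obtain ⟨M, hM⟩ := hk
      obtain ⟨M', hM'⟩ := hl
      refine ⟨M + M', fun b => ?_⟩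
      rw [mul_add, add_mul]
      exact (map_add_le_add q.toSeminorm _ _).trans (add_le_add (hM b) (hM' b))
    | smul c k _ hk =>
      obtain ⟨M, hM⟩ := hk
      refine ⟨‖c‖ * M, fun b => ?_⟩
      rw [mul_smul_comm, map_smul_eq_mul, mul_assoc]
      exact mul_le_mul_of_nonneg_left (hM b) (norm_nonneg c)
  have h2 : ∀ k ∈ Submodule.span ℂ D, q (b * k) ≤ q k * r b := by
    intro k hk
    obtain ⟨M, hM⟩ := h1 k hk
    refine le_mul_of_sq_le_mul_star_mul (u := fun b => q (b * k)) hr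
      (q.nonneg k) (fun b => ?_) hM hrr b
    rw [← q.star_mul_self, ← q.star_eq k, star_mul, mul_assoc, mul_assoc]
    exact q.mul_le _ _
  have h3 : ∀ k, q (b * k) ≤ q k * r b := by
    intro k
    have hk : k ∈ closure (Submodule.span ℂ D : Set B) := hD ▸ Set.mem_univ k
    have hc : IsClosed {k | q (b * k) ≤ q k * r b} :=
      isClosed_le (q.continuous.comp (IsLocallyCStar.continuous_mul_left b))
        (q.continuous.mul continuous_const)
    exact closure_minimal h2 hc hk
  have h4 := h3 (star b)
  have h5 := q.star_mul_self (star b)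
  rw [star_star] at h5
  rw [h5, q.star_eq] at h4
  by_contra hc
  push Not at hc
  have := (hr b).trans_lt hc
  nlinarith

end Comparison

/-! ### The locally C*-algebra of adjointable operators -/

namespace PreHilbertModule

variable {A : Type*} [NonUnitalRing A] [StarRing A] [Module ℂ A] [IsScalarTower ℂ A A]
  [SMulCommClass ℂ A A] [StarModule ℂ A] [TopologicalSpace A]
variable {E : Type*} [AddCommGroup E] [Module ℂ E] [PreHilbertModule A E]

theorem eq_zero_of_seminorm [IsLocallyCStar A] {x : E}
    (h : ∀ p : CStarSeminorm A, seminorm E p x = 0) : x = 0 := by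
  refine ip_self_eq_zero (A := A) x (IsLocallyCStar.eq_zero fun p => ?_)
  rw [← seminorm_sq, h, zero_pow two_ne_zero]

theorem seminorm_le_of_le {p q : CStarSeminorm A} {C : ℝ} (hC : 0 ≤ C)
    (h : ∀ a, q a ≤ C * p a) (x : E) : seminorm E q x ≤ √C * seminorm E p x := by
  rw [seminorm_apply, seminorm_apply, ← Real.sqrt_mul hC]
  exact Real.sqrt_le_sqrt (h _)

theorem seminorm_rsmul_le (p : CStarSeminorm A) (x : E) (a : A) :
    seminorm E p (rsmul x a) ≤ seminorm E p x * p a := by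
  refine (sq_le_sq₀ (apply_nonneg _ _) (mul_nonneg (apply_nonneg _ _) (p.nonneg _))).mp ?_
  rw [mul_pow, seminorm_sq, seminorm_sq, ip_rsmul_right, ip_rsmul_left]
  refine (p.mul_le _ _).trans ?_
  have h2 := p.mul_le (star a) ⟪x, x⟫_A
  rw [p.star_eq] at h2
  nlinarith [p.nonneg a]

end PreHilbertModule

namespace HilbertModule

open PreHilbertModule

variable (A : Type*) [NonUnitalRing A] [StarRing A] [Module ℂ A] [IsScalarTower ℂ A A]
  [SMulCommClass ℂ A A] [StarModule ℂ A] [TopologicalSpace A] [IsLocallyCStar A]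
variable (E : Type*) [AddCommGroup E] [Module ℂ E] [UniformSpace E] [HilbertModule A E]

theorem t2Space (A : Type*) [NonUnitalRing A] [StarRing A] [Module ℂ A] [IsScalarTower ℂ A A]
    [SMulCommClass ℂ A A] [StarModule ℂ A] [TopologicalSpace A] [IsLocallyCStar A]
    (E : Type*) [AddCommGroup E] [Module ℂ E] [UniformSpace E] [HilbertModule A E] :
    T2Space E := by
  have hE := HilbertModule.withSeminorms (A := A) (E := E)
  have := hE.topologicalAddGroup
  have : T1Space E := hE.T1_of_separating fun x hx => by
    by_contra hc
    push Not at hc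
    exact hx (eq_zero_of_seminorm hc)
  infer_instance

theorem isFilterComplete (A : Type*) [NonUnitalRing A] [StarRing A] [Module ℂ A]
    [IsScalarTower ℂ A A] [SMulCommClass ℂ A A] [StarModule ℂ A] [TopologicalSpace A] [IsLocallyCStar A]
    (E : Type*) [AddCommGroup E] [Module ℂ E] [UniformSpace E] [HilbertModule A E] :
    IsFilterComplete E := by
  have := HilbertModule.isUniformAddGroup A (E := E)
  exact isFilterComplete_iff.mpr (HilbertModule.complete A)

variable {E}

theorem continuous_ip_left (y : E) : Continuous (fun x : E => ⟪x, y⟫_A) := by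
  have hE := HilbertModule.withSeminorms (A := A) (E := E)
  let f : E →ₗ⋆[ℂ] A :=
    { toFun := fun x => ⟪x, y⟫_A
      map_add' := fun a b => ip_add_left a b y
      map_smul' := fun c x => ip_smul_left c x y }
  exact continuous_of_seminorm_bound hE (IsLocallyCStar.withSeminorms (A := A)) f
    (fun p => ⟨seminorm E p y, p, fun x => by
      rw [mul_comm]; exact cauchySchwarz p x y⟩)

theorem continuous_ip_right (y : E) : Continuous (fun x : E => ⟪y, x⟫_A) := by
  have hE := HilbertModule.withSeminorms (A := A) (E := E)
  let f : E →ₗ[ℂ] A :=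
    { toFun := fun x => ⟪y, x⟫_A
      map_add' := fun a b => ip_add_right y a b
      map_smul' := fun c x => ip_smul_right c y x }
  exact continuous_of_seminorm_bound hE (IsLocallyCStar.withSeminorms (A := A)) f
    (fun p => ⟨seminorm E p y, p, fun x => cauchySchwarz p y x⟩)

end HilbertModule

namespace Adjointable

open PreHilbertModule

variable {A : Type*} [NonUnitalRing A] [StarRing A] [Module ℂ A] [IsScalarTower ℂ A A]
  [SMulCommClass ℂ A A] [StarModule ℂ A] [TopologicalSpace A]

section

variable {E : Type*} [AddCommGroup E] [Module ℂ E] [PreHilbertModule A E]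

theorem toEnd_sub (S T : Adjointable A E) : (S - T).toEnd = S.toEnd - T.toEnd := rfl

theorem theta_mul_theta (x y z w : E) :
    (theta x y * theta z w : Adjointable A E) = theta (rsmul x ⟪y, z⟫_A) w := by
  refine ext fun v => ?_
  rw [toEnd_mul, Module.End.mul_apply, theta_toEnd, theta_toEnd, theta_toEnd, ip_rsmul_right,
    rsmul_mul]

theorem mul_theta (T : Adjointable A E) (x y : E) : T * theta x y = theta (T.toEnd x) y := by
  refine ext fun v => ?_
  rw [toEnd_mul, Module.End.mul_apply, theta_toEnd, theta_toEnd, toEnd_rsmul]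

theorem theta_rsmul_left (x y : E) (a : A) :
    (theta (rsmul x a) y : Adjointable A E) = theta x (rsmul y (star a)) := by
  refine ext fun v => ?_
  rw [theta_toEnd, theta_toEnd, ip_rsmul_left, star_star, rsmul_mul]

theorem opSeminorm_star_mul_self (p : CStarSeminorm A) (T : Adjointable A E) :
    opSeminorm p (star T * T) = opSeminorm p T ^ 2 := by
  refine le_antisymm ?_ ?_
  · refine (opSeminorm_mul_le p _ _).trans ?_
    rw [sq]
    exact mul_le_mul_of_nonneg_right (opSeminorm_star_le p T) (apply_nonneg _ _)
  · have h : opSeminorm p T ≤ √(opSeminorm p (star T * T)) := by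
      refine opSeminorm_le p T (Real.sqrt_nonneg _) fun x => ?_
      refine (sq_le_sq₀ (apply_nonneg _ _)
        (mul_nonneg (Real.sqrt_nonneg _) (apply_nonneg _ _))).mp ?_
      rw [mul_pow, Real.sq_sqrt (apply_nonneg _ _), seminorm_sq, inner_toEnd_left]
      refine (cauchySchwarz p _ _).trans ?_
      have := le_opSeminorm p (star T * T) x
      rw [toEnd_mul, Module.End.mul_apply] at this
      nlinarith [apply_nonneg (seminorm E p) x]
    calc opSeminorm p T ^ 2 ≤ √(opSeminorm p (star T * T)) ^ 2 :=
          pow_le_pow_left₀ (apply_nonneg _ _) h 2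
      _ = _ := Real.sq_sqrt (apply_nonneg _ _)

variable (E) in
/-- The operator seminorm, as a continuous C*-seminorm on the algebra of adjointable operators. -/
noncomputable def opCStarSeminorm (p : CStarSeminorm A) : CStarSeminorm (Adjointable A E) :=
  { opSeminorm p with
    mul_le' := opSeminorm_mul_le p
    star_mul_self' := opSeminorm_star_mul_self p
    continuous' := withSeminorms.continuous_seminorm p }

/-- Adjointable operators satisfy, for a C*-seminorm `q` dominated by a multiple of another one
`p`, the `q`-estimate with the operator seminorm for `p`. -/
theorem seminorm_toEnd_le {p q : CStarSeminorm A} {C : ℝ} (hC : 0 ≤ C)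
    (h : ∀ a, q a ≤ C * p a) (T : Adjointable A E) (x : E) :
    seminorm E q (T.toEnd x) ≤ seminorm E q x * opSeminorm p T := by
  refine le_mul_of_sq_le_mul_star_mul (u := fun T : Adjointable A E => seminorm E q (T.toEnd x))
    (r := fun T => opSeminorm p T) (M := √C * seminorm E p x)
    (fun T => apply_nonneg _ _) (apply_nonneg _ _) (fun T => ?_) (fun T => ?_) (fun T => ?_) T
  · rw [seminorm_sq, inner_toEnd_left]
    exact cauchySchwarz q _ _
  · refine (seminorm_le_of_le hC h _).trans ?_
    rw [mul_assoc, mul_comm (seminorm E p x)]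
    exact mul_le_mul_of_nonneg_left (le_opSeminorm p T x) (Real.sqrt_nonneg _)
  · exact (opSeminorm_star_mul_self p T).le

theorem opSeminorm_le_opSeminorm {p q : CStarSeminorm A} {C : ℝ} (hC : 0 ≤ C)
    (h : ∀ a, q a ≤ C * p a) (T : Adjointable A E) : opSeminorm q T ≤ opSeminorm p T :=
  opSeminorm_le q T (apply_nonneg _ _) fun x => by
    rw [mul_comm]; exact seminorm_toEnd_le hC h T x

theorem opSeminorm_theta_le (p : CStarSeminorm A) (x y : E) :
    opSeminorm p (theta x y : Adjointable A E) ≤ seminorm E p x * seminorm E p y := by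
  refine opSeminorm_le p _ (mul_nonneg (apply_nonneg _ _) (apply_nonneg _ _)) fun z => ?_
  rw [theta_toEnd]
  refine (seminorm_rsmul_le p x _).trans ?_
  rw [mul_assoc]
  exact mul_le_mul_of_nonneg_left (cauchySchwarz p y z) (apply_nonneg _ _)

theorem opSeminorm_theta_self (p : CStarSeminorm A) (x : E) :
    opSeminorm p (theta x x : Adjointable A E) = seminorm E p x ^ 2 := by
  refine le_antisymm ((opSeminorm_theta_le p x x).trans (sq _).ge) ?_
  by_cases h0 : seminorm E p x = 0
  · rw [h0]; simp
  have hpos : 0 < seminorm E p x := lt_of_le_of_ne (apply_nonneg _ _) (Ne.symm h0)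
  have h1 := cauchySchwarz p x ((theta x x : Adjointable A E).toEnd x)
  have h2 := le_opSeminorm p (theta x x : Adjointable A E) x
  have h3 : p ⟪x, (theta x x : Adjointable A E).toEnd x⟫_A = seminorm E p x ^ 4 := by
    rw [theta_toEnd, ip_rsmul_right]
    have := p.star_mul_self ⟪x, x⟫_A
    rw [star_ip] at this
    rw [this, ← seminorm_sq]; ring
  rw [h3] at h1
  have h4 : seminorm E p x ^ 2 * seminorm E p x ^ 2 ≤
      opSeminorm p (theta x x : Adjointable A E) * seminorm E p x ^ 2 := by
    calc _ = seminorm E p x ^ 4 := by ring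
      _ ≤ _ := h1
      _ ≤ seminorm E p x * (opSeminorm p (theta x x : Adjointable A E) * seminorm E p x) :=
        mul_le_mul_of_nonneg_left h2 hpos.le
      _ = _ := by ring
  exact le_of_mul_le_mul_right h4 (by positivity)

end

section Complete

variable [IsLocallyCStar A]
variable {E : Type*} [AddCommGroup E] [Module ℂ E] [UniformSpace E] [HilbertModule A E]

theorem tendsto_toEnd {F : Filter (Adjointable A E)}
    (hF : Tendsto (fun x : Adjointable A E × Adjointable A E => x.1 - x.2) (F ×ˢ F) (𝓝 0))
    [F.NeBot] (x : E) : ∃ y, Tendsto (fun T : Adjointable A E => T.toEnd x) F (𝓝 y) := by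
  refine HilbertModule.isFilterComplete A E (F.map fun T => T.toEnd x) inferInstance ?_
  rw [prod_map_map_eq, tendsto_map'_iff]
  have hE := HilbertModule.withSeminorms (A := A) (E := E)
  have hc : Continuous (fun T : Adjointable A E => T.toEnd x) :=
    continuous_of_seminorm_bound (withSeminorms (A := A) (E := E)) hE
      ({ toFun := fun T => T.toEnd x
         map_add' := fun _ _ => rfl
         map_smul' := fun _ _ => rfl } : Adjointable A E →ₗ[ℂ] E)
      (fun p => ⟨seminorm E p x, p, fun T => by
        rw [mul_comm]; exact le_opSeminorm p T x⟩)
  exact (hc.tendsto 0).comp hF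

/-- A Cauchy filter of adjointable operators converges pointwise, together with its adjoints, and the
limits are adjoint to each other. -/
theorem isFilterComplete : IsFilterComplete (Adjointable A E) := by
  intro F hF hF'
  have hE := HilbertModule.withSeminorms (A := A) (E := E)
  have hL := withSeminorms (A := A) (E := E)
  have := hE.topologicalAddGroup
  have := hE.continuousSMul
  have := HilbertModule.t2Space A E
  have := IsLocallyCStar.t2 (A := A)
  have hcs : Continuous (star : Adjointable A E → Adjointable A E) :=
    continuous_of_seminorm_bound hL hL
      (starLinearEquiv ℂ : Adjointable A E ≃ₗ⋆[ℂ] Adjointable A E).toLinearMap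
      (fun p => ⟨1, p, fun T => by rw [one_mul]; exact opSeminorm_star_le p T⟩)
  have hF2 : Tendsto (fun x : Adjointable A E × Adjointable A E => x.1 - x.2)
      (F.map star ×ˢ F.map star) (𝓝 0) := by
    rw [prod_map_map_eq, tendsto_map'_iff]
    have h0 : Tendsto (star : Adjointable A E → Adjointable A E) (𝓝 0) (𝓝 0) := by
      have := hcs.tendsto 0
      rwa [star_zero] at this
    exact (h0.comp hF').congr fun x => star_sub _ _
  choose L hL' using fun x => tendsto_toEnd hF' x
  choose M hM using fun x => tendsto_toEnd hF2 x
  have hM' : ∀ x, Tendsto (fun T : Adjointable A E => (star T).toEnd x) F (𝓝 (M x)) :=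
    fun x => tendsto_map'_iff.mp (hM x)
  let L' : Module.End ℂ E :=
    { toFun := L
      map_add' := fun x y => tendsto_nhds_unique (hL' (x + y))
        (((hL' x).add (hL' y)).congr fun T => (map_add _ _ _).symm)
      map_smul' := fun c x => tendsto_nhds_unique (hL' (c • x))
        (((hL' x).const_smul c).congr fun T => (map_smul _ _ _).symm) }
  let M' : Module.End ℂ E :=
    { toFun := M
      map_add' := fun x y => tendsto_nhds_unique (hM' (x + y))
        (((hM' x).add (hM' y)).congr fun T => (map_add _ _ _).symm)
      map_smul' := fun c x => tendsto_nhds_unique (hM' (c • x))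
        (((hM' x).const_smul c).congr fun T => (map_smul _ _ _).symm) }
  have hadj : IsAdjointPair A L' M' := by
    intro x y
    have h1 : Tendsto (fun T : Adjointable A E => ⟪T.toEnd x, y⟫_A) F (𝓝 ⟪L x, y⟫_A) :=
      ((HilbertModule.continuous_ip_left A y).tendsto _).comp (hL' x)
    have h2 : Tendsto (fun T : Adjointable A E => ⟪x, (star T).toEnd y⟫_A) F (𝓝 ⟪x, M y⟫_A) :=
      ((HilbertModule.continuous_ip_right A x).tendsto _).comp (hM' y)
    exact tendsto_nhds_unique h1 (h2.congr fun T => (inner_toEnd_left T x y).symm)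
  have hmod : ∀ {P Q : Module.End ℂ E}, IsAdjointPair A P Q → IsModuleMap A P := by
    intro P Q h x a
    refine ext_ip A fun z => ?_
    rw [← h.symm, ip_rsmul_right, ip_rsmul_right, ← h.symm]
  -- the members of a small set of the Cauchy filter are uniformly close to the limit
  have hsmall : ∀ (p : CStarSeminorm A) (ε : ℝ), 0 < ε → ∃ s ∈ F, ∀ T ∈ s, ∀ x,
      seminorm E p (T.toEnd x - L x) ≤ ε * seminorm E p x := by
    intro p ε hε
    have h1 := (hL.tendsto_nhds _ _).mp hF' p ε hε
    obtain ⟨s, hs, t, ht, hst⟩ := mem_prod_iff.mp h1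
    refine ⟨s, hs, fun T hT x => ?_⟩
    have h2 : Tendsto (fun S : Adjointable A E => seminorm E p (T.toEnd x - S.toEnd x)) F
        (𝓝 (seminorm E p (T.toEnd x - L x))) :=
      ((hE.continuous_seminorm p).tendsto _).comp ((hL' x).const_sub _)
    refine le_of_tendsto h2 (mem_of_superset ht fun S hS => ?_)
    have h3 : opSeminorm p (T - S) < ε := by
      have := hst (Set.mk_mem_prod hT hS)
      simpa using this
    have h4 := le_opSeminorm p (T - S) x
    rw [toEnd_sub, LinearMap.sub_apply] at h4
    exact h4.trans (mul_le_mul_of_nonneg_right h3.le (apply_nonneg _ _))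
  let R : Adjointable A E := ⟨L', hmod hadj, fun p => by
    obtain ⟨s, hs, h⟩ := hsmall p 1 one_pos
    obtain ⟨T, hT⟩ := hF.nonempty_of_mem hs
    refine ⟨opSeminorm p T + 1, by have := apply_nonneg (opSeminorm p) T; linarith, fun x => ?_⟩
    have h1 := h T hT x
    have h2 := le_opSeminorm p T x
    have h3 := map_sub_le_add (seminorm E p) (T.toEnd x) (T.toEnd x - L x)
    rw [sub_sub_cancel] at h3
    change seminorm E p (L x) ≤ _
    linarith, M', hmod hadj.symm, hadj⟩
  refine ⟨R, ?_⟩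
  refine (hL.tendsto_nhds id R).mpr fun p ε hε => ?_
  obtain ⟨s, hs, h⟩ := hsmall p (ε / 2) (half_pos hε)
  refine mem_of_superset hs fun T hT => ?_
  refine lt_of_le_of_lt (opSeminorm_le p (T - R) (half_pos hε).le fun x => ?_) (half_lt_self hε)
  exact h T hT x

instance : IsLocallyCStar (Adjointable A E) where
  withSeminorms := CStarSeminorm.withSeminorms_of_family (opCStarSeminorm E)
    (withSeminorms (A := A) (E := E))
  t2 := by
    have hL := withSeminorms (A := A) (E := E)
    have := hL.topologicalAddGroup
    have : T1Space (Adjointable A E) := hL.T1_of_separating fun T hT => by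
      by_contra hc
      push Not at hc
      refine hT (ext fun x => ?_)
      refine eq_zero_of_seminorm (A := A) fun p => le_antisymm ?_ (apply_nonneg _ _)
      have := le_opSeminorm p T x
      rwa [hc p, zero_mul] at this
    infer_instance
  complete := isFilterComplete

end Complete

end Adjointable

theorem isClosed_compactOperators (A : Type*) [NonUnitalRing A] [StarRing A] [Module ℂ A]
    [IsScalarTower ℂ A A] [SMulCommClass ℂ A A] [StarModule ℂ A] [TopologicalSpace A]
    (E : Type*) [AddCommGroup E] [Module ℂ E] [PreHilbertModule A E] :
    IsClosed (compactOperators A E : Set (Adjointable A E)) :=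
  isClosed_closure

theorem isClosed_innerIdeal (A : Type*) [LocallyCStarAlgebra A] (V : Type*) [AddCommGroup V]
    [Module ℂ V] [PreHilbertModule A V] : IsClosed (innerIdeal A V : Set A) :=
  isClosed_closure

instance (A : Type*) [NonUnitalRing A] [StarRing A] [Module ℂ A]
    [IsScalarTower ℂ A A] [SMulCommClass ℂ A A] [StarModule ℂ A] [TopologicalSpace A]
    [IsLocallyCStar A] (E : Type*) [AddCommGroup E] [Module ℂ E] [UniformSpace E]
    [HilbertModule A E] : IsLocallyCStar (compactOperators A E) :=
  IsLocallyCStar.of_isClosed _ (isClosed_compactOperators A E)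

instance (A : Type*) [LocallyCStarAlgebra A] (V : Type*) [AddCommGroup V]
    [Module ℂ V] [PreHilbertModule A V] : IsLocallyCStar (innerIdeal A V) :=
  IsLocallyCStar.of_isClosed _ (isClosed_innerIdeal A V)

/-! ### Functional calculus for positive elements -/

section FunctionalCalculus

open Polynomial

section

variable {A : Type*} [NonUnitalRing A] [Module ℂ A]

/-- The power `a ^ (n + 1)` in a non-unital ring. -/
def powSucc (a : A) : ℕ → A
  | 0 => a
  | n + 1 => powSucc a n * a

/-- The value at `a` of the polynomial `t * Q t`, which has no constant term. -/
noncomputable def evalMulX (a : A) (Q : ℝ[X]) : A := Q.sum fun n c => (c : ℂ) • powSucc a n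

theorem evalMulX_add (a : A) (P Q : ℝ[X]) : evalMulX a (P + Q) = evalMulX a P + evalMulX a Q :=
  sum_add_index P Q _ (fun n => by simp) fun n c d => by
    push_cast
    rw [add_smul]

theorem evalMulX_monomial (a : A) (n : ℕ) (c : ℝ) :
    evalMulX a (monomial n c) = (c : ℂ) • powSucc a n :=
  sum_monomial_index c _ (by simp)

theorem evalMulX_mem {S : Submodule ℂ A} (hS : ∀ x ∈ S, ∀ y ∈ S, x * y ∈ S) {a : A} (ha : a ∈ S)
    (Q : ℝ[X]) : evalMulX a Q ∈ S := by
  have h : ∀ n, powSucc a n ∈ S := by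
    intro n
    induction n with
    | zero => exact ha
    | succ n ih => exact hS _ ih _ ha
  exact S.sum_mem fun n _ => S.smul_mem _ (h n)

theorem map_evalMulX {C : Type*} [NonUnitalRing C] [StarRing A] [StarRing C] [Module ℂ C]
    (f : A →⋆ₙₐ[ℂ] C) (a : A) (Q : ℝ[X]) : f (evalMulX a Q) = evalMulX (f a) Q := by
  have h : ∀ n, f (powSucc a n) = powSucc (f a) n := by
    intro n
    induction n with
    | zero => rfl
    | succ n ih => rw [powSucc, map_mul, ih, powSucc]
  unfold evalMulX Polynomial.sum
  rw [map_sum]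
  exact Finset.sum_congr rfl fun n _ => by rw [map_smul, h]

end

theorem evalMulX_eq_cfcₙ {C : Type*} [NonUnitalCStarAlgebra C] {c : C} (hc : IsSelfAdjoint c)
    (Q : ℝ[X]) : evalMulX c Q = cfcₙ (fun t : ℝ => t * Q.eval t) c := by
  have h : ∀ n, powSucc c n = cfcₙ (fun t : ℝ => t ^ (n + 1)) c := by
    intro n
    induction n with
    | zero =>
      simp only [zero_add, pow_one]
      exact (cfcₙ_id' ℝ c hc).symm
    | succ n ih =>
      rw [powSucc, ih]
      rw [show (fun t : ℝ => t ^ (n + 1 + 1)) = fun t => t ^ (n + 1) * t from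
        funext fun t => pow_succ _ _, cfcₙ_mul (fun t : ℝ => t ^ (n + 1)) (fun t => t) c,
        cfcₙ_id' ℝ c hc]
  induction Q using Polynomial.induction_on' with
  | add P Q hP hQ =>
    rw [evalMulX_add, hP, hQ, ← cfcₙ_add (fun t : ℝ => t * P.eval t) (fun t => t * Q.eval t) c]
    congr 1
    funext t
    rw [eval_add, mul_add]
  | monomial n r =>
    rw [evalMulX_monomial, h, Complex.coe_smul, ← cfcₙ_smul r (fun t : ℝ => t ^ (n + 1)) c]
    congr 1
    funext t
    rw [eval_monomial, smul_eq_mul]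
    ring

/-- The Weierstrass theorem for functions vanishing at zero. -/
theorem exists_polynomial_mulX_near {f : ℝ → ℝ} (hf : Continuous f) (hf0 : f 0 = 0) (M : ℝ)
    {ε : ℝ} (hε : 0 < ε) : ∃ Q : ℝ[X], ∀ t, 0 ≤ t → t ≤ M → |t * Q.eval t - f t| ≤ ε := by
  rcases lt_or_ge M 0 with hM | hM
  · exact ⟨0, fun t h0 h1 => by linarith⟩
  obtain ⟨P, hP⟩ := exists_polynomial_near_of_continuousOn 0 M f hf.continuousOn (ε / 2)
    (half_pos hε)
  refine ⟨P.divX, fun t h0 h1 => ?_⟩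
  have h2 := hP t ⟨h0, h1⟩
  have h3 := hP 0 ⟨le_rfl, hM⟩
  rw [hf0, sub_zero] at h3
  have h4 : P.eval t = t * P.divX.eval t + P.eval 0 := by
    conv_lhs => rw [← divX_mul_X_add P]
    simp [mul_comm, coeff_zero_eq_eval_zero]
  rw [h4] at h2
  have h5 : t * P.divX.eval t - f t = (t * P.divX.eval t + P.eval 0 - f t) - P.eval 0 := by ring
  rw [h5]
  have := abs_sub (t * P.divX.eval t + P.eval 0 - f t) (P.eval 0)
  linarith

section

variable {A : Type u} [NonUnitalRing A] [StarRing A] [Module ℂ A] [IsScalarTower ℂ A A]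
  [SMulCommClass ℂ A A] [StarModule ℂ A] [TopologicalSpace A]

/-- The completion of `A` for a C*-seminorm. -/
theorem CStarSeminorm.exists_hom (p : CStarSeminorm A) :
    ∃ (C : Type u) (_ : NonUnitalCStarAlgebra C) (f : A →⋆ₙₐ[ℂ] C), ∀ a, ‖f a‖ = p a := by
  let iG : SeminormedAddCommGroup A := p.toSeminorm.toSeminormedAddCommGroup
  let iR : NonUnitalSeminormedRing A :=
    { (inferInstance : NonUnitalRing A), iG with
      norm_mul_le := p.mul_le }
  let iN : NormedSpace ℂ A :=
    { (inferInstance : Module ℂ A) with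
      norm_smul_le := fun c a => (map_smul_eq_mul p.toSeminorm c a).le }
  obtain ⟨C, iC, f, hm, hs, hn⟩ := exists_cstar_completion A p.star_mul_self
  exact ⟨C, iC,
    { toFun := f
      map_smul' := map_smul f
      map_zero' := map_zero f
      map_add' := map_add f
      map_mul' := hm
      map_star' := hs }, hn⟩

/-- Positivity of an element `a` of a locally C*-algebra: the image of `a` is positive in each
C*-algebra to which the given algebra maps isometrically for a continuous C*-seminorm. -/
def IsPos (a : A) : Prop :=
  ∀ (p : CStarSeminorm A) (C : Type u) (_ : NonUnitalCStarAlgebra C) (f : A →⋆ₙₐ[ℂ] C),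
    (∀ x, ‖f x‖ = p x) → ∃ c : C, f a = star c * c

theorem isPos_star_mul_self (b : A) : IsPos (star b * b) := fun _ _ _ f _ =>
  ⟨f b, by rw [map_mul, map_star]⟩

theorem IsPos.add {a b : A} (ha : IsPos a) (hb : IsPos b) : IsPos (a + b) := by
  intro p C iC f hf
  obtain ⟨c, hc⟩ := ha p C iC f hf
  obtain ⟨d, hd⟩ := hb p C iC f hf
  let _ := CStarAlgebra.spectralOrder C
  have _ := CStarAlgebra.spectralOrderedRing C
  have h : 0 ≤ f (a + b) := by
    rw [map_add, hc, hd]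
    exact add_nonneg (star_mul_self_nonneg c) (star_mul_self_nonneg d)
  exact CStarAlgebra.nonneg_iff_eq_star_mul_self.mp h

/-- A self-adjoint element with a positive third power is positive. -/
theorem IsPos.of_pow_three {a : A} (hs : star a = a) (ha : IsPos (a * a * a)) : IsPos a := by
  intro p C iC f hf
  obtain ⟨c, hc⟩ := ha p C iC f hf
  let _ := CStarAlgebra.spectralOrder C
  have _ := CStarAlgebra.spectralOrderedRing C
  have hsa : IsSelfAdjoint (f a) := by rw [IsSelfAdjoint, ← map_star, hs]
  have h3 : 0 ≤ cfcₙ (fun t : ℝ => t * t * t) (f a) := by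
    rw [cfcₙ_mul (fun t : ℝ => t * t) (fun t => t) (f a), cfcₙ_mul (fun t : ℝ => t) (fun t => t) (f a),
      cfcₙ_id' ℝ (f a) hsa, ← map_mul, ← map_mul, hc]
    exact star_mul_self_nonneg c
  rw [cfcₙ_nonneg_iff (fun t : ℝ => t * t * t) (f a)] at h3
  refine CStarAlgebra.nonneg_iff_eq_star_mul_self.mp ?_
  rw [← cfcₙ_id' ℝ (f a) hsa, cfcₙ_nonneg_iff (fun t : ℝ => t) (f a)]
  intro t ht
  have := h3 t ht
  by_contra hneg
  push Not at hneg
  nlinarith [mul_pos_of_neg_of_neg hneg hneg]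

theorem IsPos.mem_quasispectrum {a : A} (ha : IsPos a) {p : CStarSeminorm A} {C : Type u}
    [iC : NonUnitalCStarAlgebra C] {f : A →⋆ₙₐ[ℂ] C} (hf : ∀ x, ‖f x‖ = p x) :
    IsSelfAdjoint (f a) ∧ ∀ t ∈ quasispectrum ℝ (f a), 0 ≤ t ∧ t ≤ p a := by
  obtain ⟨c, hc⟩ := ha p C iC f hf
  let _ := CStarAlgebra.spectralOrder C
  have _ := CStarAlgebra.spectralOrderedRing C
  have h0 : 0 ≤ f a := hc ▸ star_mul_self_nonneg c
  have hsa : IsSelfAdjoint (f a) := IsSelfAdjoint.of_nonneg h0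
  refine ⟨hsa, fun t ht => ?_⟩
  have h1 := quasispectrum_nonneg_of_nonneg (f a) h0 t ht
  refine ⟨h1, ?_⟩
  have h2 := norm_apply_le_norm_cfcₙ (fun t : ℝ => t) (f a) ht
  rw [cfcₙ_id' ℝ (f a) hsa, hf, Real.norm_of_nonneg h1] at h2
  exact h2

/-- Continuous functional calculus for a positive element `a` of a locally C*-algebra: for a
continuous function `f` on the line with `f 0 = 0` there is an element of the closed algebra
generated by `a` whose image in each of the C*-completions is `f` of the image of `a`. It is the
limit of polynomials in `a`; these have to approximate `f` uniformly on compact sets, since the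
spectrum of `a` may be unbounded. -/
theorem IsPos.exists_cfc [IsLocallyCStar A] {a : A} (ha : IsPos a) {f : ℝ → ℝ} (hf : Continuous f)
    (hf0 : f 0 = 0) :
    ∃ b : A, (∀ S : Submodule ℂ A, (∀ x ∈ S, ∀ y ∈ S, x * y ∈ S) → IsClosed (S : Set A) → a ∈ S →
      b ∈ S) ∧
      ∀ (p : CStarSeminorm A) (C : Type u) (_ : NonUnitalCStarAlgebra C) (φ : A →⋆ₙₐ[ℂ] C),
        (∀ x, ‖φ x‖ = p x) → φ b = cfcₙ f (φ a) := by
  have hA := IsLocallyCStar.withSeminorms (A := A)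
  choose Q hQ using fun n : ℕ =>
    exists_polynomial_mulX_near hf hf0 (n : ℝ) (Nat.one_div_pos_of_nat (α := ℝ) (n := n))
  have hφ : ∀ (p : CStarSeminorm A) (C : Type u) (_ : NonUnitalCStarAlgebra C) (φ : A →⋆ₙₐ[ℂ] C),
      (∀ x, ‖φ x‖ = p x) →
      Tendsto (fun n => φ (evalMulX a (Q n))) atTop (𝓝 (cfcₙ f (φ a))) := by
    intro p C _ φ hφ
    obtain ⟨hsa, hσ⟩ := ha.mem_quasispectrum hφ
    rw [tendsto_iff_norm_sub_tendsto_zero]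
    obtain ⟨N, hN⟩ := exists_nat_ge (p a)
    refine squeeze_zero' (Eventually.of_forall fun n => norm_nonneg _) ?_
      (tendsto_one_div_add_atTop_nhds_zero_nat (𝕜 := ℝ))
    filter_upwards [eventually_ge_atTop N] with n hn
    rw [map_evalMulX, evalMulX_eq_cfcₙ hsa,
      ← cfcₙ_sub (fun t : ℝ => t * (Q n).eval t) f (φ a)]
    refine norm_cfcₙ_le fun t ht => ?_
    have h1 := hσ t ht
    rw [Real.norm_eq_abs]
    exact hQ n t h1.1 (h1.2.trans (hN.trans (by exact_mod_cast hn)))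
  have hcau : ∀ (p : CStarSeminorm A) (ε : ℝ), 0 < ε → ∀ᶠ x : ℕ × ℕ in atTop ×ˢ atTop,
      p (evalMulX a (Q x.1) - evalMulX a (Q x.2)) < ε := by
    intro p ε hε
    obtain ⟨C, iC, φ, hn⟩ := p.exists_hom
    have h := ((hφ p C iC φ hn).comp tendsto_fst).sub ((hφ p C iC φ hn).comp tendsto_snd)
    rw [sub_self] at h
    have h' := h.norm
    rw [norm_zero] at h'
    filter_upwards [h'.eventually_lt_const hε] with x hx
    rw [← hn, map_sub]
    exact hx
  obtain ⟨b, hb⟩ := IsLocallyCStar.complete (A := A) (atTop.map fun n => evalMulX a (Q n))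
    inferInstance (by
      rw [prod_map_map_eq, tendsto_map'_iff]
      refine (hA.tendsto_nhds _ _).mpr fun p ε hε => ?_
      filter_upwards [hcau p ε hε] with x hx
      rw [sub_zero]
      exact hx)
  have hb' : Tendsto (fun n => evalMulX a (Q n)) atTop (𝓝 b) := hb
  refine ⟨b, fun S hS hSc haS => hSc.mem_of_tendsto hb'
    (Eventually.of_forall fun n => evalMulX_mem hS haS _), fun p C iC φ hn => ?_⟩
  refine tendsto_nhds_unique ?_ (hφ p C iC φ hn)
  rw [tendsto_iff_norm_sub_tendsto_zero]
  have := IsLocallyCStar.isTopologicalAddGroup A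
  have h1 := (p.continuous.tendsto _).comp (hb'.sub_const b)
  rw [sub_self] at h1
  have h0 : p (0 : A) = 0 := map_zero p.toSeminorm
  rw [h0] at h1
  refine h1.congr fun n => ?_
  rw [← map_sub, hn]
  rfl

theorem IsLocallyCStar.ext_hom [IsLocallyCStar A] {a b : A}
    (h : ∀ (p : CStarSeminorm A) (C : Type u) (_ : NonUnitalCStarAlgebra C) (f : A →⋆ₙₐ[ℂ] C),
      (∀ x, ‖f x‖ = p x) → f a = f b) : a = b := by
  rw [← sub_eq_zero]
  refine IsLocallyCStar.eq_zero fun p => ?_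
  obtain ⟨C, iC, f, hf⟩ := p.exists_hom
  rw [← hf, map_sub, h p C iC f hf, sub_self, norm_zero]

/-- A positive element has a self-adjoint square root in the closed algebra it generates. -/
theorem IsPos.exists_sqrt [IsLocallyCStar A] {a : A} (ha : IsPos a) :
    ∃ b : A, star b = b ∧ b * b = a ∧ ∀ S : Submodule ℂ A, (∀ x ∈ S, ∀ y ∈ S, x * y ∈ S) →
      IsClosed (S : Set A) → a ∈ S → b ∈ S := by
  obtain ⟨b, hb, hφ⟩ := ha.exists_cfc Real.continuous_sqrt Real.sqrt_zero
  refine ⟨b, ?_, ?_, hb⟩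
  · refine IsLocallyCStar.ext_hom fun p C iC f hf => ?_
    rw [map_star, hφ p C iC f hf]
    exact IsSelfAdjoint.cfcₙ
  · refine IsLocallyCStar.ext_hom fun p C iC f hf => ?_
    obtain ⟨hsa, hσ⟩ := ha.mem_quasispectrum hf
    rw [map_mul, hφ p C iC f hf, ← cfcₙ_mul Real.sqrt Real.sqrt (f a)]
    conv_rhs => rw [← cfcₙ_id' ℝ (f a) hsa]
    exact cfcₙ_congr fun t ht => Real.mul_self_sqrt (hσ t ht).1

/-- Local approximate units: `a c` is close to the positive element `a` for some `c` of
seminorm at most one. -/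
theorem IsPos.exists_mul_near [IsLocallyCStar A] {a : A} (ha : IsPos a) (p : CStarSeminorm A)
    {ε : ℝ} (hε : 0 < ε) : ∃ c : A, p c ≤ 1 ∧ p (a - a * c) ≤ ε := by
  have hcont : Continuous fun t : ℝ => max 0 (min (t / ε) 1) := by fun_prop
  obtain ⟨c, -, hφ⟩ := ha.exists_cfc hcont (by simp)
  obtain ⟨C, iC, f, hf⟩ := p.exists_hom
  obtain ⟨hsa, hσ⟩ := ha.mem_quasispectrum hf
  refine ⟨c, ?_, ?_⟩
  · rw [← hf, hφ p C iC f hf]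
    refine norm_cfcₙ_le fun t ht => ?_
    rw [Real.norm_of_nonneg (le_max_left _ _)]
    exact max_le zero_le_one (min_le_right _ _)
  · have h0 : (fun t : ℝ => max 0 (min (t / ε) 1)) 0 = 0 := by simp
    have h1 : f a * cfcₙ (fun t : ℝ => max 0 (min (t / ε) 1)) (f a) =
        cfcₙ (fun t : ℝ => t * max 0 (min (t / ε) 1)) (f a) := by
      rw [cfcₙ_mul (fun t : ℝ => t) (fun t : ℝ => max 0 (min (t / ε) 1)) (f a)
        (by fun_prop) rfl hcont.continuousOn h0, cfcₙ_id' ℝ (f a) hsa]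
    have h2 : f (a - a * c) = cfcₙ (fun t : ℝ => t - t * max 0 (min (t / ε) 1)) (f a) := by
      rw [cfcₙ_sub (fun t : ℝ => t) (fun t : ℝ => t * max 0 (min (t / ε) 1)) (f a)
        (by fun_prop) rfl (by fun_prop) (by simp), ← h1, cfcₙ_id' ℝ (f a) hsa, map_sub, map_mul,
        hφ p C iC f hf]
    rw [← hf, h2]
    refine norm_cfcₙ_le fun t ht => ?_
    have ht0 := (hσ t ht).1
    rw [max_eq_right (le_min (div_nonneg ht0 hε.le) zero_le_one), Real.norm_eq_abs]
    rcases le_total (t / ε) 1 with h | h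
    · rw [min_eq_left h, abs_of_nonneg (by nlinarith)]
      have h3 : t ≤ ε := by rwa [div_le_one hε] at h
      have h4 : 0 ≤ t * (t / ε) := mul_nonneg ht0 (div_nonneg ht0 hε.le)
      linarith
    · rw [min_eq_right h, mul_one, sub_self, abs_zero]
      exact hε.le

end

end FunctionalCalculus

section Approximation

open PreHilbertModule

variable {A : Type u} [NonUnitalRing A] [StarRing A] [Module ℂ A] [IsScalarTower ℂ A A]
  [SMulCommClass ℂ A A] [StarModule ℂ A] [TopologicalSpace A] [IsLocallyCStar A]
variable {E : Type*} [AddCommGroup E] [Module ℂ E] [PreHilbertModule A E]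

theorem PreHilbertModule.isPos_ip_self (x : E) : IsPos ⟪x, x⟫_A := by
  obtain ⟨b, hb⟩ := ip_self_nonneg (A := A) x
  rw [hb]
  exact isPos_star_mul_self b

/-- The module action is non-degenerate: `x` is approximated by elements `x c`. -/
theorem PreHilbertModule.exists_rsmul_near (p : CStarSeminorm A) (x : E) {ε : ℝ} (hε : 0 < ε) :
    ∃ c : A, seminorm E p (x - rsmul x c) ≤ ε := by
  obtain ⟨c, hc1, hc⟩ := (isPos_ip_self (A := A) x).exists_mul_near p
    (ε := ε ^ 2 / 2) (by positivity)
  refine ⟨c, ?_⟩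
  refine (sq_le_sq₀ (apply_nonneg _ _) hε.le).mp ?_
  have h1 : ⟪x - rsmul x c, x - rsmul x c⟫_A =
      (⟪x, x⟫_A - ⟪x, x⟫_A * c) - star c * (⟪x, x⟫_A - ⟪x, x⟫_A * c) := by
    simp only [ip_sub_left, ip_sub_right, ip_rsmul_left, ip_rsmul_right, sub_mul, mul_sub, mul_assoc]
    abel
  rw [seminorm_sq, h1]
  refine (map_sub_le_add p.toSeminorm _ _).trans ?_
  have h2 := p.mul_le (star c) (⟪x, x⟫_A - ⟪x, x⟫_A * c)
  rw [p.star_eq] at h2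
  have h3 := p.nonneg c
  have h4 := p.nonneg (⟪x, x⟫_A - ⟪x, x⟫_A * c)
  nlinarith

end Approximation

/-! ### Imprimitivity modules from actions -/

/-- A linear map is inducing when the seminorms of the two spaces dominate each other along it. -/
theorem isInducing_of_seminorm_bounds {X Y ι κ : Type*} [AddCommGroup X] [Module ℂ X]
    [TopologicalSpace X] [AddCommGroup Y] [Module ℂ Y] [TopologicalSpace Y]
    {σ : ℂ →+* ℂ} [RingHomIsometric σ] {p : SeminormFamily ℂ X ι}
    {q : SeminormFamily ℂ Y κ} (hp : WithSeminorms p) (hq : WithSeminorms q) (f : X →ₛₗ[σ] Y)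
    (h1 : ∀ j, ∃ (C : ℝ) (i : ι), ∀ x, q j (f x) ≤ C * p i x)
    (h2 : ∀ i, ∃ (C : ℝ) (j : κ), ∀ x, p i x ≤ C * q j (f x)) : IsInducing f := by
  have hind := f.withSeminorms_induced hq
  have h : WithSeminorms (q.comp f) := by
    refine hp.congr (Seminorm.IsBounded.of_real fun j => ?_) (Seminorm.IsBounded.of_real fun i => ?_)
    · obtain ⟨C, i, h⟩ := h1 j
      exact ⟨{i}, C, fun x => by rw [Finset.sup_singleton]; exact h x⟩
    · obtain ⟨C, j, h⟩ := h2 i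
      exact ⟨{j}, C, fun x => by rw [Finset.sup_singleton]; exact h x⟩
  exact ⟨h.topology_eq_withSeminorms.trans (@WithSeminorms.topology_eq_withSeminorms _ _ _ _ _ _ _
    (TopologicalSpace.induced f inferInstance) hind).symm⟩

section

open PreHilbertModule Adjointable

variable {A B : Type u} [NonUnitalRing A] [StarRing A] [Module ℂ A] [IsScalarTower ℂ A A]
  [SMulCommClass ℂ A A] [StarModule ℂ A] [TopologicalSpace A]
  [NonUnitalRing B] [StarRing B] [Module ℂ B] [IsScalarTower ℂ B B]
  [SMulCommClass ℂ B B] [StarModule ℂ B] [TopologicalSpace B]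

theorem theta_mem_compactOperators {E : Type*} [AddCommGroup E] [Module ℂ E]
    [PreHilbertModule A E] (x y : E) : theta x y ∈ compactOperators A E :=
  subset_closure (Submodule.subset_span ⟨x, y, rfl⟩)

theorem mem_of_isClosed_of_dense_span {X : Type*} [AddCommGroup X] [Module ℂ X]
    [TopologicalSpace X] {D : Set X} (hD : closure (Submodule.span ℂ D : Set X) = Set.univ)
    {S : Submodule ℂ X} (hS : IsClosed (S : Set X)) (h : D ⊆ S) (x : X) : x ∈ S := by
  have hx : x ∈ closure (Submodule.span ℂ D : Set X) := hD ▸ Set.mem_univ x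
  exact closure_minimal (Submodule.span_le.mpr h) hS hx

variable [IsLocallyCStar A] [IsLocallyCStar B]
variable {E : Type u} [AddCommGroup E] [Module ℂ E] [UniformSpace E] [HilbertModule A E]

/-- The action embeds `B` topologically. The hypothesis `h2` bounds a C*-seminorm of `B` only on the
products `b * lip x y`, with a constant that may depend on `x` and `y`; the C*-identity makes it
uniform. -/
theorem isInducing_action (lam : B →⋆ₙₐ[ℂ] Adjointable A E) (lip : E → E → B)
    (hdense : closure (Submodule.span ℂ {b | ∃ x y, lip x y = b} : Set B) = Set.univ)
    (h1 : ∀ p : CStarSeminorm A, ∃ (C : ℝ) (q : CStarSeminorm B), ∀ b,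
      opSeminorm p (lam b) ≤ C * q b)
    (h2 : ∀ q : CStarSeminorm B, ∃ p : CStarSeminorm A, ∀ x y, ∃ M, ∀ b,
      q (b * lip x y) ≤ M * opSeminorm p (lam b)) : IsInducing lam := by
  refine isInducing_of_seminorm_bounds (IsLocallyCStar.withSeminorms (A := B))
    (Adjointable.withSeminorms (A := A) (E := E)) (lam : B →ₗ[ℂ] Adjointable A E) h1 fun q => ?_
  obtain ⟨p, hp⟩ := h2 q
  refine ⟨1, p, fun b => ?_⟩
  rw [one_mul]
  refine q.le_of_mul_le (r := fun b => opSeminorm p (lam b)) (fun b => apply_nonneg _ _)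
    (fun b => ?_) hdense ?_ b
  · rw [map_mul, map_star]
    exact (opSeminorm_star_mul_self p _).le
  · rintro _ ⟨x, y, rfl⟩
    exact hp x y

/-- A full Hilbert `A`-module `E` with an action of `B` by adjointable operators is an
imprimitivity module, if the rank-one operators `θ_{x,y}` come from elements of `B` with dense
linear span and if the topology of `B` is that of the operator seminorms. For the last point it is
enough to bound the continuous C*-seminorms of `B` on the products with the elements acting as
rank-one operators. -/
noncomputable def ImprimitivityModule.ofAction (hfull : IsFull A E)
    (lam : B →⋆ₙₐ[ℂ] Adjointable A E) (lip : E → E → B)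
    (hlip : ∀ x y, lam (lip x y) = theta x y)
    (hdense : closure (Submodule.span ℂ {b | ∃ x y, lip x y = b} : Set B) = Set.univ)
    (h1 : ∀ p : CStarSeminorm A, ∃ (C : ℝ) (q : CStarSeminorm B), ∀ b,
      opSeminorm p (lam b) ≤ C * q b)
    (h2 : ∀ q : CStarSeminorm B, ∃ p : CStarSeminorm A, ∀ x y, ∃ M, ∀ b,
      q (b * lip x y) ≤ M * opSeminorm p (lam b)) : ImprimitivityModule A B :=
  have hind := isInducing_action lam lip hdense h1 h2
  have hmem : ∀ b, lam b ∈ compactOperators A E := fun b =>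
    mem_of_isClosed_of_dense_span hdense
      (S := (compactOperators A E).toNonUnitalSubalgebra.toSubmodule.comap
        (lam : B →ₗ[ℂ] Adjointable A E))
      ((isClosed_compactOperators A E).preimage hind.continuous)
      (by
        rintro _ ⟨x, y, rfl⟩
        change lam (lip x y) ∈ compactOperators A E
        rw [hlip]
        exact theta_mem_compactOperators x y) b
  let f : B →⋆ₙₐ[ℂ] compactOperators A E :=
    { toFun := fun b => ⟨lam b, hmem b⟩
      map_smul' := fun c b => Subtype.ext (map_smul lam c b)
      map_zero' := Subtype.ext (map_zero lam)
      map_add' := fun b c => Subtype.ext (map_add lam b c)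
      map_mul' := fun b c => Subtype.ext (map_mul lam b c)
      map_star' := fun b => Subtype.ext (map_star lam b) }
  have hfind : IsInducing f := IsInducing.subtypeVal.of_comp_iff.mp hind
  have hbij : Function.Bijective f := by
    have := IsLocallyCStar.t2 (A := B)
    have := IsLocallyCStar.t2 (A := Adjointable A E)
    have := IsLocallyCStar.isTopologicalAddGroup (Adjointable A E)
    refine ⟨hfind.injective, ?_⟩
    rintro ⟨T, hT⟩
    have hc : IsClosed (Set.range lam) :=
      (IsLocallyCStar.complete (A := B)).isClosed_range (lam : B →+ Adjointable A E) hind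
    have hT' : T ∈ closure (Set.range lam) := by
      refine closure_mono ?_ hT
      have : Submodule.span ℂ {T : Adjointable A E | ∃ x y : E, theta x y = T} ≤
          LinearMap.range (lam : B →ₗ[ℂ] Adjointable A E) := by
        refine Submodule.span_le.mpr ?_
        rintro _ ⟨x, y, rfl⟩
        exact ⟨lip x y, hlip x y⟩
      exact this
    rw [hc.closure_eq] at hT'
    obtain ⟨b, hb⟩ := hT'
    exact ⟨b, Subtype.ext hb⟩
  { E := E
    isFull := hfull
    iso := StarAlgEquiv.ofBijective f hbij
    continuous_iso := hfind.continuous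
    continuous_iso_symm := hfind.continuous_iff.mpr
      (continuous_id.congr fun T => ((StarAlgEquiv.ofBijective f hbij).apply_symm_apply T).symm) }

end

/-! ### Symmetry: the conjugate imprimitivity module -/

/-- The conjugate of a complex vector space: the same group, with conjugate scalar multiplication. -/
def Conj (E : Type*) := E

namespace Conj

variable {E : Type*} [AddCommGroup E] [Module ℂ E]

instance : AddCommGroup (Conj E) := inferInstanceAs (AddCommGroup E)

instance [UniformSpace E] : UniformSpace (Conj E) := inferInstanceAs (UniformSpace E)

noncomputable instance : Module ℂ (Conj E) := Module.compHom E (starRingEnd ℂ)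

/-- The identity, as an additive map to the conjugate space. -/
def of : E ≃+ Conj E := AddEquiv.refl E

theorem smul_of (c : ℂ) (x : E) : c • of x = of (star c • x) := rfl

theorem of_smul (c : ℂ) (x : E) : of (c • x) = star c • of x := by
  rw [smul_of, star_star]

end Conj

namespace ImprimitivityModule

open PreHilbertModule Adjointable

variable {A B : Type u} [NonUnitalRing A] [StarRing A] [Module ℂ A] [IsScalarTower ℂ A A]
  [SMulCommClass ℂ A A] [StarModule ℂ A] [TopologicalSpace A]
  [NonUnitalRing B] [StarRing B] [Module ℂ B] [TopologicalSpace B]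

section

variable (X : ImprimitivityModule A B)

/-- The left action of `B`. -/
noncomputable def lact (b : B) : Adjointable A X.E := X.iso b

/-- The `B`-valued inner product, for which `⟪x, y⟫ z = x ⟪y, z⟫`. -/
noncomputable def lip (x y : X.E) : B := X.iso.symm ⟨theta x y, theta_mem_compactOperators x y⟩

theorem lact_lip (x y : X.E) : X.lact (X.lip x y) = theta x y := by
  rw [lact, lip, StarAlgEquiv.apply_symm_apply]

theorem lact_injective : Function.Injective X.lact := fun _ _ h =>
  X.iso.injective (Subtype.ext h)

theorem lact_add (b c : B) : X.lact (b + c) = X.lact b + X.lact c := by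
  simp only [lact, map_add]; rfl

theorem lact_smul (r : ℂ) (b : B) : X.lact (r • b) = r • X.lact b := by
  simp only [lact, map_smul]; rfl

theorem lact_mul (b c : B) : X.lact (b * c) = X.lact b * X.lact c := by
  simp only [lact, map_mul]; rfl

theorem lact_star (b : B) : X.lact (star b) = star (X.lact b) := by
  simp only [lact, map_star]; rfl

theorem star_lip (x y : X.E) : star (X.lip x y) = X.lip y x :=
  X.lact_injective (by rw [lact_star, lact_lip, lact_lip, star_theta])

theorem mul_lip (b : B) (x y : X.E) : b * X.lip x y = X.lip ((X.lact b).toEnd x) y :=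
  X.lact_injective (by rw [lact_mul, lact_lip, lact_lip, mul_theta])

theorem lip_mul (b : B) (x y : X.E) : X.lip x y * b = X.lip x ((X.lact (star b)).toEnd y) :=
  X.lact_injective (by rw [lact_mul, lact_lip, lact_lip, lact_star, theta_mul])

theorem lip_rsmul_left (x y : X.E) (a : A) : X.lip (rsmul x a) y = X.lip x (rsmul y (star a)) :=
  X.lact_injective (by rw [lact_lip, lact_lip, theta_rsmul_left])

theorem span_lip_dense : closure (Submodule.span ℂ {b | ∃ x y, X.lip x y = b} : Set B) =
    Set.univ := by
  refine Set.eq_univ_of_forall fun b => ?_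
  have h1 : X.lact b ∈ closure ((Submodule.span ℂ {T | ∃ x y : X.E, theta x y = T} :
    Submodule ℂ (Adjointable A X.E)) : Set (Adjointable A X.E)) := (X.iso b).2
  have h2 : (X.iso b) ∈ closure ((Subtype.val : compactOperators A X.E → Adjointable A X.E) ⁻¹'
      ((Submodule.span ℂ {T | ∃ x y : X.E, theta x y = T} : Submodule ℂ (Adjointable A X.E)) :
        Set (Adjointable A X.E))) := by
    rw [closure_subtype]
    refine closure_mono ?_ h1
    intro T hT
    exact ⟨⟨T, subset_closure hT⟩, hT, rfl⟩
  have h3 := map_mem_closure X.continuous_iso_symm h2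
    (t := (Submodule.span ℂ {b | ∃ x y, X.lip x y = b} : Set B)) (by
      rintro ⟨T, hT'⟩ hT
      change T ∈ Submodule.span ℂ {T : Adjointable A X.E | ∃ x y : X.E, theta x y = T} at hT
      change X.iso.symm ⟨T, hT'⟩ ∈ Submodule.span ℂ {b | ∃ x y, X.lip x y = b}
      induction hT using Submodule.span_induction with
      | mem T h =>
        obtain ⟨x, y, rfl⟩ := h
        exact Submodule.subset_span ⟨x, y, rfl⟩
      | zero =>
        have : (⟨0, hT'⟩ : compactOperators A X.E) = 0 := rfl
        rw [this, map_zero]; exact Submodule.zero_mem _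
      | add S T h h' hS hT =>
        have : (⟨S + T, hT'⟩ : compactOperators A X.E) =
          ⟨S, subset_closure h⟩ + ⟨T, subset_closure h'⟩ := rfl
        rw [this, map_add]; exact Submodule.add_mem _ (hS _) (hT _)
      | smul c S h hS =>
        have : (⟨c • S, hT'⟩ : compactOperators A X.E) = c • ⟨S, subset_closure h⟩ := rfl
        rw [this, map_smul]; exact Submodule.smul_mem _ _ (hS _))
  rwa [X.iso.symm_apply_apply] at h3

variable [IsLocallyCStar A]

/-- This is positivity of the left inner product, which takes its values in `K(E)`. -/
theorem isPos_theta_self {E : Type u} [AddCommGroup E] [Module ℂ E] [UniformSpace E]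
    [HilbertModule A E] (x : E) :
    IsPos (⟨theta x x, theta_mem_compactOperators x x⟩ : compactOperators A E) := by
  -- with `y = x √⟪x, x⟫`, the third power of `θ_{x,x}` is `θ_{x,y} θ_{x,y}*`
  refine IsPos.of_pow_three (Subtype.ext (star_theta x x)) ?_
  obtain ⟨r, hr, hrr, -⟩ := (isPos_ip_self (A := A) x).exists_sqrt
  have h : (⟨theta x x, theta_mem_compactOperators x x⟩ : compactOperators A E) *
      ⟨theta x x, theta_mem_compactOperators x x⟩ * ⟨theta x x, theta_mem_compactOperators x x⟩ =
      star ⟨theta (rsmul x r) x, theta_mem_compactOperators _ x⟩ *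
        ⟨theta (rsmul x r) x, theta_mem_compactOperators _ x⟩ := by
    refine Subtype.ext ?_
    change theta x x * theta x x * theta x x = star (theta (rsmul x r) x) * theta (rsmul x r) x
    rw [star_theta, theta_mul_theta, theta_mul_theta, theta_mul_theta, ip_rsmul_left,
      ip_rsmul_right, hr, ← rsmul_mul, ← hrr]
    simp only [mul_assoc]
  rw [h]
  exact isPos_star_mul_self _

noncomputable instance conjPreHilbertModule : PreHilbertModule B (Conj X.E) where
  inner x y := X.lip (Conj.of.symm x) (Conj.of.symm y)
  rsmul x b := Conj.of ((X.lact (star b)).toEnd (Conj.of.symm x))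
  add_rsmul x y b := by rw [map_add, map_add, map_add]
  rsmul_add x b c := by rw [star_add, lact_add, toEnd_add, LinearMap.add_apply, map_add]
  rsmul_mul x b c := by
    rw [star_mul, lact_mul, toEnd_mul, Module.End.mul_apply, AddEquiv.symm_apply_apply]
  smul_rsmul c x b := by
    change Conj.of ((X.lact (star b)).toEnd (star c • (Conj.of.symm x))) = _
    rw [map_smul, Conj.of_smul, star_star]
  rsmul_smul c x b := by
    have : X.lact (star (c • b)) = star c • X.lact (star b) := by
      rw [lact_star, lact_star, lact_smul, star_smul]
    rw [this, toEnd_smul, LinearMap.smul_apply, Conj.of_smul, star_star]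
  ip_add_right x y z := X.lact_injective (by
    rw [lact_add, lact_lip, lact_lip, lact_lip, map_add]
    refine Adjointable.ext fun w => ?_
    rw [toEnd_add, LinearMap.add_apply, theta_toEnd, theta_toEnd, theta_toEnd, ip_add_left,
      rsmul_add])
  ip_smul_right c x y := X.lact_injective (by
    rw [lact_smul, lact_lip, lact_lip]
    refine Adjointable.ext fun w => ?_
    change rsmul _ ⟪star c • Conj.of.symm y, w⟫_A = _
    rw [toEnd_smul, LinearMap.smul_apply, theta_toEnd, ip_smul_left, star_star, rsmul_smul])
  ip_rsmul_right x y b := by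
    rw [AddEquiv.symm_apply_apply, lip_mul]
  star_ip x y := X.star_lip _ _
  ip_self_nonneg x := by
    obtain ⟨r, hr, hrr, -⟩ := (isPos_theta_self (A := A) (Conj.of.symm x)).exists_sqrt
    refine ⟨X.iso.symm r, ?_⟩
    rw [← map_star, ← map_mul, hr, hrr]
    rfl
  ip_self_eq_zero x h := by
    have h1 : theta (Conj.of.symm x) (Conj.of.symm x) = (0 : Adjointable A X.E) := by
      rw [← X.lact_lip, h]
      simp only [lact, map_zero]; rfl
    have h2 : Conj.of.symm x = 0 := eq_zero_of_seminorm (A := A) fun p => by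
      have := opSeminorm_theta_self p (Conj.of.symm x)
      rw [h1, map_zero] at this
      exact pow_eq_zero_iff two_ne_zero |>.mp this.symm
    exact h2

theorem continuous_lact : Continuous X.lact := continuous_subtype_val.comp X.continuous_iso

/-- The left action as a `*`-homomorphism. -/
noncomputable def lactHom : B →⋆ₙₐ[ℂ] Adjointable A X.E where
  toFun := X.lact
  map_smul' := X.lact_smul
  map_zero' := by simp only [lact, map_zero]; rfl
  map_add' := X.lact_add
  map_mul' := X.lact_mul
  map_star' := X.lact_star

/-- The C*-seminorm on `B` corresponding to a C*-seminorm on `A`. -/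
noncomputable def leftSeminorm (p : CStarSeminorm A) : CStarSeminorm B :=
  (opCStarSeminorm X.E p).comap X.lactHom X.continuous_lact

theorem leftSeminorm_apply (p : CStarSeminorm A) (b : B) :
    X.leftSeminorm p b = opSeminorm p (X.lact b) := rfl

theorem exists_leftSeminorm_bound (q : CStarSeminorm B) :
    ∃ (p : CStarSeminorm A) (C : ℝ), 0 ≤ C ∧ ∀ b, q b ≤ C * X.leftSeminorm p b := by
  let f : compactOperators A X.E →⋆ₙₐ[ℂ] B := X.iso.symm
  let r : CStarSeminorm (compactOperators A X.E) := q.comap f X.continuous_iso_symm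
  obtain ⟨s, C, hC, h⟩ := Seminorm.bound_comp_of_isInducing (p := r.toSeminorm) r.continuous
    (Adjointable.withSeminorms (A := A) (E := X.E))
    (f := (NonUnitalStarSubalgebraClass.subtype (compactOperators A X.E) :
      compactOperators A X.E →ₗ[ℂ] Adjointable A X.E)) IsInducing.subtypeVal
  obtain ⟨p, hp⟩ := CStarSeminorm.exists_finset_sup_le s
  refine ⟨p, C, C.2, fun b => ?_⟩
  have h1 := h (X.iso b)
  have h2 : r (X.iso b) = q b := by
    change q (X.iso.symm (X.iso b)) = q b
    rw [X.iso.symm_apply_apply]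
  rw [← h2]
  refine h1.trans ?_
  change (C : ℝ) * (s.sup (fun p => opSeminorm p)) (X.lact b) ≤ _
  refine mul_le_mul_of_nonneg_left ?_ C.2
  refine Seminorm.finset_sup_apply_le (apply_nonneg _ _) fun q hq => ?_
  refine opSeminorm_le_opSeminorm zero_le_one (fun a => ?_) _
  rw [one_mul]
  exact (Seminorm.le_finset_sup_apply (p := fun q : CStarSeminorm A => q.toSeminorm) hq).trans (hp a)

variable [IsScalarTower ℂ B B] [SMulCommClass ℂ B B] [StarModule ℂ B]

theorem seminorm_conj_sq (q : CStarSeminorm B) (x : X.E) :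
    seminorm (Conj X.E) q (Conj.of x) ^ 2 = q (X.lip x x) := seminorm_sq q _

theorem seminorm_conj_leftSeminorm (p : CStarSeminorm A) (x : X.E) :
    seminorm (Conj X.E) (X.leftSeminorm p) (Conj.of x) = seminorm X.E p x := by
  refine (pow_left_inj₀ (apply_nonneg _ _) (apply_nonneg _ _) two_ne_zero).mp ?_
  rw [seminorm_conj_sq, leftSeminorm_apply, lact_lip, opSeminorm_theta_self]

theorem seminorm_conj_le {p : CStarSeminorm A} {q : CStarSeminorm B} {C : ℝ} (hC : 0 ≤ C)
    (h : ∀ b, q b ≤ C * X.leftSeminorm p b) (x : X.E) :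
    seminorm (Conj X.E) q (Conj.of x) ≤ √C * seminorm X.E p x := by
  rw [← X.seminorm_conj_leftSeminorm p x]
  exact seminorm_le_of_le hC h _

noncomputable instance conjHilbertModule : HilbertModule B (Conj X.E) where
  toPreHilbertModule := X.conjPreHilbertModule
  isUniformAddGroup := HilbertModule.isUniformAddGroup A (E := X.E)
  complete := HilbertModule.complete A (E := X.E)
  withSeminorms := by
    have hE := HilbertModule.withSeminorms (A := A) (E := X.E)
    let f : Conj X.E →ₗ⋆[ℂ] X.E :=
      { toFun := Conj.of.symm
        map_add' := fun _ _ => rfl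
        map_smul' := fun _ _ => rfl }
    have h : WithSeminorms _ := IsInducing.withSeminorms hE (f := f) ⟨induced_id.symm⟩
    refine h.congr (Seminorm.IsBounded.of_real fun q => ?_)
      (Seminorm.IsBounded.of_real fun p => ⟨{X.leftSeminorm p}, 1, fun x => ?_⟩)
    · obtain ⟨p, C, hC, h⟩ := X.exists_leftSeminorm_bound q
      refine ⟨{p}, √C, fun x => ?_⟩
      rw [Finset.sup_singleton]
      exact X.seminorm_conj_le hC h (Conj.of.symm x)
    · rw [Finset.sup_singleton, one_mul]
      exact (X.seminorm_conj_leftSeminorm p (Conj.of.symm x)).ge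

/-- The estimate for the right multiplications by elements of `A`, as operators on the conjugate
module. -/
theorem seminorm_conj_rsmul_le {p : CStarSeminorm A} {q : CStarSeminorm B} {C : ℝ} (hC : 0 ≤ C)
    (h : ∀ b, q b ≤ C * X.leftSeminorm p b) (x : X.E) (a : A) :
    seminorm (Conj X.E) q (Conj.of (rsmul x (star a))) ≤
      seminorm (Conj X.E) q (Conj.of x) * p a := by
  refine le_mul_of_sq_le_mul_star_mul
    (u := fun a => seminorm (Conj X.E) q (Conj.of (rsmul x (star a)))) (r := fun a => p a)
    (M := √C * seminorm X.E p x) p.nonneg (apply_nonneg _ _) (fun a => ?_) (fun a => ?_)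
    (fun a => (p.star_mul_self a).le) a
  · rw [seminorm_conj_sq, lip_rsmul_left, ← rsmul_mul, star_star, star_mul, star_star]
    exact cauchySchwarz q (Conj.of x) _
  · refine (X.seminorm_conj_le hC h _).trans ?_
    rw [mul_assoc, ← p.star_eq a]
    exact mul_le_mul_of_nonneg_left (seminorm_rsmul_le p x _) (Real.sqrt_nonneg _)

/-- Right multiplication by `a*`, as an operator on the conjugate module. -/
noncomputable def conjRsmul (a : A) : Module.End ℂ (Conj X.E) where
  toFun x := Conj.of (rsmul (Conj.of.symm x) (star a))
  map_add' x y := by rw [map_add, add_rsmul, map_add]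
  map_smul' c x := by
    change Conj.of (rsmul (star c • Conj.of.symm x) (star a)) = _
    rw [smul_rsmul, Conj.of_smul, star_star, RingHom.id_apply]

theorem isAdjointPair_conjRsmul (a : A) :
    IsAdjointPair B (X.conjRsmul a) (X.conjRsmul (star a)) := fun x y => by
  change X.lip _ _ = X.lip _ _
  rw [conjRsmul, conjRsmul]
  change X.lip (rsmul (Conj.of.symm x) (star a)) _ = X.lip _ (rsmul (Conj.of.symm y) (star (star a)))
  rw [lip_rsmul_left]

theorem isModuleMap_conjRsmul (a : A) : IsModuleMap B (X.conjRsmul a) := fun x b => by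
  change Conj.of (rsmul ((X.lact (star b)).toEnd (Conj.of.symm x)) (star a)) =
    Conj.of ((X.lact (star b)).toEnd (rsmul (Conj.of.symm x) (star a)))
  rw [toEnd_rsmul]

/-- Right multiplication by `a*`, as an adjointable operator on the conjugate module. -/
noncomputable def conjAdjointable (a : A) : Adjointable B (Conj X.E) :=
  ⟨X.conjRsmul a, X.isModuleMap_conjRsmul a, fun q => by
    obtain ⟨p, C, hC, h⟩ := X.exists_leftSeminorm_bound q
    refine ⟨p a + 1, add_pos_of_nonneg_of_pos (p.nonneg a) one_pos, fun x => ?_⟩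
    have h1 := X.seminorm_conj_rsmul_le hC h (Conj.of.symm x) a
    rw [mul_comm] at h1
    exact h1.trans (mul_le_mul_of_nonneg_right (lt_add_one _).le
      (apply_nonneg (seminorm (Conj X.E) q) x)), X.conjRsmul (star a),
    X.isModuleMap_conjRsmul _, X.isAdjointPair_conjRsmul a⟩

theorem conjAdjointable_toEnd (a : A) (x : Conj X.E) :
    (X.conjAdjointable a).toEnd x = Conj.of (rsmul (Conj.of.symm x) (star a)) := rfl

/-- The action of `A` on the conjugate module. -/
noncomputable def conjAction : A →⋆ₙₐ[ℂ] Adjointable B (Conj X.E) where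
  toFun a := X.conjAdjointable a
  map_smul' c a := Adjointable.ext fun x => by
    change _ = c • (X.conjAdjointable a).toEnd x
    rw [conjAdjointable_toEnd, conjAdjointable_toEnd, star_smul, rsmul_smul, Conj.smul_of]
  map_zero' := Adjointable.ext fun x => by
    change _ = (0 : Conj X.E)
    have h := rsmul_smul (0 : ℂ) (Conj.of.symm x) (0 : A)
    rw [zero_smul, zero_smul] at h
    rw [conjAdjointable_toEnd, star_zero, h, map_zero]
  map_add' a b := Adjointable.ext fun x => by
    rw [toEnd_add, LinearMap.add_apply, conjAdjointable_toEnd, conjAdjointable_toEnd,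
      conjAdjointable_toEnd, star_add, rsmul_add, map_add]
  map_mul' a b := Adjointable.ext fun x => by
    rw [toEnd_mul, Module.End.mul_apply, conjAdjointable_toEnd, conjAdjointable_toEnd,
      conjAdjointable_toEnd, star_mul, rsmul_mul, AddEquiv.symm_apply_apply]
  map_star' a := Adjointable.ext fun x => ext_ip B fun z => by
    rw [← inner_toEnd_left]
    exact (X.isAdjointPair_conjRsmul a z x).symm

theorem conjAction_ip (x y : X.E) : X.conjAction ⟪x, y⟫_A = theta (Conj.of x) (Conj.of y) :=
  Adjointable.ext fun z => by
    change Conj.of (rsmul (Conj.of.symm z) (star ⟪x, y⟫_A)) =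
      Conj.of ((X.lact (star (X.lip y (Conj.of.symm z)))).toEnd x)
    rw [star_lip, lact_lip, theta_toEnd, star_ip]

theorem isFull_conj : IsFull B (Conj X.E) := X.span_lip_dense

variable [IsLocallyCStar B]

theorem opSeminorm_conjAction_le {p : CStarSeminorm A} {q : CStarSeminorm B} {C : ℝ} (hC : 0 ≤ C)
    (h : ∀ b, q b ≤ C * X.leftSeminorm p b) (a : A) : opSeminorm q (X.conjAction a) ≤ p a :=
  opSeminorm_le q _ (p.nonneg a) fun x => by
    rw [mul_comm]; exact X.seminorm_conj_rsmul_le hC h (Conj.of.symm x) a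

/-- The conjugate module is an imprimitivity module in the other direction: strong Morita
equivalence is symmetric. -/
noncomputable def symm : ImprimitivityModule B A :=
  ofAction (E := Conj X.E) X.isFull_conj X.conjAction
    (fun x y => ⟪Conj.of.symm x, Conj.of.symm y⟫_A)
    (fun x y => X.conjAction_ip _ _) X.isFull
    (fun q => by
      obtain ⟨p, C, hC, h⟩ := X.exists_leftSeminorm_bound q
      exact ⟨1, p, fun a => by rw [one_mul]; exact X.opSeminorm_conjAction_le hC h a⟩)
    (fun p => ⟨X.leftSeminorm p, fun x y =>
      ⟨seminorm X.E p (Conj.of.symm x) * seminorm X.E p (Conj.of.symm y), fun a => by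
        have h1 : a * ⟪Conj.of.symm x, Conj.of.symm y⟫_A =
            ⟪rsmul (Conj.of.symm x) (star a), Conj.of.symm y⟫_A := by
          rw [ip_rsmul_left, star_star]
        have h2 := le_opSeminorm (X.leftSeminorm p) (X.conjAction a) x
        change seminorm (Conj X.E) (X.leftSeminorm p)
          (Conj.of (rsmul (Conj.of.symm x) (star a))) ≤ _ at h2
        have h3 := X.seminorm_conj_leftSeminorm p (Conj.of.symm x)
        rw [AddEquiv.apply_symm_apply] at h3
        rw [seminorm_conj_leftSeminorm, h3] at h2
        rw [h1]
        refine (cauchySchwarz p _ _).trans ?_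
        have := mul_le_mul_of_nonneg_right h2 (apply_nonneg (seminorm X.E p) (Conj.of.symm y))
        linarith⟩⟩)

/-- The map from an imprimitivity module to its conjugate. -/
def toSymm (x : X.E) : X.symm.E := (Conj.of x : Conj X.E)

theorem symm_ip (x y : X.E) : ⟪X.toSymm x, X.toSymm y⟫_B = X.lip x y := rfl

theorem symm_lip (x y : X.E) : X.symm.lip (X.toSymm x) (X.toSymm y) = ⟪x, y⟫_A :=
  X.symm.lact_injective ((X.symm.lact_lip _ _).trans (X.conjAction_ip x y).symm)

end

end ImprimitivityModule

/-! ### Direct sums of Hilbert modules -/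

section DirectSum

open PreHilbertModule Adjointable

variable {A : Type u} [NonUnitalRing A] [StarRing A] [Module ℂ A] [IsScalarTower ℂ A A]
  [SMulCommClass ℂ A A] [StarModule ℂ A] [TopologicalSpace A]

/-- C*-seminorms are monotone on positive elements. -/
theorem IsPos.le_add {a b : A} (ha : IsPos a) (hb : IsPos b) (p : CStarSeminorm A) :
    p a ≤ p (a + b) := by
  obtain ⟨C, iC, f, hf⟩ := p.exists_hom
  obtain ⟨c, hc⟩ := ha p C iC f hf
  obtain ⟨d, hd⟩ := hb p C iC f hf
  let _ := CStarAlgebra.spectralOrder C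
  have _ := CStarAlgebra.spectralOrderedRing C
  have h0 : 0 ≤ f a := hc ▸ star_mul_self_nonneg c
  have h1 : 0 ≤ f b := hd ▸ star_mul_self_nonneg d
  rw [← hf, ← hf, map_add]
  exact CStarAlgebra.norm_le_norm_of_nonneg_of_le h0 (le_add_of_nonneg_right h1)

variable [IsLocallyCStar A]
variable (E F : Type*) [AddCommGroup E] [Module ℂ E] [AddCommGroup F] [Module ℂ F]

/-- The direct sum of two pre-Hilbert modules over a locally C*-algebra. -/
noncomputable instance [PreHilbertModule A E] [PreHilbertModule A F] :
    PreHilbertModule A (E × F) where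
  inner x y := ⟪x.1, y.1⟫_A + ⟪x.2, y.2⟫_A
  rsmul x a := (rsmul x.1 a, rsmul x.2 a)
  add_rsmul x y a := Prod.ext (add_rsmul _ _ _) (add_rsmul _ _ _)
  rsmul_add x a b := Prod.ext (rsmul_add _ _ _) (rsmul_add _ _ _)
  rsmul_mul x a b := Prod.ext (rsmul_mul _ _ _) (rsmul_mul _ _ _)
  smul_rsmul c x a := Prod.ext (smul_rsmul _ _ _) (smul_rsmul _ _ _)
  rsmul_smul c x a := Prod.ext (rsmul_smul _ _ _) (rsmul_smul _ _ _)
  ip_add_right x y z := by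
    rw [Prod.fst_add, Prod.snd_add, ip_add_right, ip_add_right]; abel
  ip_smul_right c x y := by
    rw [Prod.smul_fst, Prod.smul_snd, ip_smul_right, ip_smul_right, smul_add]
  ip_rsmul_right x y a := by rw [ip_rsmul_right, ip_rsmul_right, add_mul]
  star_ip x y := by rw [star_add, star_ip, star_ip]
  ip_self_nonneg x := by
    obtain ⟨r, hr, hrr, -⟩ :=
      ((isPos_ip_self (A := A) x.1).add (isPos_ip_self (A := A) x.2)).exists_sqrt
    exact ⟨r, by rw [hr, hrr]⟩
  ip_self_eq_zero x h := by
    have h1 : ⟪x.1, x.1⟫_A = 0 := IsLocallyCStar.eq_zero fun p => by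
      refine le_antisymm ?_ (p.nonneg _)
      refine ((isPos_ip_self (A := A) x.1).le_add (isPos_ip_self (A := A) x.2) p).trans ?_
      rw [h]; exact (map_zero p.toSeminorm).le
    rw [h1, zero_add] at h
    exact Prod.ext (ip_self_eq_zero x.1 h1) (ip_self_eq_zero x.2 h)

theorem prod_ip [PreHilbertModule A E] [PreHilbertModule A F] (x y : E × F) :
    ⟪x, y⟫_A = ⟪x.1, y.1⟫_A + ⟪x.2, y.2⟫_A := rfl

theorem seminorm_fst_le [PreHilbertModule A E] [PreHilbertModule A F] (p : CStarSeminorm A)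
    (x : E × F) : seminorm E p x.1 ≤ seminorm (E × F) p x :=
  Real.sqrt_le_sqrt ((isPos_ip_self (A := A) x.1).le_add (isPos_ip_self (A := A) x.2) p)

theorem seminorm_snd_le [PreHilbertModule A E] [PreHilbertModule A F] (p : CStarSeminorm A)
    (x : E × F) : seminorm F p x.2 ≤ seminorm (E × F) p x := by
  refine Real.sqrt_le_sqrt ?_
  rw [prod_ip, add_comm]
  exact (isPos_ip_self (A := A) x.2).le_add (isPos_ip_self (A := A) x.1) p

theorem seminorm_prod_le [PreHilbertModule A E] [PreHilbertModule A F] (p : CStarSeminorm A)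
    (x : E × F) : seminorm (E × F) p x ≤ seminorm E p x.1 + seminorm F p x.2 := by
  have h1 : 0 ≤ seminorm E p x.1 := apply_nonneg _ _
  have h2 : 0 ≤ seminorm F p x.2 := apply_nonneg _ _
  refine (sq_le_sq₀ (apply_nonneg _ _) (by positivity)).mp ?_
  rw [seminorm_sq, prod_ip]
  refine (map_add_le_add p.toSeminorm _ _).trans ?_
  change p ⟪x.1, x.1⟫_A + p ⟪x.2, x.2⟫_A ≤ _
  rw [← seminorm_sq, ← seminorm_sq]
  nlinarith

noncomputable instance [UniformSpace E] [UniformSpace F] [HilbertModule A E]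
    [HilbertModule A F] : HilbertModule A (E × F) where
  isUniformAddGroup := by
    have := HilbertModule.isUniformAddGroup A (E := E)
    have := HilbertModule.isUniformAddGroup A (E := F)
    infer_instance
  complete := by
    have := HilbertModule.complete A (E := E)
    have := HilbertModule.complete A (E := F)
    infer_instance
  withSeminorms := by
    have hE := HilbertModule.withSeminorms (A := A) (E := E)
    have hF := HilbertModule.withSeminorms (A := A) (E := F)
    have := HilbertModule.isUniformAddGroup A (E := E)
    have := HilbertModule.isUniformAddGroup A (E := F)
    have := hE.continuousSMul
    have := hF.continuousSMul
    refine (SeminormFamily.withSeminorms_iff_nhds_eq_iInf _).mpr (le_antisymm ?_ ?_)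
    · refine le_iInf fun p => tendsto_iff_comap.mp ?_
      have hc : Continuous ((seminorm E p).comp (LinearMap.fst ℂ E F) +
          (seminorm F p).comp (LinearMap.snd ℂ E F)) :=
        ((hE.continuous_seminorm p).comp continuous_fst).add
          ((hF.continuous_seminorm p).comp continuous_snd)
      have hc' : Continuous (seminorm (E × F) p) :=
        Seminorm.continuous_of_le hc (fun x => seminorm_prod_le E F p x)
      have h := hc'.tendsto 0
      rwa [map_zero] at h
    · have h : ∀ (p : CStarSeminorm A) (ε : ℝ), 0 < ε →
          ∀ᶠ x in ⨅ p : CStarSeminorm A, comap (seminorm (E × F) p) (𝓝 0),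
            seminorm (E × F) p x < ε := fun p ε hε =>
        (tendsto_comap.eventually_lt_const hε).filter_mono (iInf_le _ p)
      rw [← Prod.mk_zero_zero, nhds_prod_eq, ← tendsto_id']
      refine Tendsto.prodMk ((hE.tendsto_nhds _ _).mpr fun p ε hε => ?_)
        ((hF.tendsto_nhds _ _).mpr fun p ε hε => ?_)
      · filter_upwards [h p ε hε] with x hx
        rw [sub_zero]
        exact (seminorm_fst_le E F p x).trans_lt hx
      · filter_upwards [h p ε hε] with x hx
        rw [sub_zero]
        exact (seminorm_snd_le E F p x).trans_lt hx

end DirectSum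

/-! ### Ternary rings of operators -/

/-- The continuous C*-seminorms of an algebra embedded in `R` are dominated by those of `R`. -/
theorem exists_bound_of_isInducing {A R : Type*} [NonUnitalRing A] [StarRing A] [Module ℂ A]
    [TopologicalSpace A] [NonUnitalRing R] [StarRing R] [Module ℂ R] [TopologicalSpace R]
    [IsLocallyCStar R] {f : A →⋆ₙₐ[ℂ] R} (hf : IsInducing f) (q : CStarSeminorm A) :
    ∃ (r : CStarSeminorm R) (C : ℝ), 0 ≤ C ∧ ∀ a, q a ≤ C * r (f a) := by
  obtain ⟨s, C, hC, h⟩ := Seminorm.bound_comp_of_isInducing (p := q.toSeminorm) q.continuous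
    (IsLocallyCStar.withSeminorms (A := R)) (f := (f : A →ₗ[ℂ] R)) hf
  obtain ⟨r, hr⟩ := CStarSeminorm.exists_finset_sup_le s
  refine ⟨r, C, C.2, fun a => (h a).trans ?_⟩
  exact mul_le_mul_of_nonneg_left (hr (f a)) C.2

section Ternary

open PreHilbertModule Adjointable

variable (R A B : Type u) [NonUnitalRing A] [StarRing A] [Module ℂ A] [IsScalarTower ℂ A A]
  [SMulCommClass ℂ A A] [StarModule ℂ A] [TopologicalSpace A]
  [NonUnitalRing B] [StarRing B] [Module ℂ B] [IsScalarTower ℂ B B]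
  [SMulCommClass ℂ B B] [StarModule ℂ B] [TopologicalSpace B]
  [NonUnitalRing R] [StarRing R] [Module ℂ R] [IsScalarTower ℂ R R]
  [SMulCommClass ℂ R R] [StarModule ℂ R] [TopologicalSpace R]

/-- A ternary ring of operators: a closed subspace `F` of an algebra `R` such that the products
`S* T` and `S T*` of its elements span dense subspaces of subalgebras `A` and `B` of `R` with
`F A ⊆ F` and `B F ⊆ F`. The subalgebras are given by topological embeddings into `R`. -/
structure TernaryRing where
  carrier : Submodule ℂ R
  isClosed : IsClosed (carrier : Set R)
  right : A →⋆ₙₐ[ℂ] R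
  isInducing_right : IsInducing right
  left : B →⋆ₙₐ[ℂ] R
  isInducing_left : IsInducing left
  mul_right_mem : ∀ T ∈ carrier, ∀ a, T * right a ∈ carrier
  left_mul_mem : ∀ T ∈ carrier, ∀ b, left b * T ∈ carrier
  star_mul_mem : ∀ S ∈ carrier, ∀ T ∈ carrier, ∃ a, right a = star S * T
  mul_star_mem : ∀ S ∈ carrier, ∀ T ∈ carrier, ∃ b, left b = S * star T
  dense_right : closure (Submodule.span ℂ {a | ∃ S ∈ carrier, ∃ T ∈ carrier,
    right a = star S * T} : Set A) = Set.univ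
  dense_left : closure (Submodule.span ℂ {b | ∃ S ∈ carrier, ∃ T ∈ carrier,
    left b = S * star T} : Set B) = Set.univ

namespace TernaryRing

variable {R A B} [IsLocallyCStar R] [IsLocallyCStar A] [IsLocallyCStar B]
variable (F : TernaryRing R A B)

theorem right_injective : Function.Injective F.right :=
  have := IsLocallyCStar.t2 (A := A)
  F.isInducing_right.injective

theorem left_injective : Function.Injective F.left :=
  have := IsLocallyCStar.t2 (A := B)
  F.isInducing_left.injective

/-- The `A`-valued inner product `S* T`; it is only meaningful for elements of the ternary ring. -/
noncomputable def ip (S T : R) : A := Function.invFun F.right (star S * T)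

/-- The `B`-valued inner product `S T*`; it is only meaningful for elements of the ternary ring. -/
noncomputable def lip (S T : R) : B := Function.invFun F.left (S * star T)

theorem right_ip (S : R) (hS : S ∈ F.carrier) (T : R) (hT : T ∈ F.carrier) :
    F.right (F.ip S T) = star S * T :=
  Function.invFun_eq (F.star_mul_mem S hS T hT)

theorem left_lip (S : R) (hS : S ∈ F.carrier) (T : R) (hT : T ∈ F.carrier) :
    F.left (F.lip S T) = S * star T :=
  Function.invFun_eq (F.mul_star_mem S hS T hT)

theorem isClosed_range_right : IsClosed (Set.range F.right) := by
  have := IsLocallyCStar.t2 (A := R)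
  have := IsLocallyCStar.isTopologicalAddGroup R
  exact (IsLocallyCStar.complete (A := A)).isClosed_range (F.right : A →+ R) F.isInducing_right

noncomputable instance : PreHilbertModule A F.carrier where
  inner S T := F.ip S T
  rsmul S a := ⟨S * F.right a, F.mul_right_mem S S.2 a⟩
  add_rsmul S T a := Subtype.ext (add_mul _ _ _)
  rsmul_add S a b := Subtype.ext (by
    change (S : R) * F.right (a + b) = S * F.right a + S * F.right b
    rw [map_add, mul_add])
  rsmul_mul S a b := Subtype.ext (by
    change (S : R) * F.right (a * b) = S * F.right a * F.right b
    rw [map_mul, mul_assoc])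
  smul_rsmul c S a := Subtype.ext (smul_mul_assoc _ _ _)
  rsmul_smul c S a := Subtype.ext (by
    change (S : R) * F.right (c • a) = c • (S * F.right a)
    rw [map_smul, mul_smul_comm])
  ip_add_right S T U := F.right_injective (by
    rw [map_add, F.right_ip _ S.2 _ (T + U).2, F.right_ip _ S.2 _ T.2, F.right_ip _ S.2 _ U.2,
      ← mul_add]
    rfl)
  ip_smul_right c S T := F.right_injective (by
    rw [map_smul, F.right_ip _ S.2 _ (c • T).2, F.right_ip _ S.2 _ T.2, ← mul_smul_comm]
    rfl)
  ip_rsmul_right S T a := F.right_injective (by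
    rw [map_mul, F.right_ip _ S.2 _ (F.mul_right_mem T T.2 a), F.right_ip _ S.2 _ T.2, mul_assoc])
  star_ip S T := F.right_injective (by
    rw [map_star, F.right_ip _ S.2 _ T.2, F.right_ip _ T.2 _ S.2, star_mul, star_star])
  ip_self_nonneg S := by
    obtain ⟨r, hr, hrr, hS⟩ := (isPos_star_mul_self (S : R)).exists_sqrt
    obtain ⟨b, rfl⟩ : r ∈ LinearMap.range (F.right : A →ₗ[ℂ] R) := by
      refine hS _ ?_ F.isClosed_range_right ⟨F.ip S S, F.right_ip _ S.2 _ S.2⟩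
      rintro _ ⟨a, rfl⟩ _ ⟨b, rfl⟩
      exact ⟨a * b, map_mul F.right a b⟩
    refine ⟨b, F.right_injective ?_⟩
    rw [map_mul, map_star, F.right_ip _ S.2 _ S.2, ← hrr]
    exact congrArg (· * F.right b) hr.symm
  ip_self_eq_zero S h := by
    have h1 : star (S : R) * S = 0 := by rw [← F.right_ip _ S.2 _ S.2, h, map_zero]
    refine Subtype.ext (IsLocallyCStar.eq_zero fun p => ?_)
    have h2 := p.star_mul_self (S : R)
    rw [h1] at h2
    have h0 : p (0 : R) = 0 := map_zero p.toSeminorm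
    rw [h0] at h2
    exact (pow_eq_zero_iff two_ne_zero).mp h2.symm

theorem ip_def (S T : F.carrier) : ⟪S, T⟫_A = F.ip S T := rfl

theorem coe_rsmul (S : F.carrier) (a : A) : ((rsmul S a : F.carrier) : R) = S * F.right a := rfl

/-- The C*-seminorm on `A` induced by one on `R`. -/
noncomputable def rightSeminorm (r : CStarSeminorm R) : CStarSeminorm A :=
  r.comap F.right F.isInducing_right.continuous

theorem seminorm_rightSeminorm (r : CStarSeminorm R) (S : F.carrier) :
    seminorm F.carrier (F.rightSeminorm r) S = r S := by
  refine (pow_left_inj₀ (apply_nonneg _ _) (r.nonneg _) two_ne_zero).mp ?_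
  rw [seminorm_sq, ip_def, rightSeminorm, CStarSeminorm.comap_apply, F.right_ip _ S.2 _ S.2,
    r.star_mul_self]

theorem seminorm_le {p : CStarSeminorm A} {r : CStarSeminorm R} {C : ℝ} (hC : 0 ≤ C)
    (h : ∀ a, p a ≤ C * r (F.right a)) (S : F.carrier) :
    seminorm F.carrier p S ≤ √C * r S := by
  rw [← F.seminorm_rightSeminorm r S]
  exact seminorm_le_of_le hC h S

theorem withSeminorms :
    WithSeminorms (fun p : CStarSeminorm A => seminorm F.carrier p) := by
  have h : WithSeminorms _ := IsInducing.withSeminorms (IsLocallyCStar.withSeminorms (A := R))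
    (f := F.carrier.subtype) IsInducing.subtypeVal
  refine h.congr (Seminorm.IsBounded.of_real fun p => ?_)
    (Seminorm.IsBounded.of_real fun r => ⟨{F.rightSeminorm r}, 1, fun S => ?_⟩)
  · obtain ⟨r, C, hC, h⟩ := exists_bound_of_isInducing F.isInducing_right p
    refine ⟨{r}, √C, fun S => ?_⟩
    rw [Finset.sup_singleton]
    exact F.seminorm_le hC h S
  · rw [Finset.sup_singleton, one_mul]
    exact (F.seminorm_rightSeminorm r S).ge

theorem isTopologicalAddGroup_carrier : IsTopologicalAddGroup F.carrier :=
  F.withSeminorms.topologicalAddGroup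

noncomputable instance : UniformSpace F.carrier :=
  have := F.isTopologicalAddGroup_carrier
  IsTopologicalAddGroup.rightUniformSpace F.carrier

noncomputable instance : HilbertModule A F.carrier where
  isUniformAddGroup :=
    have := F.isTopologicalAddGroup_carrier
    isUniformAddGroup_of_addCommGroup
  withSeminorms := F.withSeminorms
  complete :=
    have := F.isTopologicalAddGroup_carrier
    ((IsLocallyCStar.complete (A := R)).of_isClosedEmbedding
      (AddSubgroupClass.subtype F.carrier)
      F.isClosed.isClosedEmbedding_subtypeVal).completeSpace_rightUniformSpace

/-- Left multiplication by an element of `B`. -/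
noncomputable def leftMul (b : B) : Module.End ℂ F.carrier where
  toFun S := ⟨F.left b * S, F.left_mul_mem S S.2 b⟩
  map_add' _ _ := Subtype.ext (mul_add _ _ _)
  map_smul' _ _ := Subtype.ext (mul_smul_comm _ _ _)

theorem coe_leftMul (b : B) (S : F.carrier) : (F.leftMul b S : R) = F.left b * S := rfl

theorem isAdjointPair_leftMul (b : B) : IsAdjointPair A (F.leftMul b) (F.leftMul (star b)) :=
  fun S T => F.right_injective (by
    rw [ip_def, ip_def, F.right_ip _ (Subtype.coe_prop _) _ T.2,
      F.right_ip _ S.2 _ (Subtype.coe_prop _), coe_leftMul, coe_leftMul, star_mul, map_star,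
      mul_assoc])

theorem isModuleMap_leftMul (b : B) : IsModuleMap A (F.leftMul b) := fun S a =>
  Subtype.ext (by rw [coe_leftMul, coe_rsmul, coe_rsmul, coe_leftMul, mul_assoc])

theorem seminorm_leftMul_le {p : CStarSeminorm A} {r : CStarSeminorm R} {C : ℝ} (hC : 0 ≤ C)
    (h : ∀ a, p a ≤ C * r (F.right a)) (b : B) (S : F.carrier) :
    seminorm F.carrier p (F.leftMul b S) ≤ seminorm F.carrier p S * r (F.left b) := by
  refine le_mul_of_sq_le_mul_star_mul (u := fun b => seminorm F.carrier p (F.leftMul b S))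
    (r := fun b => r (F.left b)) (M := √C * r S) (fun b => r.nonneg _) (apply_nonneg _ _)
    (fun b => ?_) (fun b => ?_) (fun b => ?_) b
  · rw [seminorm_sq, F.isAdjointPair_leftMul]
    have h1 : F.leftMul (star b) (F.leftMul b S) = F.leftMul (star b * b) S :=
      Subtype.ext (by rw [coe_leftMul, coe_leftMul, coe_leftMul, map_mul, mul_assoc])
    rw [h1]
    exact cauchySchwarz p _ _
  · refine (F.seminorm_le hC h _).trans ?_
    rw [mul_assoc, coe_leftMul, mul_comm (r S)]
    exact mul_le_mul_of_nonneg_left (r.mul_le _ _) (Real.sqrt_nonneg _)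
  · rw [map_mul, map_star, r.star_mul_self]

/-- Left multiplication by an element of `B`, as an adjointable operator. -/
noncomputable def leftAdjointable (b : B) : Adjointable A F.carrier :=
  ⟨F.leftMul b, F.isModuleMap_leftMul b, fun p => by
    obtain ⟨r, C, hC, h⟩ := exists_bound_of_isInducing F.isInducing_right p
    refine ⟨r (F.left b) + 1, add_pos_of_nonneg_of_pos (r.nonneg _) one_pos, fun S => ?_⟩
    have h1 := F.seminorm_leftMul_le hC h b S
    rw [mul_comm] at h1
    exact h1.trans (mul_le_mul_of_nonneg_right (lt_add_one _).le (apply_nonneg _ _)),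
    F.leftMul (star b), F.isModuleMap_leftMul _, F.isAdjointPair_leftMul b⟩

/-- The action of `B` by left multiplication. -/
noncomputable def leftAction : B →⋆ₙₐ[ℂ] Adjointable A F.carrier where
  toFun b := F.leftAdjointable b
  map_smul' c b := Adjointable.ext fun S => Subtype.ext (by
    change F.left (c • b) * S = c • (F.left b * (S : R))
    rw [map_smul, smul_mul_assoc])
  map_zero' := Adjointable.ext fun S => Subtype.ext (by
    change F.left 0 * S = (0 : R)
    rw [map_zero, zero_mul])
  map_add' b c := Adjointable.ext fun S => Subtype.ext (by
    change F.left (b + c) * S = F.left b * S + F.left c * S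
    rw [map_add, add_mul])
  map_mul' b c := Adjointable.ext fun S => Subtype.ext (by
    change F.left (b * c) * S = F.left b * (F.left c * S)
    rw [map_mul, mul_assoc])
  map_star' b := Adjointable.ext fun S => ext_ip A fun T => by
    rw [← inner_toEnd_left]
    exact (F.isAdjointPair_leftMul b T S).symm

theorem leftAction_lip (S T : F.carrier) : F.leftAction (F.lip S T) = theta S T :=
  Adjointable.ext fun U => Subtype.ext (by
    change F.left (F.lip S T) * U = S * F.right (F.ip T U)
    rw [F.left_lip _ S.2 _ T.2, F.right_ip _ T.2 _ U.2, mul_assoc])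

/-- A ternary ring of operators is an imprimitivity module. -/
noncomputable def imprimitivityModule : ImprimitivityModule A B :=
  ImprimitivityModule.ofAction (E := F.carrier)
    (by
      have h := F.dense_right
      unfold IsFull innerSpan
      convert h using 4
      ext a
      refine ⟨fun ⟨S, T, h⟩ => ⟨S, S.2, T, T.2, ?_⟩, fun ⟨S, hS, T, hT, h⟩ =>
        ⟨⟨S, hS⟩, ⟨T, hT⟩, F.right_injective ((F.right_ip S hS T hT).trans h.symm)⟩⟩
      rw [← h]
      exact F.right_ip _ S.2 _ T.2)
    F.leftAction (fun S T => F.lip S T) F.leftAction_lip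
    (by
      have h := F.dense_left
      convert h using 4
      ext a
      refine ⟨fun ⟨S, T, h⟩ => ⟨S, S.2, T, T.2, ?_⟩, fun ⟨S, hS, T, hT, h⟩ =>
        ⟨⟨S, hS⟩, ⟨T, hT⟩, F.left_injective ((F.left_lip S hS T hT).trans h.symm)⟩⟩
      rw [← h]
      exact F.left_lip _ S.2 _ T.2)
    (fun p => by
      obtain ⟨r, C, hC, h⟩ := exists_bound_of_isInducing F.isInducing_right p
      refine ⟨1, r.comap F.left F.isInducing_left.continuous, fun b => ?_⟩
      refine opSeminorm_le p _ (by rw [one_mul]; exact r.nonneg _) fun S => ?_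
      rw [one_mul, mul_comm]
      exact F.seminorm_leftMul_le hC h b S)
    (fun q => by
      obtain ⟨r, C, hC, h⟩ := exists_bound_of_isInducing F.isInducing_left q
      refine ⟨F.rightSeminorm r, fun S T => ⟨C * r S * r T, fun b => ?_⟩⟩
      refine (h _).trans ?_
      have h1 := le_opSeminorm (F.rightSeminorm r) (F.leftAction b) S
      rw [F.seminorm_rightSeminorm, F.seminorm_rightSeminorm] at h1
      change r (F.left b * S) ≤ _ at h1
      have h2 : r (F.left (b * F.lip S T)) ≤ r (F.left b * S) * r T := by
        rw [map_mul, F.left_lip _ S.2 _ T.2, ← mul_assoc, ← r.star_eq (T : R)]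
        exact r.mul_le _ _
      have h3 := mul_le_mul_of_nonneg_right h1 (r.nonneg T)
      have h4 := mul_le_mul_of_nonneg_left (h2.trans h3) hC
      linarith)

end TernaryRing

end Ternary

/-! ### Composition of strong Morita equivalences -/

section Composition

open PreHilbertModule Adjointable

/-- An adjointable isometry between Hilbert modules, together with its adjoint. -/
structure AdjointableIsometry (C E Z : Type*) [NonUnitalRing C] [StarRing C] [Module ℂ C]
    [AddCommGroup E] [Module ℂ E] [PreHilbertModule C E]
    [AddCommGroup Z] [Module ℂ Z] [PreHilbertModule C Z] where
  map : E →ₗ[ℂ] Z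
  adj : Z →ₗ[ℂ] E
  ip_map_left : ∀ x z, ⟪map x, z⟫_C = ⟪x, adj z⟫_C
  adj_map : ∀ x, adj (map x) = x

namespace AdjointableIsometry

section

variable {C : Type*} [NonUnitalRing C] [StarRing C] [Module ℂ C] [IsScalarTower ℂ C C]
  [SMulCommClass ℂ C C] [StarModule ℂ C] [TopologicalSpace C]
variable {E Z : Type*} [AddCommGroup E] [Module ℂ E] [PreHilbertModule C E]
  [AddCommGroup Z] [Module ℂ Z] [PreHilbertModule C Z]
variable (e : AdjointableIsometry C E Z)

theorem ip_map_right (x : E) (z : Z) : ⟪z, e.map x⟫_C = ⟪e.adj z, x⟫_C := by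
  rw [← star_ip, ip_map_left, star_ip]

theorem ip_map_map (x y : E) : ⟪e.map x, e.map y⟫_C = ⟪x, y⟫_C := by
  rw [ip_map_left, adj_map]

theorem map_rsmul (x : E) (c : C) : e.map (rsmul x c) = rsmul (e.map x) c :=
  ext_ip C fun z => by rw [ip_map_right, ip_rsmul_right, ip_rsmul_right, ip_map_right]

theorem adj_rsmul (z : Z) (c : C) : e.adj (rsmul z c) = rsmul (e.adj z) c :=
  ext_ip C fun x => by rw [← ip_map_left, ip_rsmul_right, ip_rsmul_right, ← ip_map_left]

theorem seminorm_map (p : CStarSeminorm C) (x : E) : seminorm Z p (e.map x) = seminorm E p x := by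
  rw [seminorm_apply, seminorm_apply, ip_map_map]

theorem seminorm_adj_le (p : CStarSeminorm C) (z : Z) :
    seminorm E p (e.adj z) ≤ seminorm Z p z := by
  have h : seminorm E p (e.adj z) ^ 2 ≤ seminorm E p (e.adj z) * seminorm Z p z := by
    rw [seminorm_sq, ← ip_map_left, ← e.seminorm_map]
    exact cauchySchwarz p _ _
  by_contra hc
  push Not at hc
  have h0 : 0 ≤ seminorm Z p z := apply_nonneg _ _
  nlinarith

/-- The extension by zero of an operator on `E` to an operator on `Z`. -/
noncomputable def conj (T : Adjointable C E) : Adjointable C Z :=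
  ⟨e.map ∘ₗ T.toEnd ∘ₗ e.adj, fun z c => by
    simp only [LinearMap.comp_apply, adj_rsmul, toEnd_rsmul, map_rsmul], fun p =>
    ⟨opSeminorm p T + 1, add_pos_of_nonneg_of_pos (apply_nonneg _ _) one_pos, fun z => by
      simp only [LinearMap.comp_apply, seminorm_map]
      have h1 := le_opSeminorm p T (e.adj z)
      have h2 := mul_le_mul_of_nonneg_left (e.seminorm_adj_le p z) (apply_nonneg (opSeminorm p) T)
      have h3 : 0 ≤ seminorm Z p z := apply_nonneg _ _
      linarith⟩, e.map ∘ₗ (star T).toEnd ∘ₗ e.adj, fun z c => by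
    simp only [LinearMap.comp_apply, adj_rsmul, toEnd_rsmul, map_rsmul], fun z w => by
    simp only [LinearMap.comp_apply, ip_map_left, ip_map_right, inner_toEnd_left]⟩

theorem conj_toEnd (T : Adjointable C E) (z : Z) :
    (e.conj T).toEnd z = e.map (T.toEnd (e.adj z)) := rfl

/-- The extension by zero of operators, as a `*`-homomorphism. -/
noncomputable def conjHom : Adjointable C E →⋆ₙₐ[ℂ] Adjointable C Z where
  toFun := e.conj
  map_smul' c T := Adjointable.ext fun z => by
    change e.map (c • T.toEnd (e.adj z)) = c • e.map (T.toEnd (e.adj z))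
    rw [map_smul]
  map_zero' := Adjointable.ext fun z => map_zero e.map
  map_add' S T := Adjointable.ext fun z => map_add e.map _ _
  map_mul' S T := Adjointable.ext fun z => by
    rw [toEnd_mul, Module.End.mul_apply, conj_toEnd, conj_toEnd, conj_toEnd, adj_map]
    rfl
  map_star' T := Adjointable.ext fun z => ext_ip C fun w => by
    rw [← inner_toEnd_left, conj_toEnd, conj_toEnd, ip_map_left, ip_map_right, inner_toEnd_left]

theorem conjHom_apply (T : Adjointable C E) : e.conjHom T = e.conj T := rfl

theorem conj_theta (x y : E) : e.conj (theta x y) = theta (e.map x) (e.map y) :=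
  Adjointable.ext fun z => by
    rw [conj_toEnd, theta_toEnd, theta_toEnd, map_rsmul, ip_map_left]

theorem opSeminorm_conj (p : CStarSeminorm C) (T : Adjointable C E) :
    opSeminorm p (e.conj T) = opSeminorm p T := by
  refine le_antisymm (opSeminorm_le p _ (apply_nonneg _ _) fun z => ?_)
    (opSeminorm_le p _ (apply_nonneg _ _) fun x => ?_)
  · rw [conj_toEnd, seminorm_map]
    exact (le_opSeminorm p T _).trans
      (mul_le_mul_of_nonneg_left (e.seminorm_adj_le p z) (apply_nonneg _ _))
  · have h := le_opSeminorm p (e.conj T) (e.map x)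
    rwa [conj_toEnd, adj_map, seminorm_map, seminorm_map] at h

theorem isInducing_conjHom : IsInducing e.conjHom :=
  isInducing_of_seminorm_bounds (Adjointable.withSeminorms (A := C) (E := E))
    (Adjointable.withSeminorms (A := C) (E := Z))
    (e.conjHom : Adjointable C E →ₗ[ℂ] Adjointable C Z)
    (fun p => ⟨1, p, fun T => by rw [one_mul]; exact (e.opSeminorm_conj p T).le⟩)
    (fun p => ⟨1, p, fun T => by rw [one_mul]; exact (e.opSeminorm_conj p T).ge⟩)

end

section

variable {C : Type u} [NonUnitalRing C] [StarRing C] [Module ℂ C] [IsScalarTower ℂ C C]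
  [SMulCommClass ℂ C C] [StarModule ℂ C] [TopologicalSpace C]
variable {Z : Type u} [AddCommGroup Z] [Module ℂ Z]
variable {E₁ E₂ : Type u} [AddCommGroup E₁] [Module ℂ E₁] [AddCommGroup E₂] [Module ℂ E₂]

/-- The closed linear span of the rank-one operators from the range of `e₁` to that of `e₂`. -/
noncomputable def corner [PreHilbertModule C Z] [PreHilbertModule C E₁] [PreHilbertModule C E₂]
    (e₂ : AdjointableIsometry C E₂ Z) (e₁ : AdjointableIsometry C E₁ Z) :
    Submodule ℂ (Adjointable C Z) :=
  have := (Adjointable.withSeminorms (A := C) (E := Z)).topologicalAddGroup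
  have := (Adjointable.withSeminorms (A := C) (E := Z)).continuousSMul
  (Submodule.span ℂ {T | ∃ y x, theta (e₂.map y) (e₁.map x) = T}).topologicalClosure

theorem isClosed_corner [PreHilbertModule C Z] [PreHilbertModule C E₁] [PreHilbertModule C E₂]
    (e₂ : AdjointableIsometry C E₂ Z) (e₁ : AdjointableIsometry C E₁ Z) :
    IsClosed (corner e₂ e₁ : Set (Adjointable C Z)) := isClosed_closure

theorem theta_mem_corner [PreHilbertModule C Z] [PreHilbertModule C E₁] [PreHilbertModule C E₂]
    (e₂ : AdjointableIsometry C E₂ Z) (e₁ : AdjointableIsometry C E₁ Z) (y : E₂) (x : E₁) :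
    theta (e₂.map y) (e₁.map x) ∈ corner e₂ e₁ :=
  subset_closure (Submodule.subset_span ⟨y, x, rfl⟩)

theorem corner_le [PreHilbertModule C Z] [PreHilbertModule C E₁] [PreHilbertModule C E₂]
    {e₂ : AdjointableIsometry C E₂ Z} {e₁ : AdjointableIsometry C E₁ Z}
    {S : Submodule ℂ (Adjointable C Z)} (hS : IsClosed (S : Set (Adjointable C Z)))
    (h : ∀ y x, theta (e₂.map y) (e₁.map x) ∈ S) : corner e₂ e₁ ≤ S :=
  closure_minimal (Submodule.span_le.mpr (by rintro _ ⟨y, x, rfl⟩; exact h y x)) hS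

variable [UniformSpace Z] [HilbertModule C Z] [IsLocallyCStar C]

theorem star_mem_corner [PreHilbertModule C E₁] [PreHilbertModule C E₂]
    {e₂ : AdjointableIsometry C E₂ Z} {e₁ : AdjointableIsometry C E₁ Z} {T : Adjointable C Z}
    (hT : T ∈ corner e₂ e₁) : star T ∈ corner e₁ e₂ := by
  refine corner_le (S := (corner e₁ e₂).comap
    (starLinearEquiv ℂ : Adjointable C Z ≃ₗ⋆[ℂ] Adjointable C Z).toLinearMap) ?_ ?_ hT
  · exact (isClosed_corner e₁ e₂).preimage IsLocallyCStar.continuous_star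
  · intro y x
    change star (theta (e₂.map y) (e₁.map x)) ∈ corner e₁ e₂
    rw [star_theta]
    exact theta_mem_corner e₁ e₂ x y

theorem mul_conj_mem_corner [PreHilbertModule C E₁] [PreHilbertModule C E₂]
    {e₂ : AdjointableIsometry C E₂ Z} {e₁ : AdjointableIsometry C E₁ Z} {T : Adjointable C Z}
    (hT : T ∈ corner e₂ e₁) (S : Adjointable C E₁) : T * e₁.conj S ∈ corner e₂ e₁ := by
  refine corner_le (S := (corner e₂ e₁).comap (LinearMap.mulRight ℂ (e₁.conj S))) ?_ ?_ hT
  · exact (isClosed_corner e₂ e₁).preimage (IsLocallyCStar.continuous_mul_right _)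
  · intro y x
    change theta (e₂.map y) (e₁.map x) * e₁.conj S ∈ corner e₂ e₁
    rw [theta_mul, ← conjHom_apply, ← map_star, conjHom_apply, conj_toEnd, adj_map]
    exact theta_mem_corner _ _ _ _

variable {A : Type u} [NonUnitalRing A] [StarRing A] [Module ℂ A] [IsScalarTower ℂ A A]
  [SMulCommClass ℂ A A] [StarModule ℂ A] [TopologicalSpace A]

/-- The representation of `A` on `Z` given by an equivalence `C ~ A` whose module is contained
in `Z`. -/
noncomputable def actionHom {X : ImprimitivityModule C A} (e : AdjointableIsometry C X.E Z) :
    A →⋆ₙₐ[ℂ] Adjointable C Z := e.conjHom.comp X.lactHom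

theorem actionHom_apply {X : ImprimitivityModule C A} (e : AdjointableIsometry C X.E Z) (a : A) :
    e.actionHom a = e.conj (X.lact a) := rfl

theorem actionHom_lip {X : ImprimitivityModule C A} (e : AdjointableIsometry C X.E Z)
    (x y : X.E) : e.actionHom (X.lip x y) = theta (e.map x) (e.map y) := by
  rw [actionHom_apply, ImprimitivityModule.lact_lip, conj_theta]

theorem isInducing_actionHom {X : ImprimitivityModule C A} (e : AdjointableIsometry C X.E Z) :
    IsInducing e.actionHom := by
  refine e.isInducing_conjHom.comp (IsInducing.subtypeVal.comp (g := Subtype.val) (f := X.iso) ?_)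
  let h : A ≃ₜ compactOperators C X.E :=
    { toEquiv := X.iso.toEquiv
      continuous_toFun := X.continuous_iso
      continuous_invFun := X.continuous_iso_symm }
  exact h.isInducing

variable [IsLocallyCStar A] [PreHilbertModule C E₂]

/-- Products of compact operators from `X.E` to `E₂` and back come from elements of `A`. -/
theorem exists_actionHom_eq_mul {X : ImprimitivityModule C A} {e₂ : AdjointableIsometry C E₂ Z}
    {e : AdjointableIsometry C X.E Z} {S T : Adjointable C Z} (hS : S ∈ corner e e₂)
    (hT : T ∈ corner e₂ e) : ∃ a, e.actionHom a = S * T := by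
  have := IsLocallyCStar.t2 (A := Adjointable C Z)
  have := IsLocallyCStar.isTopologicalAddGroup (Adjointable C Z)
  have hc : IsClosed (LinearMap.range (e.actionHom : A →ₗ[ℂ] Adjointable C Z) :
      Set (Adjointable C Z)) :=
    (IsLocallyCStar.complete (A := A)).isClosed_range (e.actionHom : A →+ Adjointable C Z)
      e.isInducing_actionHom
  have h1 : ∀ x y, ∀ T ∈ corner e₂ e, theta (e.map x) (e₂.map y) * T ∈
      LinearMap.range (e.actionHom : A →ₗ[ℂ] Adjointable C Z) := by
    intro x y
    refine corner_le (S := (LinearMap.range (e.actionHom : A →ₗ[ℂ] Adjointable C Z)).comap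
      (LinearMap.mulLeft ℂ (theta (e.map x) (e₂.map y)))) ?_ ?_
    · exact hc.preimage (IsLocallyCStar.continuous_mul_left _)
    · intro y' x'
      refine ⟨X.lip (rsmul x ⟪y, y'⟫_C) x', ?_⟩
      change e.actionHom _ = theta (e.map x) (e₂.map y) * theta (e₂.map y') (e.map x')
      rw [actionHom_lip, theta_mul_theta, ip_map_map, map_rsmul]
  refine corner_le (S := (LinearMap.range (e.actionHom : A →ₗ[ℂ] Adjointable C Z)).comap
      (LinearMap.mulRight ℂ T)) ?_ ?_ hS
  · exact hc.preimage (IsLocallyCStar.continuous_mul_right _)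
  · intro x y
    exact h1 x y T hT

/-- The inner products with values in `A` of the compact operators from `X.E` to a full module `E₂`
span a dense subspace: they include `⟪x ⟪y, y'⟫, x'⟫`, and the elements `⟪y, y'⟫` are total in `C`. -/
theorem span_actionHom_dense {X : ImprimitivityModule C A} {e₂ : AdjointableIsometry C E₂ Z}
    {e : AdjointableIsometry C X.E Z} (hfull : IsFull C E₂) :
    closure (Submodule.span ℂ {a | ∃ S ∈ corner e₂ e, ∃ T ∈ corner e₂ e,
      e.actionHom a = star S * T} : Set A) = Set.univ := by
  have := IsLocallyCStar.isTopologicalAddGroup A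
  have := (IsLocallyCStar.withSeminorms (A := A)).continuousSMul
  set D := {a | ∃ S ∈ corner e₂ e, ∃ T ∈ corner e₂ e, e.actionHom a = star S * T} with hD
  set M := (Submodule.span ℂ D).topologicalClosure with hM
  have hMc : IsClosed (M : Set A) := isClosed_closure
  have hlip : ∀ y, Continuous fun x : X.E => X.lip x y := fun y =>
    HilbertModule.continuous_ip_left A (E := Conj X.E) (Conj.of y)
  have h1 : ∀ (x x' : X.E) (c : C), X.lip (rsmul x c) x' ∈ M := by
    intro x x' c
    let f : C →ₗ[ℂ] A :=
      { toFun := fun c => X.lip (rsmul x c) x'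
        map_add' := fun c d => by
          rw [rsmul_add]
          exact ip_add_left (Conj.of (rsmul x c)) (Conj.of (rsmul x d)) (Conj.of x')
        map_smul' := fun r c => by
          rw [rsmul_smul]
          have := ip_smul_left (A := A) (star r) (Conj.of (rsmul x c)) (Conj.of x')
          rw [star_star, Conj.smul_of, star_star] at this
          exact this }
    have hf : Continuous f := by
      refine (hlip x').comp ?_
      exact continuous_of_seminorm_bound (IsLocallyCStar.withSeminorms (A := C))
        (HilbertModule.withSeminorms (A := C) (E := X.E))
        ({ toFun := fun c => rsmul x c
           map_add' := rsmul_add x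
           map_smul' := fun r c => rsmul_smul r x c } : C →ₗ[ℂ] X.E)
        (fun p => ⟨seminorm X.E p x, p, fun c => seminorm_rsmul_le p x c⟩)
    refine mem_of_isClosed_of_dense_span hfull (S := M.comap f) (hMc.preimage hf) ?_ c
    rintro _ ⟨y, y', rfl⟩
    refine subset_closure (Submodule.subset_span ⟨theta (e₂.map y) (e.map x),
      theta_mem_corner _ _ _ _, theta (e₂.map y') (e.map x'), theta_mem_corner _ _ _ _, ?_⟩)
    change e.actionHom (X.lip _ _) = _
    rw [actionHom_lip, star_theta, theta_mul_theta, ip_map_map, map_rsmul]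
  have h2 : ∀ x x' : X.E, X.lip x x' ∈ M := by
    intro x x'
    have hx : x ∈ closure (Set.range fun c : C => rsmul x c) := by
      rw [mem_closure_iff_nhds]
      intro U hU
      obtain ⟨s, r, hr, hs⟩ := ((HilbertModule.withSeminorms (A := C) (E := X.E)).mem_nhds_iff
        x U).mp hU
      obtain ⟨p, hp⟩ := CStarSeminorm.exists_finset_sup_le s
      obtain ⟨c, hc⟩ := exists_rsmul_near p x (half_pos hr)
      refine ⟨rsmul x c, hs ?_, c, rfl⟩
      rw [Seminorm.mem_ball, map_sub_rev]
      refine lt_of_le_of_lt ?_ (half_lt_self hr)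
      refine Seminorm.finset_sup_apply_le (half_pos hr).le fun q hq => le_trans ?_ hc
      have := seminorm_le_of_le (E := X.E) (p := p) (q := q) zero_le_one (fun a => by
        rw [one_mul]
        exact (Seminorm.le_finset_sup_apply (p := fun q : CStarSeminorm C => q.toSeminorm)
          hq).trans (hp a)) (x - rsmul x c)
      rwa [Real.sqrt_one, one_mul] at this
    have := map_mem_closure (hlip x') hx (t := (M : Set A)) (by
      rintro _ ⟨c, rfl⟩
      exact h1 x x' c)
    rwa [hMc.closure_eq] at this
  refine Set.eq_univ_of_forall fun a => mem_of_isClosed_of_dense_span X.span_lip_dense hMc ?_ a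
  rintro _ ⟨x, x', rfl⟩
  exact h2 x x'

variable {B : Type u} [NonUnitalRing B] [StarRing B] [Module ℂ B] [IsScalarTower ℂ B B]
  [SMulCommClass ℂ B B] [StarModule ℂ B] [TopologicalSpace B] [IsLocallyCStar B]

/-- The compact operators from one full Hilbert module to another, as a ternary ring of operators
on a Hilbert module which contains both. -/
noncomputable def ternaryRing {X : ImprimitivityModule C A} {Y : ImprimitivityModule C B}
    (e₁ : AdjointableIsometry C X.E Z) (e₂ : AdjointableIsometry C Y.E Z) :
    TernaryRing (Adjointable C Z) A B where
  carrier := corner e₂ e₁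
  isClosed := isClosed_corner e₂ e₁
  right := e₁.actionHom
  isInducing_right := e₁.isInducing_actionHom
  left := e₂.actionHom
  isInducing_left := e₂.isInducing_actionHom
  mul_right_mem T hT a := mul_conj_mem_corner hT _
  left_mul_mem T hT b := by
    have h := star_mem_corner (mul_conj_mem_corner (star_mem_corner hT) (Y.lact (star b)))
    rwa [star_mul, star_star, ← actionHom_apply, map_star, star_star] at h
  star_mul_mem S hS T hT := exists_actionHom_eq_mul (star_mem_corner hS) hT
  mul_star_mem S hS T hT := exists_actionHom_eq_mul hS (star_mem_corner hT)
  dense_right := span_actionHom_dense Y.isFull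
  dense_left := by
    have h := span_actionHom_dense (e₂ := e₁) (e := e₂) X.isFull
    convert h using 4
    ext b
    constructor
    · rintro ⟨S, hS, T, hT, h⟩
      exact ⟨star S, star_mem_corner hS, star T, star_mem_corner hT, by rw [star_star, h]⟩
    · rintro ⟨S, hS, T, hT, h⟩
      exact ⟨star S, star_mem_corner hS, star T, star_mem_corner hT, by rw [star_star, h]⟩

end

end AdjointableIsometry

section

variable {A B C : Type u} [NonUnitalRing A] [StarRing A] [Module ℂ A] [IsScalarTower ℂ A A]
  [SMulCommClass ℂ A A] [StarModule ℂ A] [TopologicalSpace A] [IsLocallyCStar A]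
  [NonUnitalRing B] [StarRing B] [Module ℂ B] [IsScalarTower ℂ B B]
  [SMulCommClass ℂ B B] [StarModule ℂ B] [TopologicalSpace B] [IsLocallyCStar B]
  [NonUnitalRing C] [StarRing C] [Module ℂ C] [IsScalarTower ℂ C C]
  [SMulCommClass ℂ C C] [StarModule ℂ C] [TopologicalSpace C] [IsLocallyCStar C]

theorem ip_zero_left {E : Type*} [AddCommGroup E] [Module ℂ E] [PreHilbertModule C E] (x : E) :
    ⟪(0 : E), x⟫_C = 0 := by
  rw [← sub_self x, ip_sub_left, sub_self]

/-- Two algebras which are strongly Morita equivalent to a third one `C` are so to each other: with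
`C`-modules `X` and `Y` giving the equivalences, the compact operators from `X` to `Y` form an
imprimitivity module. They are realized as operators on `X ⊕ Y`. -/
theorem StronglyMoritaEquivalent.of_common (h₁ : StronglyMoritaEquivalent C A)
    (h₂ : StronglyMoritaEquivalent C B) : StronglyMoritaEquivalent A B := by
  obtain ⟨X⟩ := h₁
  obtain ⟨Y⟩ := h₂
  let e₁ : AdjointableIsometry C X.E (X.E × Y.E) :=
    { map := LinearMap.inl ℂ X.E Y.E
      adj := LinearMap.fst ℂ X.E Y.E
      ip_map_left := fun x z => by
        rw [prod_ip, LinearMap.inl_apply, ip_zero_left, add_zero]; rfl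
      adj_map := fun x => rfl }
  let e₂ : AdjointableIsometry C Y.E (X.E × Y.E) :=
    { map := LinearMap.inr ℂ X.E Y.E
      adj := LinearMap.snd ℂ X.E Y.E
      ip_map_left := fun x z => by
        rw [prod_ip, LinearMap.inr_apply, ip_zero_left, zero_add]; rfl
      adj_map := fun x => rfl }
  exact ⟨(e₁.ternaryRing e₂).imprimitivityModule⟩

theorem StronglyMoritaEquivalent.symm (h : StronglyMoritaEquivalent A B) :
    StronglyMoritaEquivalent B A := by
  obtain ⟨X⟩ := h
  exact ⟨X.symm⟩

end

end Composition

/-! ### A Hilbert module as an imprimitivity module -/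

section InnerIdeal

open PreHilbertModule Adjointable

variable {A V : Type u} [LocallyCStarAlgebra A] [AddCommGroup V] [Module ℂ V]

section PreHilbert

variable [PreHilbertModule A V]

variable (A V) in
/-- The inclusion of `⟨V, V⟩` in `A`. -/
noncomputable def innerIdealIncl : innerIdeal A V →⋆ₙₐ[ℂ] A :=
  NonUnitalStarSubalgebraClass.subtype (innerIdeal A V)

theorem isInducing_innerIdealIncl : IsInducing (innerIdealIncl A V) := IsInducing.subtypeVal

/-- A Hilbert `A`-module `V` as a module over the ideal `⟨V, V⟩`. Positivity of `⟪x, x⟫` in the ideal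
holds because the square root of a positive element lies in the closed algebra it generates. -/
noncomputable instance innerIdealPreHilbertModule : PreHilbertModule (innerIdeal A V) V where
  inner x y := ⟨⟪x, y⟫_A, inner_mem_innerIdeal A x y⟩
  rsmul x a := rsmul x (a : A)
  add_rsmul x y a := add_rsmul x y (a : A)
  rsmul_add x a b := rsmul_add x (a : A) b
  rsmul_mul x a b := rsmul_mul x (a : A) b
  smul_rsmul c x a := smul_rsmul c x (a : A)
  rsmul_smul c x a := rsmul_smul c x (a : A)
  ip_add_right x y z := Subtype.ext (ip_add_right x y z)
  ip_smul_right c x y := Subtype.ext (ip_smul_right c x y)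
  ip_rsmul_right x y a := Subtype.ext (ip_rsmul_right x y (a : A))
  star_ip x y := Subtype.ext (star_ip x y)
  ip_self_nonneg x := by
    obtain ⟨r, hr, hrr, hS⟩ := (isPos_ip_self (A := A) x).exists_sqrt
    refine ⟨⟨r, hS (innerIdeal A V).toNonUnitalSubalgebra.toSubmodule
      (fun a ha b hb => (innerIdeal A V).mul_mem ha hb) (isClosed_innerIdeal A V)
      (inner_mem_innerIdeal A x x)⟩, Subtype.ext ?_⟩
    change ⟪x, x⟫_A = star r * r
    rw [hr, hrr]
  ip_self_eq_zero x h := ip_self_eq_zero (A := A) x (congrArg Subtype.val h)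

theorem coe_innerIdeal_ip (x y : V) : ((⟪x, y⟫_(innerIdeal A V) : innerIdeal A V) : A) = ⟪x, y⟫_A :=
  rfl

variable (V) in
/-- The restriction of a C*-seminorm to `⟨V, V⟩`. -/
noncomputable def CStarSeminorm.restrict (p : CStarSeminorm A) : CStarSeminorm (innerIdeal A V) :=
  p.comap (innerIdealIncl A V) isInducing_innerIdealIncl.continuous

theorem seminorm_restrict (p : CStarSeminorm A) (x : V) :
    seminorm V (p.restrict V) x = seminorm V p x := rfl

theorem exists_restrict_bound (q : CStarSeminorm (innerIdeal A V)) :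
    ∃ (p : CStarSeminorm A) (C : ℝ), 0 ≤ C ∧ ∀ a, q a ≤ C * p.restrict V a :=
  exists_bound_of_isInducing (isInducing_innerIdealIncl (A := A) (V := V)) q

/-- A continuous C*-seminorm of the ideal need not be the restriction of one of `A`; it is only
dominated by a multiple of a restriction, and that is enough. -/
theorem seminorm_toEnd_le_of_restrict {q : CStarSeminorm (innerIdeal A V)} {p : CStarSeminorm A}
    {C : ℝ} (hC : 0 ≤ C) (h : ∀ a, q a ≤ C * p.restrict V a) (T : Adjointable A V) (x : V) :
    seminorm V q (T.toEnd x) ≤ seminorm V q x * opSeminorm p T := by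
  refine le_mul_of_sq_le_mul_star_mul (u := fun T : Adjointable A V => seminorm V q (T.toEnd x))
    (r := fun T => opSeminorm p T) (M := √C * seminorm V p x)
    (fun T => apply_nonneg _ _) (apply_nonneg _ _) (fun T => ?_) (fun T => ?_) (fun T => ?_) T
  · have h1 : ⟪T.toEnd x, T.toEnd x⟫_(innerIdeal A V) =
        ⟪x, (star T * T).toEnd x⟫_(innerIdeal A V) := Subtype.ext (inner_toEnd_left T x _)
    rw [seminorm_sq, h1]
    exact cauchySchwarz q _ _
  · refine (seminorm_le_of_le hC h _).trans ?_
    rw [mul_assoc, mul_comm (seminorm V p x)]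
    exact mul_le_mul_of_nonneg_left (le_opSeminorm p T x) (Real.sqrt_nonneg _)
  · exact (opSeminorm_star_mul_self p T).le

/-- An adjointable operator over `A`, as one over `⟨V, V⟩`. -/
noncomputable def toInnerIdealAdjointable (T : Adjointable A V) : Adjointable (innerIdeal A V) V :=
  ⟨T.toEnd, fun x a => T.toEnd_rsmul x (a : A), fun q => by
      obtain ⟨p, C, hC, h⟩ := exists_restrict_bound q
      refine ⟨opSeminorm p T + 1, add_pos_of_nonneg_of_pos (apply_nonneg _ _) one_pos, fun x => ?_⟩
      have h1 := seminorm_toEnd_le_of_restrict hC h T x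
      rw [mul_comm] at h1
      exact h1.trans (mul_le_mul_of_nonneg_right (lt_add_one _).le (apply_nonneg _ _)),
    (star T).toEnd, fun x a => (star T).toEnd_rsmul x (a : A),
    fun x y => Subtype.ext (inner_toEnd_left T x y)⟩

theorem toInnerIdealAdjointable_toEnd (T : Adjointable A V) (x : V) :
    (toInnerIdealAdjointable T).toEnd x = T.toEnd x := rfl

/-- The passage from adjointable operators over `A` to those over `⟨V, V⟩`, as a
`*`-homomorphism. -/
noncomputable def restrictAdjointable : Adjointable A V →⋆ₙₐ[ℂ] Adjointable (innerIdeal A V) V where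
  toFun := toInnerIdealAdjointable
  map_smul' _ _ := rfl
  map_zero' := rfl
  map_add' _ _ := rfl
  map_mul' _ _ := rfl
  map_star' T := Adjointable.ext fun x => ext_ip (innerIdeal A V) fun z => by
    rw [← inner_toEnd_left, toInnerIdealAdjointable_toEnd, toInnerIdealAdjointable_toEnd]
    exact Subtype.ext (inner_toEnd_left T z x).symm

end PreHilbert

variable [UniformSpace V] [HilbertModule A V]

/-- The seminorms of `V` over `⟨V, V⟩` define the same topology as those over `A`. -/
noncomputable instance innerIdealHilbertModule : HilbertModule (innerIdeal A V) V where
  isUniformAddGroup := HilbertModule.isUniformAddGroup A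
  complete := HilbertModule.complete A
  withSeminorms := by
    refine (HilbertModule.withSeminorms (A := A) (E := V)).congr
      (Seminorm.IsBounded.of_real fun q => ?_)
      (Seminorm.IsBounded.of_real fun p => ⟨{p.restrict V}, 1, fun x => ?_⟩)
    · obtain ⟨p, C, hC, h⟩ := exists_restrict_bound q
      refine ⟨{p}, √C, fun x => ?_⟩
      rw [Finset.sup_singleton]
      exact seminorm_le_of_le hC h x
    · rw [Finset.sup_singleton, one_mul]
      exact (seminorm_restrict p x).ge

theorem isFull_innerIdeal : IsFull (innerIdeal A V) V := by
  refine Set.eq_univ_of_forall fun a => ?_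
  rw [closure_subtype]
  refine closure_mono ?_ a.2
  intro s hs
  suffices h : ∃ t ∈ innerSpan (innerIdeal A V) V, (t : A) = s by
    obtain ⟨t, ht, rfl⟩ := h
    exact ⟨t, ht, rfl⟩
  change s ∈ Submodule.span ℂ _ at hs
  induction hs using Submodule.span_induction with
  | mem s h =>
    obtain ⟨x, y, rfl⟩ := h
    exact ⟨_, Submodule.subset_span ⟨x, y, rfl⟩, rfl⟩
  | zero => exact ⟨0, Submodule.zero_mem _, rfl⟩
  | add s t _ _ hs ht =>
    obtain ⟨s, hs, rfl⟩ := hs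
    obtain ⟨t, ht, rfl⟩ := ht
    exact ⟨s + t, Submodule.add_mem _ hs ht, rfl⟩
  | smul c s _ hs =>
    obtain ⟨s, hs, rfl⟩ := hs
    exact ⟨c • s, Submodule.smul_mem _ c hs, rfl⟩

/-- A Hilbert module `V` gives a strong Morita equivalence of `⟨V, V⟩` and `K(V)`. -/
theorem stronglyMoritaEquivalent_compactOperators :
    StronglyMoritaEquivalent (innerIdeal A V) (compactOperators A V) := by
  refine ⟨ImprimitivityModule.ofAction (E := V) isFull_innerIdeal
    (restrictAdjointable.comp (NonUnitalStarSubalgebraClass.subtype (compactOperators A V)))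
    (fun x y => ⟨theta x y, theta_mem_compactOperators x y⟩) (fun x y => rfl) ?_ (fun q => ?_)
    (fun q => ?_)⟩
  · refine Set.eq_univ_of_forall fun T => ?_
    rw [closure_subtype]
    refine closure_mono ?_ T.2
    intro s hs
    suffices h : ∃ t ∈ Submodule.span ℂ {b : compactOperators A V | ∃ x y : V,
        (⟨theta x y, theta_mem_compactOperators x y⟩ : compactOperators A V) = b},
        (t : Adjointable A V) = s by
      obtain ⟨t, ht, rfl⟩ := h
      exact ⟨t, ht, rfl⟩
    change s ∈ Submodule.span ℂ _ at hs
    induction hs using Submodule.span_induction with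
    | mem s h =>
      obtain ⟨x, y, rfl⟩ := h
      exact ⟨_, Submodule.subset_span ⟨x, y, rfl⟩, rfl⟩
    | zero => exact ⟨0, Submodule.zero_mem _, rfl⟩
    | add s t _ _ hs ht =>
      obtain ⟨s, hs, rfl⟩ := hs
      obtain ⟨t, ht, rfl⟩ := ht
      exact ⟨s + t, Submodule.add_mem _ hs ht, rfl⟩
    | smul c s _ hs =>
      obtain ⟨s, hs, rfl⟩ := hs
      exact ⟨c • s, Submodule.smul_mem _ c hs, rfl⟩
  · obtain ⟨p, C, hC, h⟩ := exists_restrict_bound q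
    refine ⟨1, (opCStarSeminorm V p).comap
      (NonUnitalStarSubalgebraClass.subtype (compactOperators A V)) continuous_subtype_val,
      fun T => ?_⟩
    rw [one_mul]
    refine opSeminorm_le q _ (apply_nonneg _ _) fun x => ?_
    rw [mul_comm]
    exact seminorm_toEnd_le_of_restrict hC h T x
  · obtain ⟨r, C, hC, h⟩ := exists_bound_of_isInducing
      (f := NonUnitalStarSubalgebraClass.subtype (compactOperators A V)) IsInducing.subtypeVal q
    obtain ⟨s, D, -, hD⟩ := Seminorm.bound_of_continuous
      (Adjointable.withSeminorms (A := A) (E := V)) r.toSeminorm r.continuous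
    obtain ⟨p, hp⟩ := CStarSeminorm.exists_finset_sup_le s
    have hr : ∀ T, r T ≤ D * opSeminorm p T := fun T => by
      refine (hD T).trans ?_
      change (D : ℝ) * (s.sup fun p => opSeminorm p) T ≤ _
      refine mul_le_mul_of_nonneg_left ?_ D.2
      refine Seminorm.finset_sup_apply_le (apply_nonneg _ _) fun q hq => ?_
      refine opSeminorm_le_opSeminorm zero_le_one (fun a => ?_) _
      rw [one_mul]
      exact (Seminorm.le_finset_sup_apply (p := fun q : CStarSeminorm A => q.toSeminorm) hq).trans
        (hp a)
    refine ⟨p.restrict V, fun x y => ⟨C * (D * opSeminorm p (theta x y)), fun T => ?_⟩⟩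
    have h1 := opSeminorm_mul_le p (T : Adjointable A V) (theta x y)
    have h2 := mul_le_mul_of_nonneg_left (((hr _).trans (mul_le_mul_of_nonneg_left h1 D.2))) hC
    refine ((h _).trans h2).trans (le_of_eq ?_)
    change _ = C * (D * opSeminorm p (theta x y)) * opSeminorm p (T : Adjointable A V)
    ring

/-- Morita equivalent Hilbert modules have strongly Morita equivalent ideals of inner products. -/
theorem MoritaEquivalent.stronglyMoritaEquivalent_innerIdeal {B W : Type u} [LocallyCStarAlgebra B] [AddCommGroup W]
    [Module ℂ W] [UniformSpace W] [HilbertModule B W] (h : MoritaEquivalent A B V W) :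
    StronglyMoritaEquivalent (innerIdeal A V) (innerIdeal B W) := by
  have h1 := stronglyMoritaEquivalent_compactOperators (A := A) (V := V)
  have h2 := stronglyMoritaEquivalent_compactOperators (A := B) (V := W)
  have h3 := (h1.symm.of_common h).symm
  exact h3.of_common h2.symm

end InnerIdeal

/-! ### Total families of operators -/

section Total

open ContinuousLinearMap

variable {ι : Type*} {H K L : Type*}
  [NormedAddCommGroup H] [InnerProductSpace ℂ H]
  [NormedAddCommGroup K] [InnerProductSpace ℂ K]
  [NormedAddCommGroup L] [InnerProductSpace ℂ L]

/-- The ranges of the operators `T i` have a dense linear span. -/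
def HasTotalRange (T : ι → H →L[ℂ] K) : Prop :=
  closure (Submodule.span ℂ {k : K | ∃ i h, T i h = k} : Set K) = Set.univ

/-- The linear map `∑ i ⊗ h i ↦ ∑ T i (h i)`. -/
noncomputable def synthesis (T : ι → H →L[ℂ] K) : (ι →₀ H) →ₗ[ℂ] K :=
  Finsupp.lsum ℂ fun i => (T i : H →ₗ[ℂ] K)

theorem synthesis_single (T : ι → H →L[ℂ] K) (i : ι) (h : H) :
    synthesis T (Finsupp.single i h) = T i h := by
  rw [synthesis, Finsupp.lsum_single]; rfl

namespace HasTotalRange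

variable {T : ι → H →L[ℂ] K}

theorem dense (hT : HasTotalRange T) : Dense (Submodule.span ℂ {k : K | ∃ i h, T i h = k} : Set K) :=
  dense_iff_closure_eq.mpr hT

theorem ext_clm (hT : HasTotalRange T) {S S' : K →L[ℂ] L} (h : ∀ i x, S (T i x) = S' (T i x)) : S = S' :=
  ContinuousLinearMap.ext_on hT.dense (by rintro _ ⟨i, x, rfl⟩; exact h i x)

theorem ext_inner (hT : HasTotalRange T) {v w : K} (h : ∀ i x, ⟪T i x, v⟫_ℂ = ⟪T i x, w⟫_ℂ) : v = w := by
  have h1 : (innerSL ℂ v : K →L[ℂ] ℂ) = innerSL ℂ w := hT.ext_clm fun i x => by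
    rw [innerSL_apply_apply, innerSL_apply_apply, ← inner_conj_symm, h, inner_conj_symm]
  exact ext_inner_right ℂ fun x => by
    rw [← innerSL_apply_apply ℂ v, h1, innerSL_apply_apply]

theorem denseRange_synthesis (hT : HasTotalRange T) : DenseRange (synthesis T) := by
  have h : Submodule.span ℂ {k : K | ∃ i h, T i h = k} ≤ LinearMap.range (synthesis T) := by
    refine Submodule.span_le.mpr ?_
    rintro _ ⟨i, x, rfl⟩
    exact ⟨Finsupp.single i x, synthesis_single T i x⟩
  exact hT.dense.mono h

/-- A family is total if its values lie in the closed span of a second one. -/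
theorem closure_span_eq_univ (hT : HasTotalRange T) {D : Set K} (h : ∀ i x, T i x ∈ (Submodule.span ℂ D).topologicalClosure) :
    closure (Submodule.span ℂ D : Set K) = Set.univ :=
  Set.eq_univ_of_forall fun k => mem_of_isClosed_of_dense_span hT
    (S := (Submodule.span ℂ D).topologicalClosure) isClosed_closure
    (by rintro _ ⟨i, x, rfl⟩; exact h i x) k

variable [CompleteSpace H] [CompleteSpace K]

theorem eq_of_adjoint_apply (hT : HasTotalRange T) {v w : K} (h : ∀ i, adjoint (T i) v = adjoint (T i) w) : v = w :=
  hT.ext_inner fun i x => by rw [← adjoint_inner_right, h, adjoint_inner_right]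

end HasTotalRange

/-- Two total families with the same Gram operators, up to a unitary, are unitarily equivalent. -/
theorem HasTotalRange.exists_unitary {H₁ H₂ K₁ K₂ : Type*}
    [NormedAddCommGroup H₁] [InnerProductSpace ℂ H₁] [CompleteSpace H₁]
    [NormedAddCommGroup H₂] [InnerProductSpace ℂ H₂] [CompleteSpace H₂]
    [NormedAddCommGroup K₁] [InnerProductSpace ℂ K₁] [CompleteSpace K₁]
    [NormedAddCommGroup K₂] [InnerProductSpace ℂ K₂] [CompleteSpace K₂]
    {T₁ : ι → H₁ →L[ℂ] K₁} {T₂ : ι → H₂ →L[ℂ] K₂} (hT₁ : HasTotalRange T₁) (hT₂ : HasTotalRange T₂)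
    (U : H₁ ≃ₗᵢ[ℂ] H₂)
    (hU : ∀ i j h, adjoint (T₂ i) (T₂ j (U h)) = U (adjoint (T₁ i) (T₁ j h))) :
    ∃ U' : K₁ ≃ₗᵢ[ℂ] K₂, ∀ i h, U' (T₁ i h) = T₂ i (U h) := by
  let f : (ι →₀ H₁) ≃ₗ[ℂ] (ι →₀ H₂) := Finsupp.mapRange.linearEquiv U.toLinearEquiv
  have hf : ∀ i h, f (Finsupp.single i h) = Finsupp.single i (U h) := fun i h => by simp [f]
  have hin : ∀ z w, ⟪synthesis T₂ (f z), synthesis T₂ (f w)⟫_ℂ =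
      ⟪synthesis T₁ z, synthesis T₁ w⟫_ℂ := by
    intro z w
    induction z using Finsupp.induction_linear with
    | zero => simp
    | add z z' hz hz' => simp only [map_add, inner_add_left, hz, hz']
    | single i h =>
      induction w using Finsupp.induction_linear with
      | zero => simp
      | add w w' hw hw' => simp only [map_add, inner_add_right, hw, hw']
      | single j k =>
        rw [hf, hf, synthesis_single, synthesis_single, synthesis_single, synthesis_single,
          ← adjoint_inner_right, hU, U.inner_map_map, adjoint_inner_right]
  let U' := f.extendOfIsometry (synthesis T₁) (synthesis T₂) hT₁.denseRange_synthesis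
    hT₂.denseRange_synthesis fun z => by
      rw [← sq_eq_sq₀ (norm_nonneg _) (norm_nonneg _), @norm_sq_eq_re_inner ℂ,
        @norm_sq_eq_re_inner ℂ, hin]
  refine ⟨U', fun i h => ?_⟩
  rw [← synthesis_single T₁, ← synthesis_single T₂, ← hf]
  exact f.extendOfIsometry_eq _ _ _ _ _ _

/-- A total family on which `B` acts, compatibly with the Gram operators and boundedly for a
continuous C*-seminorm, carries a representation of `B`. -/
theorem HasTotalRange.exists_representation {B : Type*} [NonUnitalRing B] [StarRing B] [Module ℂ B]
    [TopologicalSpace B] [CompleteSpace H] [CompleteSpace K] {T : ι → H →L[ℂ] K} (hT : HasTotalRange T)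
    (act : B → ι → ι) (hmul : ∀ b c i, act (b * c) i = act b (act c i))
    (hadd : ∀ b c i, T (act (b + c) i) = T (act b i) + T (act c i))
    (hsmul : ∀ (r : ℂ) b i, T (act (r • b) i) = r • T (act b i))
    (hstar : ∀ b i j h k, ⟪T (act b i) h, T j k⟫_ℂ = ⟪T i h, T (act (star b) j) k⟫_ℂ)
    (q : CStarSeminorm B) (hq : ∀ i, ∃ M, ∀ b, ‖T (act b i)‖ ≤ M * q b) :
    ∃ ρ : B →⋆ₙₐ[ℂ] (K →L[ℂ] K), (∀ b, ‖ρ b‖ ≤ q b) ∧ ∀ b i h, ρ b (T i h) = T (act b i) h := by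
  let S : B → (ι →₀ H) →ₗ[ℂ] (ι →₀ H) := fun b => Finsupp.lmapDomain H ℂ (act b)
  have hS : ∀ b i h, S b (Finsupp.single i h) = Finsupp.single (act b i) h := fun b i h =>
    Finsupp.mapDomain_single
  have hSmul : ∀ b c z, S (b * c) z = S b (S c z) := fun b c z => by
    have : act (b * c) = act b ∘ act c := funext fun i => hmul b c i
    change Finsupp.mapDomain (act (b * c)) z = _
    rw [this, Finsupp.mapDomain_comp]
    rfl
  have hSstar : ∀ b z w, ⟪synthesis T (S b z), synthesis T w⟫_ℂ =
      ⟪synthesis T z, synthesis T (S (star b) w)⟫_ℂ := by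
    intro b z w
    induction z using Finsupp.induction_linear with
    | zero => simp
    | add z z' hz hz' => simp only [map_add, inner_add_left, hz, hz']
    | single i h =>
      induction w using Finsupp.induction_linear with
      | zero => simp
      | add w w' hw hw' => simp only [map_add, inner_add_right, hw, hw']
      | single j k =>
        rw [hS, hS, synthesis_single, synthesis_single, synthesis_single, synthesis_single, hstar]
  have hM : ∀ z, ∃ M, ∀ b, ‖synthesis T (S b z)‖ ≤ M * q b := by
    intro z
    induction z using Finsupp.induction_linear with
    | zero => exact ⟨0, fun b => by simp⟩
    | add z z' hz hz' =>
      obtain ⟨M, hM⟩ := hz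
      obtain ⟨M', hM'⟩ := hz'
      refine ⟨M + M', fun b => ?_⟩
      rw [map_add, map_add, add_mul]
      exact (norm_add_le _ _).trans (add_le_add (hM b) (hM' b))
    | single i h =>
      obtain ⟨M, hM⟩ := hq i
      refine ⟨M * ‖h‖, fun b => ?_⟩
      rw [hS, synthesis_single]
      refine (le_opNorm _ _).trans ?_
      have := mul_le_mul_of_nonneg_right (hM b) (norm_nonneg h)
      linarith
  have hbound : ∀ b z, ‖synthesis T (S b z)‖ ≤ q b * ‖synthesis T z‖ := by
    intro b z
    obtain ⟨M, hM⟩ := hM z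
    rw [mul_comm]
    refine le_mul_of_sq_le_mul_star_mul (u := fun b => ‖synthesis T (S b z)‖) (r := fun b => q b)
      (M := M) q.nonneg (norm_nonneg _) (fun b => ?_) hM (fun b => (q.star_mul_self b).le) b
    rw [@norm_sq_eq_re_inner ℂ, hSstar, ← hSmul]
    exact (RCLike.re_le_norm _).trans (norm_inner_le_norm _ _)
  let R : B → K →L[ℂ] K := fun b => (synthesis T ∘ₗ S b).extendOfNorm (synthesis T)
  have hR : ∀ b i h, R b (T i h) = T (act b i) h := fun b i h => by
    have h1 := LinearMap.extendOfNorm_eq (f := synthesis T ∘ₗ S b) hT.denseRange_synthesis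
      ⟨q b, hbound b⟩ (Finsupp.single i h)
    rwa [LinearMap.comp_apply, hS, synthesis_single, synthesis_single] at h1
  refine ⟨{ toFun := R
            map_smul' := fun r b => hT.ext_clm fun i h => ?_
            map_zero' := hT.ext_clm fun i h => ?_
            map_add' := fun b c => hT.ext_clm fun i h => ?_
            map_mul' := fun b c => hT.ext_clm fun i h => ?_
            map_star' := fun b => hT.ext_clm fun i h => ?_ }, fun b => ?_, hR⟩
  · change R (r • b) (T i h) = r • R b (T i h)
    rw [hR, hR, hsmul]; rfl
  · have h0 := hsmul 0 (0 : B) i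
    rw [zero_smul, zero_smul] at h0
    rw [hR, h0]; rfl
  · change R (b + c) (T i h) = R b (T i h) + R c (T i h)
    rw [hR, hR, hR, hadd]; rfl
  · change R (b * c) (T i h) = R b (R c (T i h))
    rw [hR, hR, hR, hmul]
  · refine hT.ext_inner fun j k => ?_
    change ⟪_, R (star b) (T i h)⟫_ℂ = ⟪_, adjoint (R b) (T i h)⟫_ℂ
    rw [adjoint_inner_right, hR, hR, hstar]
  · exact LinearMap.opNorm_extendOfNorm_le hT.denseRange_synthesis (q.nonneg b) (hbound b)

end Total

/-! ### Dilation of the inner product -/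

section Dilation

open ContinuousLinearMap PreHilbertModule

variable {A : Type u} [NonUnitalRing A] [StarRing A] [Module ℂ A] [IsScalarTower ℂ A A]
  [SMulCommClass ℂ A A] [StarModule ℂ A]
  {E : Type u} [AddCommGroup E] [Module ℂ E] [PreHilbertModule A E]
  {H : Type*} [NormedAddCommGroup H] [InnerProductSpace ℂ H] [CompleteSpace H]
  (π : A →⋆ₙₐ[ℂ] (H →L[ℂ] H))

theorem inner_rep_left (a : A) (h k : H) : ⟪π a h, k⟫_ℂ = ⟪h, π (star a) k⟫_ℂ := by
  rw [map_star, star_eq_adjoint, adjoint_inner_right]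

theorem rep_mul_apply (a b : A) (h : H) : π (a * b) h = π a (π b h) := by
  rw [map_mul]; rfl

theorem ip_sum_rsmul_self {ι : Type*} (s : Finset ι) (x : ι → E) (b : ι → A) :
    ⟪∑ i ∈ s, rsmul (x i) (b i), ∑ j ∈ s, rsmul (x j) (b j)⟫_A =
      ∑ i ∈ s, ∑ j ∈ s, star (b i) * ⟪x i, x j⟫_A * b j := by
  let f : E →+ E →+ A := AddMonoidHom.mk' (fun x => AddMonoidHom.mk' (fun y => ⟪x, y⟫_A)
    fun y z => ip_add_right x y z) fun x y => by ext z; exact ip_add_left x y z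
  have h := map_sum (f.flip (∑ j ∈ s, rsmul (x j) (b j))) (fun i => rsmul (x i) (b i)) s
  refine h.trans (Finset.sum_congr rfl fun i _ => ?_)
  refine (map_sum (f (rsmul (x i) (b i))) (fun j => rsmul (x j) (b j)) s).trans
    (Finset.sum_congr rfl fun j _ => ?_)
  change ⟪rsmul (x i) (b i), rsmul (x j) (b j)⟫_A = _
  rw [ip_rsmul_left, ip_rsmul_right, mul_assoc]

/-- The form `∑ ⟪h i, π ⟪x i, x j⟫ h j⟫` is positive. The induction on the number of terms splits the
vectors along the cyclic subspace generated by one of them: on this subspace the form is a limit of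
values `‖π c h‖²`, and on its complement the term with that vector vanishes. -/
theorem re_sum_inner_rep_nonneg {ι : Type*} (x : ι → E) (s : Finset ι) (h : ι → H) :
    0 ≤ RCLike.re (∑ i ∈ s, ∑ j ∈ s, ⟪h i, π ⟪x i, x j⟫_A (h j)⟫_ℂ) := by
  classical
  induction s using Finset.induction_on generalizing h with
  | empty => simp
  | insert a s ha ih =>
    let N : Submodule ℂ H := LinearMap.range
      ({ toFun := fun c => π c (h a)
         map_add' := fun c d => by rw [map_add]; rfl
         map_smul' := fun r c => by rw [map_smul]; rfl } : A →ₗ[ℂ] H)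
    let M : Submodule ℂ H := N.topologicalClosure
    have : CompleteSpace M := (isClosed_closure : IsClosed (M : Set H)).completeSpace_coe
    have hinv : ∀ c, ∀ v ∈ M, π c v ∈ M := by
      intro c v hv
      refine map_mem_closure (π c).continuous hv ?_
      rintro _ ⟨d, rfl⟩
      exact ⟨c * d, rep_mul_apply π c d (h a)⟩
    have hinv' : ∀ c, ∀ v ∈ Mᗮ, π c v ∈ Mᗮ := by
      intro c v hv
      rw [Submodule.mem_orthogonal'] at hv ⊢
      intro w hw
      rw [inner_rep_left]
      exact hv _ (hinv _ w hw)
    let m : ι → H := fun i => M.starProjection (h i)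
    let n : ι → H := fun i => h i - M.starProjection (h i)
    have hm : ∀ i, m i ∈ M := fun i => Submodule.starProjection_apply_mem _ _
    have hn : ∀ i, n i ∈ Mᗮ := fun i => Submodule.sub_starProjection_mem_orthogonal _
    have hna : ∀ c, π c (n a) = 0 := by
      intro c
      have h1 : π c (n a) ∈ M := by
        simp only [n, map_sub]
        exact M.sub_mem (subset_closure ⟨c, rfl⟩) (hinv c _ (hm a))
      exact inner_self_eq_zero.mp ((Submodule.mem_orthogonal _ _).mp (hinv' c _ (hn a)) _ h1)
    have hsplit : ∀ i j, ⟪h i, π ⟪x i, x j⟫_A (h j)⟫_ℂ =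
        ⟪m i, π ⟪x i, x j⟫_A (m j)⟫_ℂ + ⟪n i, π ⟪x i, x j⟫_A (n j)⟫_ℂ := by
      intro i j
      have h1 : ∀ i, h i = m i + n i := fun i => by simp [m, n]
      have h2 := (Submodule.mem_orthogonal _ _).mp (hinv' ⟪x i, x j⟫_A _ (hn j)) _ (hm i)
      have h3 := (Submodule.mem_orthogonal' _ _).mp (hn i) _ (hinv ⟪x i, x j⟫_A _ (hm j))
      rw [h1 i, h1 j, map_add, inner_add_left, inner_add_right, inner_add_right, h2, h3]
      ring
    simp only [hsplit, Finset.sum_add_distrib, map_add]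
    refine add_nonneg ?_ ?_
    · have hcl : IsClosed {v : ι → H | 0 ≤ RCLike.re (∑ i ∈ insert a s, ∑ j ∈ insert a s,
          ⟪v i, π ⟪x i, x j⟫_A (v j)⟫_ℂ)} := by
        refine isClosed_le continuous_const (RCLike.continuous_re.comp ?_)
        refine continuous_finsetSum _ fun i _ => continuous_finsetSum _ fun j _ => ?_
        exact (continuous_apply i).inner ((π _).continuous.comp (continuous_apply j))
      have hmem : m ∈ closure (Set.univ.pi fun _ : ι => (N : Set H)) := by
        rw [closure_pi_set]
        exact fun i _ => hm i
      refine closure_minimal ?_ hcl hmem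
      intro v hv
      choose b hb using fun i => hv i (Set.mem_univ i)
      obtain ⟨c, hc⟩ := ip_self_nonneg (A := A) (∑ i ∈ insert a s, rsmul (x i) (b i))
      rw [ip_sum_rsmul_self] at hc
      have h1 : ∀ i j, ⟪v i, π ⟪x i, x j⟫_A (v j)⟫_ℂ =
          ⟪h a, π (star (b i) * ⟪x i, x j⟫_A * b j) (h a)⟫_ℂ := by
        intro i j
        rw [← hb i, ← hb j, rep_mul_apply, rep_mul_apply, ← inner_rep_left]
        rfl
      have h2 : ∑ i ∈ insert a s, ∑ j ∈ insert a s, ⟪v i, π ⟪x i, x j⟫_A (v j)⟫_ℂ =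
          ⟪h a, π (star c * c) (h a)⟫_ℂ := by
        rw [← hc]
        simp only [h1, map_sum, _root_.sum_apply, inner_sum]
      rw [Set.mem_ofPred_eq, h2, rep_mul_apply, ← inner_rep_left, ← norm_sq_eq_re_inner]
      positivity
    · have h1 : ∀ j, ⟪n a, π ⟪x a, x j⟫_A (n j)⟫_ℂ = 0 := fun j => by
        rw [← star_ip, ← inner_rep_left, hna, inner_zero_left]
      have h2 : ∀ i, ⟪n i, π ⟪x i, x a⟫_A (n a)⟫_ℂ = 0 := fun i => by
        rw [hna, inner_zero_right]
      simp only [Finset.sum_insert ha, h1, h2, Finset.sum_const_zero, zero_add]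
      exact ih n

variable (E) in
/-- The Hausdorff completion of `E ⊗ H`, given by the operators `h ↦ x ⊗ h`; it is the Hilbert space
with the reproducing kernel `π ⟪x, y⟫`. -/
theorem exists_dilation {H : Type u} [NormedAddCommGroup H] [InnerProductSpace ℂ H]
    [CompleteSpace H] (π : A →⋆ₙₐ[ℂ] (H →L[ℂ] H)) : ∃ (L : Type u) (_ : NormedAddCommGroup L) (_ : InnerProductSpace ℂ L)
    (_ : CompleteSpace L) (T : E → H →L[ℂ] L), HasTotalRange T ∧
      ∀ x y h, adjoint (T x) (T y h) = π ⟪x, y⟫_A h := by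
  let K : Matrix E E (H →L[ℂ] H) := Matrix.of fun x y => π ⟪x, y⟫_A
  have hK : K.PosSemidef := by
    refine ((RKHS.posSemidef_tfae (K := K)).out 0 2 rfl rfl).mpr ⟨?_, fun v => ?_⟩
    · ext1 x y
      change star (π ⟪y, x⟫_A) = π ⟪x, y⟫_A
      rw [← map_star, star_ip]
    · have h1 := re_sum_inner_rep_nonneg π (fun x : E => x) v.support v
      refine h1.trans (le_of_eq (congrArg RCLike.re ?_))
      rw [Finsupp.sum]
      refine Finset.sum_congr rfl fun x _ => ?_
      rw [Finsupp.sum]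
      refine Finset.sum_congr rfl fun y _ => ?_
      change _ = ⟪π ⟪y, x⟫_A (v x), v y⟫_ℂ
      rw [inner_rep_left, star_ip]
  have : Fact K.PosSemidef := ⟨hK⟩
  refine ⟨RKHS.OfKernel K, inferInstance, inferInstance, inferInstance,
    RKHS.kerFun (RKHS.OfKernel K), ?_, fun x y h => ?_⟩
  · have h := RKHS.kerFun_dense (RKHS.OfKernel K)
    exact congrArg (fun S : Submodule ℂ (RKHS.OfKernel K) => (S : Set (RKHS.OfKernel K))) h
  · have h1 := RKHS.kernel_apply (RKHS.OfKernel K) x y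
    rw [RKHS.OfKernel.kernel_ofKernel] at h1
    exact (DFunLike.congr_fun h1 h).symm

end Dilation

/-! ### Operators with a given Gram kernel -/

section Gram

open ContinuousLinearMap PreHilbertModule

variable {A : Type u} [NonUnitalRing A] [StarRing A] [Module ℂ A] [IsScalarTower ℂ A A]
  [SMulCommClass ℂ A A] [StarModule ℂ A] [TopologicalSpace A]
  {E : Type u} [AddCommGroup E] [Module ℂ E] [PreHilbertModule A E]
  {H : Type*} [NormedAddCommGroup H] [InnerProductSpace ℂ H] [CompleteSpace H]
  {L : Type*} [NormedAddCommGroup L] [InnerProductSpace ℂ L] [CompleteSpace L]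
  {π : A →⋆ₙₐ[ℂ] (H →L[ℂ] H)}

variable (A) in
/-- The continuous C*-seminorm `a ↦ ‖π a‖` of a representation. -/
noncomputable def repSeminorm (π : A →⋆ₙₐ[ℂ] (H →L[ℂ] H)) (hπ : Continuous π) : CStarSeminorm A where
  toSeminorm := (normSeminorm ℂ (H →L[ℂ] H)).comp (π : A →ₗ[ℂ] (H →L[ℂ] H))
  mul_le' a b := by
    change ‖π (a * b)‖ ≤ ‖π a‖ * ‖π b‖
    rw [map_mul]
    exact norm_mul_le _ _
  star_mul_self' a := by
    change ‖π (star a * a)‖ = ‖π a‖ ^ 2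
    rw [map_mul, map_star, CStarRing.norm_star_mul_self, sq]
  continuous' := hπ.norm

theorem repSeminorm_apply (hπ : Continuous π) (a : A) : repSeminorm A π hπ a = ‖π a‖ := rfl

variable (π) in
/-- The family `T` of operators has the Gram kernel `π ⟪x, y⟫`. -/
def IsGramFamily (T : E → H →L[ℂ] L) : Prop :=
  ∀ x y h, adjoint (T x) (T y h) = π ⟪x, y⟫_A h

namespace IsGramFamily

variable {T : E → H →L[ℂ] L}

theorem inner_apply (hT : IsGramFamily π T) (x y : E) (h k : H) :
    ⟪T x h, T y k⟫_ℂ = ⟪h, π ⟪x, y⟫_A k⟫_ℂ := by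
  rw [← hT, adjoint_inner_right]

theorem norm_sq (hT : IsGramFamily π T) (hπ : Continuous π) (x : E) :
    ‖T x‖ ^ 2 = seminorm E (repSeminorm A π hπ) x ^ 2 := by
  have h : adjoint (T x) ∘L T x = π ⟪x, x⟫_A := ContinuousLinearMap.ext fun h => hT x x h
  rw [seminorm_sq, repSeminorm_apply, ← h, norm_adjoint_comp_self, sq]

theorem norm_eq (hT : IsGramFamily π T) (hπ : Continuous π) (x : E) :
    ‖T x‖ = seminorm E (repSeminorm A π hπ) x :=
  (pow_left_inj₀ (norm_nonneg _) (apply_nonneg _ _) two_ne_zero).mp (hT.norm_sq hπ x)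

theorem map_add (hT : IsGramFamily π T) (hd : HasTotalRange T) (x y : E) :
    T (x + y) = T x + T y :=
  ContinuousLinearMap.ext fun h => hd.eq_of_adjoint_apply fun z => by
    rw [add_apply, _root_.map_add, hT, hT, hT, ip_add_right, _root_.map_add]; rfl

theorem map_smul (hT : IsGramFamily π T) (hd : HasTotalRange T) (c : ℂ) (x : E) :
    T (c • x) = c • T x :=
  ContinuousLinearMap.ext fun h => hd.eq_of_adjoint_apply fun z => by
    rw [smul_apply, _root_.map_smul, hT, hT, ip_smul_right, _root_.map_smul]; rfl

theorem map_rsmul (hT : IsGramFamily π T) (hd : HasTotalRange T) (x : E) (a : A) (h : H) :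
    T (rsmul x a) h = T x (π a h) :=
  hd.eq_of_adjoint_apply fun z => by rw [hT, hT, ip_rsmul_right, rep_mul_apply]

/-- For a full module and a non-degenerate representation, the adjoints have total range. -/
theorem hasTotalRange_adjoint (hT : IsGramFamily π T) (hfull : IsFull A E) (hπ : Continuous π)
    (hnd : HasTotalRange fun a => π a) : HasTotalRange fun x => adjoint (T x) := by
  refine hnd.closure_span_eq_univ fun a h => ?_
  let f : A →ₗ[ℂ] H :=
    { toFun := fun a => π a h
      map_add' := fun a b => by rw [_root_.map_add]; rfl
      map_smul' := fun r a => by rw [_root_.map_smul]; rfl }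
  have hf : Continuous f := hπ.clm_apply continuous_const
  refine mem_of_isClosed_of_dense_span hfull (S := Submodule.comap f
    (Submodule.span ℂ _).topologicalClosure) (isClosed_closure.preimage hf) ?_ a
  rintro _ ⟨x, y, rfl⟩
  exact subset_closure (Submodule.subset_span ⟨x, T y h, hT x y h⟩)

end IsGramFamily

/-- If the operators `T i` and their adjoints have total range, so have the products `(T i)* T j`. -/
theorem HasTotalRange.adjoint_apply {ι : Type*} {T : ι → H →L[ℂ] L} (hT : HasTotalRange T)
    (hT' : HasTotalRange fun i => adjoint (T i)) :
    closure (Submodule.span ℂ {h : H | ∃ i j k, adjoint (T i) (T j k) = h} : Set H) = Set.univ := by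
  refine hT'.closure_span_eq_univ fun i l => ?_
  refine mem_of_isClosed_of_dense_span hT (S := Submodule.comap (adjoint (T i) : L →ₗ[ℂ] H)
    (Submodule.span ℂ _).topologicalClosure) (isClosed_closure.preimage (adjoint (T i)).continuous)
    ?_ l
  rintro _ ⟨j, k, rfl⟩
  exact subset_closure (Submodule.subset_span ⟨i, j, k, rfl⟩)

theorem IsGramFamily.hasTotalRange_rep {T : E → H →L[ℂ] L} (hT : IsGramFamily π T)
    (hd : HasTotalRange T) (hd' : HasTotalRange fun x => adjoint (T x)) :
    HasTotalRange fun a => π a := by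
  refine Set.eq_univ_of_univ_subset ((hd.adjoint_apply hd').ge.trans (closure_mono ?_))
  refine Submodule.span_mono ?_
  rintro _ ⟨x, y, h, rfl⟩
  exact ⟨⟪x, y⟫_A, h, (hT x y h).symm⟩

end Gram

/-! ### Induction of representations along an imprimitivity module -/

section Induction

open ContinuousLinearMap PreHilbertModule Adjointable

variable {A B : Type u} [NonUnitalRing A] [StarRing A] [Module ℂ A] [IsScalarTower ℂ A A]
  [SMulCommClass ℂ A A] [StarModule ℂ A] [TopologicalSpace A] [IsLocallyCStar A]
  [NonUnitalRing B] [StarRing B] [Module ℂ B] [IsScalarTower ℂ B B]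
  [SMulCommClass ℂ B B] [StarModule ℂ B] [TopologicalSpace B] [IsLocallyCStar B]
  {H : Type*} [NormedAddCommGroup H] [InnerProductSpace ℂ H] [CompleteSpace H]
  {L : Type*} [NormedAddCommGroup L] [InnerProductSpace ℂ L] [CompleteSpace L]

/-- A representation of the imprimitivity module `X` by operators `T x` from `H` to `L`, over
representations `π` and `ρ` of the two algebras. It exhibits `ρ` as induced from `π`: then `L` is
the completion of `X ⊗ H`, with `T x h` for `x ⊗ h`. The conditions are symmetric in `π` and `ρ`, up
to passage from `T x` to its adjoint. -/
structure ImprimitivityModule.Intertwines (X : ImprimitivityModule A B)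
    (π : A →⋆ₙₐ[ℂ] (H →L[ℂ] H)) (ρ : B →⋆ₙₐ[ℂ] (L →L[ℂ] L)) (T : X.E → H →L[ℂ] L) : Prop where
  adjoint_comp : ∀ x y h, adjoint (T x) (T y h) = π ⟪x, y⟫_A h
  comp_adjoint : ∀ x y l, T x (adjoint (T y) l) = ρ (X.lip x y) l
  total : HasTotalRange T
  total_adjoint : HasTotalRange fun x => adjoint (T x)

namespace ImprimitivityModule.Intertwines

variable {X : ImprimitivityModule A B} {π : A →⋆ₙₐ[ℂ] (H →L[ℂ] H)} {ρ : B →⋆ₙₐ[ℂ] (L →L[ℂ] L)}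
  {T : X.E → H →L[ℂ] L}

theorem isGramFamily (hT : X.Intertwines π ρ T) : IsGramFamily π T := hT.adjoint_comp

theorem symm (hT : X.Intertwines π ρ T) : X.symm.Intertwines ρ π fun x => adjoint (T x) where
  adjoint_comp x y l := by
    rw [adjoint_adjoint]
    exact hT.comp_adjoint x y l
  comp_adjoint x y h := by
    rw [adjoint_adjoint]
    exact (hT.adjoint_comp x y h).trans
      (congrArg (fun a => π a h) (X.symm_lip (x : X.E) (y : X.E)).symm)
  total := hT.total_adjoint
  total_adjoint := by
    simp only [adjoint_adjoint]
    exact hT.total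

theorem of_symm {S : X.symm.E → L →L[ℂ] H} (hS : X.symm.Intertwines ρ π S) :
    X.Intertwines π ρ fun x => adjoint (S (X.toSymm x)) where
  adjoint_comp x y h := by
    rw [adjoint_adjoint, hS.comp_adjoint, X.symm_lip]
  comp_adjoint x y l := by
    rw [adjoint_adjoint, hS.adjoint_comp, X.symm_ip]
  total := hS.total_adjoint
  total_adjoint := by
    simp only [adjoint_adjoint]
    exact hS.total

theorem hasTotalRange_left (hT : X.Intertwines π ρ T) : HasTotalRange fun a => π a :=
  hT.isGramFamily.hasTotalRange_rep hT.total hT.total_adjoint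

theorem hasTotalRange_right (hT : X.Intertwines π ρ T) : HasTotalRange fun b => ρ b :=
  hT.symm.hasTotalRange_left

/-- The condition `ρ ⟪x, y⟫ = T x (T y)*` contains the formula `b (x ⊗ h) = b x ⊗ h` for the induced
representation, as the ranges of the operators `(T y)*` are total. -/
theorem apply_lact (hT : X.Intertwines π ρ T) (b : B) (x : X.E) (h : H) :
    ρ b (T x h) = T ((X.lact b).toEnd x) h := by
  have h1 : ρ b ∘L T x = T ((X.lact b).toEnd x) := hT.total_adjoint.ext_clm fun y l => by
    rw [comp_apply, hT.comp_adjoint, hT.comp_adjoint, ← rep_mul_apply, X.mul_lip]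
  exact DFunLike.congr_fun h1 h

/-- A total family with the right Gram kernel, compatible with the left action, intertwines. -/
theorem of_apply_lact (hT : IsGramFamily π T) (hd : HasTotalRange T)
    (hρ : ∀ b x h, ρ b (T x h) = T ((X.lact b).toEnd x) h) (hπ : Continuous π)
    (hnd : HasTotalRange fun a => π a) : X.Intertwines π ρ T where
  adjoint_comp := hT
  comp_adjoint x y l := by
    have h1 : T x ∘L adjoint (T y) = ρ (X.lip x y) := hd.ext_clm fun z h => by
      rw [comp_apply, hT, hρ, X.lact_lip, theta_toEnd, hT.map_rsmul hd]
    exact DFunLike.congr_fun h1 l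
  total := hd
  total_adjoint := hT.hasTotalRange_adjoint X.isFull hπ hnd

/-- The induced representation is determined up to unitary equivalence. -/
theorem exists_unitary {H' L' : Type*} [NormedAddCommGroup H'] [InnerProductSpace ℂ H']
    [CompleteSpace H'] [NormedAddCommGroup L'] [InnerProductSpace ℂ L'] [CompleteSpace L']
    {π' : A →⋆ₙₐ[ℂ] (H' →L[ℂ] H')} {ρ' : B →⋆ₙₐ[ℂ] (L' →L[ℂ] L')} {T' : X.E → H' →L[ℂ] L'}
    (hT : X.Intertwines π ρ T) (hT' : X.Intertwines π' ρ' T') (U : H ≃ₗᵢ[ℂ] H')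
    (hU : ∀ a h, U (π a h) = π' a (U h)) :
    ∃ U' : L ≃ₗᵢ[ℂ] L', ∀ b l, U' (ρ b l) = ρ' b (U' l) := by
  obtain ⟨U', hU'⟩ := hT.total.exists_unitary hT'.total U fun x y h => by
    rw [hT.adjoint_comp, hT'.adjoint_comp, hU]
  refine ⟨U', fun b l => ?_⟩
  have h1 : (U' : L →L[ℂ] L') ∘L ρ b = ρ' b ∘L (U' : L →L[ℂ] L') :=
    hT.total.ext_clm fun x h => by
      change U' (ρ b (T x h)) = ρ' b (U' (T x h))
      rw [hT.apply_lact, hU', hU', hT'.apply_lact]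
  exact DFunLike.congr_fun h1 l

/-- The induced representation may be transported along a unitary. -/
theorem congr {L' : Type*} [NormedAddCommGroup L'] [InnerProductSpace ℂ L'] [CompleteSpace L']
    {ρ' : B →⋆ₙₐ[ℂ] (L' →L[ℂ] L')} (hT : X.Intertwines π ρ T) (U : L ≃ₗᵢ[ℂ] L')
    (hU : ∀ b l, U (ρ b l) = ρ' b (U l)) (hπ : Continuous π) :
    X.Intertwines π ρ' fun x => (U : L →L[ℂ] L') ∘L T x := by
  refine of_apply_lact (fun x y h => ?_) ?_ (fun b x h => ?_) hπ hT.hasTotalRange_left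
  · refine ext_inner_right ℂ fun k => ?_
    rw [adjoint_inner_left, ← hT.adjoint_comp, adjoint_inner_left]
    exact U.inner_map_map _ _
  · refine Set.eq_univ_of_forall fun l => ?_
    have h1 := map_mem_closure U.continuous (hT.total.ge (Set.mem_univ (U.symm l)))
      (t := (Submodule.span ℂ {k | ∃ x h, ((U : L →L[ℂ] L') ∘L T x) h = k} : Set L')) (by
        intro z hz
        have : Submodule.span ℂ {k | ∃ x h, T x h = k} ≤ Submodule.comap (U : L →ₗ[ℂ] L')
            (Submodule.span ℂ {k | ∃ x h, ((U : L →L[ℂ] L') ∘L T x) h = k}) := by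
          refine Submodule.span_le.mpr ?_
          rintro _ ⟨x, h, rfl⟩
          exact Submodule.subset_span ⟨x, h, rfl⟩
        exact this hz)
    rwa [U.apply_symm_apply] at h1
  · change ρ' b (U (T x h)) = U _
    rw [← hU, hT.apply_lact]
    rfl

end ImprimitivityModule.Intertwines

/-- Existence of the induced representation. -/
theorem ImprimitivityModule.exists_intertwines {H : Type u} [NormedAddCommGroup H]
    [InnerProductSpace ℂ H] [CompleteSpace H] (X : ImprimitivityModule A B)
    (π : A →⋆ₙₐ[ℂ] (H →L[ℂ] H)) (hπ : Continuous π) (hnd : HasTotalRange fun a => π a) :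
    ∃ (L : Type u) (_ : NormedAddCommGroup L) (_ : InnerProductSpace ℂ L) (_ : CompleteSpace L)
      (ρ : B →⋆ₙₐ[ℂ] (L →L[ℂ] L)) (T : X.E → H →L[ℂ] L), Continuous ρ ∧ X.Intertwines π ρ T := by
  obtain ⟨L, i₁, i₂, i₃, T, hd, hT⟩ := exists_dilation X.E π
  have hT : IsGramFamily π T := hT
  obtain ⟨ρ, hρ, hρT⟩ := hd.exists_representation (B := B) (fun b x => (X.lact b).toEnd x)
    (fun b c x => by rw [X.lact_mul]; rfl)
    (fun b c x => by rw [X.lact_add, toEnd_add, LinearMap.add_apply, hT.map_add hd])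
    (fun r b x => by rw [X.lact_smul, toEnd_smul, LinearMap.smul_apply, hT.map_smul hd])
    (fun b x y h k => by
      rw [hT.inner_apply, hT.inner_apply, inner_toEnd_left, X.lact_star])
    (X.leftSeminorm (repSeminorm A π hπ))
    (fun x => ⟨seminorm X.E (repSeminorm A π hπ) x, fun b => by
      rw [hT.norm_eq hπ, mul_comm]
      exact le_opSeminorm _ _ _⟩)
  refine ⟨L, i₁, i₂, i₃, ρ, T, ?_, .of_apply_lact hT hd hρT hπ hnd⟩
  exact continuous_of_seminorm_bound (IsLocallyCStar.withSeminorms (A := B))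
    (norm_withSeminorms ℂ (L →L[ℂ] L)) (ρ : B →ₗ[ℂ] (L →L[ℂ] L))
    (fun _ => ⟨1, _, fun b => by rw [one_mul]; exact hρ b⟩)

end Induction

/-! ### Representations of a Hilbert module and of its ideal of inner products -/

section ModuleRepresentations

open ContinuousLinearMap PreHilbertModule

variable {A V : Type u} [LocallyCStarAlgebra A] [AddCommGroup V] [Module ℂ V]

/-- A non-degenerate representation of the ideal `⟨V, V⟩` extends to `A`. -/
theorem exists_extension [PreHilbertModule A V] {H : Type*} [NormedAddCommGroup H]
    [InnerProductSpace ℂ H] [CompleteSpace H]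
    (π : innerIdeal A V →⋆ₙₐ[ℂ] (H →L[ℂ] H)) (hπ : Continuous π)
    (hnd : HasTotalRange fun a => π a) :
    ∃ φ : A →⋆ₙₐ[ℂ] (H →L[ℂ] H), Continuous φ ∧ ∀ a : innerIdeal A V, φ a = π a := by
  have hmem : ∀ (a : A) (i : innerIdeal A V), a * i ∈ innerIdeal A V := by
    intro a i
    refine map_mem_closure (IsLocallyCStar.continuous_mul_left a) i.2 fun s hs => ?_
    change s ∈ Submodule.span ℂ _ at hs
    change a * s ∈ Submodule.span ℂ _
    induction hs using Submodule.span_induction with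
    | mem s h =>
      obtain ⟨x, y, rfl⟩ := h
      exact Submodule.subset_span ⟨rsmul x (star a), y, by rw [ip_rsmul_left, star_star]⟩
    | zero => rw [mul_zero]; exact Submodule.zero_mem _
    | add s t _ _ hs ht => rw [mul_add]; exact Submodule.add_mem _ hs ht
    | smul c s _ hs => rw [mul_smul_comm]; exact Submodule.smul_mem _ c hs
  obtain ⟨p, C, hC, hp⟩ := exists_restrict_bound (repSeminorm _ π hπ)
  obtain ⟨φ, hφ, hφπ⟩ := hnd.exists_representation (B := A) (fun a i => ⟨a * i, hmem a i⟩)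
    (fun a b i => Subtype.ext (mul_assoc a b i))
    (fun a b i => by
      rw [← map_add]
      exact congrArg π (Subtype.ext (add_mul a b i)))
    (fun r a i => by
      rw [← map_smul]
      exact congrArg π (Subtype.ext (smul_mul_assoc r a (i : A))))
    (fun a i j h k => by
      rw [inner_rep_left, inner_rep_left, ← rep_mul_apply, ← rep_mul_apply]
      refine congrArg (fun b => ⟪h, π b k⟫_ℂ) (Subtype.ext ?_)
      change star (a * (i : A)) * j = star (i : A) * (star a * j)
      rw [star_mul, mul_assoc])
    p (fun i => ⟨C * p i, fun a => by
      refine (hp _).trans ?_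
      have := mul_le_mul_of_nonneg_left (p.mul_le a i) hC
      refine this.trans (le_of_eq ?_)
      ring⟩)
  refine ⟨φ, ?_, fun i => hnd.ext_clm fun j h => ?_⟩
  · exact continuous_of_seminorm_bound (IsLocallyCStar.withSeminorms (A := A))
      (norm_withSeminorms ℂ (H →L[ℂ] H)) (φ : A →ₗ[ℂ] (H →L[ℂ] H))
      (fun _ => ⟨1, p, fun a => by rw [one_mul]; exact hφ a⟩)
  · rw [hφπ, ← rep_mul_apply]
    rfl

variable [UniformSpace V] [HilbertModule A V]

namespace ModuleRep

/-- The representation of `⟨V, V⟩` associated with a representation of `V`. -/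
noncomputable def idealRep (Φ : ModuleRep A V) : innerIdeal A V →⋆ₙₐ[ℂ] (Φ.H →L[ℂ] Φ.H) :=
  Φ.φ.comp (innerIdealIncl A V)

theorem idealRep_apply (Φ : ModuleRep A V) (a : innerIdeal A V) : Φ.idealRep a = Φ.φ a := rfl

theorem continuous_idealRep (Φ : ModuleRep A V) : Continuous Φ.idealRep :=
  Φ.continuous_φ.comp continuous_subtype_val

theorem isGramFamily (Φ : ModuleRep A V) : IsGramFamily Φ.idealRep Φ.Φ := fun x y h =>
  DFunLike.congr_fun (Φ.adjoint_comp x y) h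

theorem IsNondegenerate.hasTotalRange {Φ : ModuleRep A V} (h : Φ.IsNondegenerate) :
    HasTotalRange Φ.Φ := h.1

theorem IsNondegenerate.hasTotalRange_idealRep {Φ : ModuleRep A V} (h : Φ.IsNondegenerate) :
    HasTotalRange fun a => Φ.idealRep a := Φ.isGramFamily.hasTotalRange_rep h.1 h.2

/-- Unitary equivalence of non-degenerate representations of `V` is that of the associated
representations of `⟨V, V⟩`. -/
theorem unitarilyEquivalent_iff {Φ₁ Φ₂ : ModuleRep A V} (h₁ : Φ₁.IsNondegenerate)
    (h₂ : Φ₂.IsNondegenerate) : Φ₁.UnitarilyEquivalent Φ₂ ↔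
      ∃ U : Φ₁.H ≃ₗᵢ[ℂ] Φ₂.H, ∀ a h, U (Φ₁.idealRep a h) = Φ₂.idealRep a (U h) := by
  constructor
  · rintro ⟨U₁, U₂, hU⟩
    refine ⟨U₁, fun a h => ?_⟩
    let f : innerIdeal A V →ₗ[ℂ] Φ₂.H :=
      { toFun := fun a => U₁ (Φ₁.idealRep a h) - Φ₂.idealRep a (U₁ h)
        map_add' := fun a b => by
          simp only [map_add, _root_.add_apply]; abel
        map_smul' := fun r a => by
          simp only [map_smul, _root_.smul_apply, smul_sub, RingHom.id_apply] }
    have hf : Continuous f :=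
      (U₁.continuous.comp (Φ₁.continuous_idealRep.clm_apply continuous_const)).sub
        (Φ₂.continuous_idealRep.clm_apply continuous_const)
    refine sub_eq_zero.mp (mem_of_isClosed_of_dense_span (isFull_innerIdeal (A := A) (V := V))
      (S := LinearMap.ker f) (isClosed_singleton.preimage hf) ?_ a)
    rintro _ ⟨x, y, rfl⟩
    refine sub_eq_zero.mpr (ext_inner_left ℂ fun k => ?_)
    obtain ⟨k, rfl⟩ := U₁.surjective k
    rw [U₁.inner_map_map, ← Φ₁.isGramFamily, ← Φ₂.isGramFamily, adjoint_inner_right,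
      adjoint_inner_right, ← hU, ← hU, U₂.inner_map_map]
  · rintro ⟨U, hU⟩
    obtain ⟨U', hU'⟩ := h₁.hasTotalRange.exists_unitary h₂.hasTotalRange U fun x y h => by
      rw [Φ₁.isGramFamily, Φ₂.isGramFamily, hU]
    exact ⟨U, U', hU'⟩

end ModuleRep

/-- Every non-degenerate representation of `⟨V, V⟩` is associated with a non-degenerate
representation of `V`. -/
theorem exists_nondegRep {H : Type u} [NormedAddCommGroup H] [InnerProductSpace ℂ H]
    [CompleteSpace H] (π : innerIdeal A V →⋆ₙₐ[ℂ] (H →L[ℂ] H)) (hπ : Continuous π)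
    (hnd : HasTotalRange fun a => π a) :
    ∃ (Φ : NondegRep A V) (U : H ≃ₗᵢ[ℂ] Φ.1.H), ∀ a h, U (π a h) = Φ.1.idealRep a (U h) := by
  obtain ⟨φ, hφ, hφπ⟩ := exists_extension π hπ hnd
  obtain ⟨K, i₁, i₂, i₃, T, hd, hT⟩ := exists_dilation V π
  have hT : IsGramFamily π T := hT
  let Φ : ModuleRep A V :=
    { H := H
      K := K
      φ := φ
      continuous_φ := hφ
      Φ := T
      adjoint_comp := fun x y => ContinuousLinearMap.ext fun h => by
        rw [comp_apply, hT, ← coe_innerIdeal_ip, hφπ] }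
  refine ⟨⟨Φ, hd, hT.hasTotalRange_adjoint isFull_innerIdeal hπ hnd⟩,
    LinearIsometryEquiv.refl ℂ H, fun a h => ?_⟩
  exact DFunLike.congr_fun (hφπ a).symm h

end ModuleRepresentations

/-! ### Rieffel induction -/

section RieffelInduction

open ContinuousLinearMap PreHilbertModule

variable {A B V W : Type u} [LocallyCStarAlgebra A] [LocallyCStarAlgebra B]
  [AddCommGroup V] [Module ℂ V] [UniformSpace V] [HilbertModule A V]
  [AddCommGroup W] [Module ℂ W] [UniformSpace W] [HilbertModule B W]
  {X : ImprimitivityModule (innerIdeal A V) (innerIdeal B W)}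

theorem IsRieffelInduced.exists_intertwines {Φ : ModuleRep A V} {Θ : ModuleRep B W}
    (h : IsRieffelInduced X Φ Θ) (hΦ : Φ.IsNondegenerate) :
    ∃ T, X.Intertwines Φ.idealRep Θ.idealRep T := by
  obtain ⟨t, s, ht, htt, -, -, hact, -⟩ := h
  let T : X.E → Φ.H →L[ℂ] Θ.H := fun x =>
    (t ∘ₗ TensorProduct.mk ℂ X.E Φ.H x).mkContinuous √‖Φ.idealRep ⟪x, x⟫_(innerIdeal A V)‖ fun h => by
      refine (sq_le_sq₀ (norm_nonneg _) (by positivity)).mp ?_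
      rw [mul_pow, Real.sq_sqrt (norm_nonneg _), @norm_sq_eq_re_inner ℂ]
      refine (RCLike.re_le_norm _).trans ?_
      rw [LinearMap.comp_apply, TensorProduct.mk_apply, htt]
      refine (norm_inner_le_norm _ _).trans ?_
      have := mul_le_mul_of_nonneg_left (le_opNorm (Φ.idealRep ⟪x, x⟫_(innerIdeal A V)) h)
        (norm_nonneg h)
      refine this.trans (le_of_eq ?_)
      ring
  have hTt : ∀ x h, T x h = t (x ⊗ₜ h) := fun x h => rfl
  have hT : IsGramFamily Φ.idealRep T := fun x y h => ext_inner_left ℂ fun k => by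
    rw [adjoint_inner_right, hTt, hTt, htt]
    rfl
  refine ⟨T, .of_apply_lact hT ?_ (fun b x h => hact b x h) Φ.continuous_idealRep
    hΦ.hasTotalRange_idealRep⟩
  have hr : LinearMap.range t ≤ Submodule.span ℂ {k | ∃ x h, T x h = k} := by
    rw [LinearMap.range_eq_map, ← TensorProduct.span_tmul_eq_top, Submodule.map_span,
      Submodule.span_le]
    rintro _ ⟨_, ⟨x, h, rfl⟩, rfl⟩
    exact Submodule.subset_span ⟨x, h, rfl⟩
  exact (ht.mono hr).closure_eq

theorem ImprimitivityModule.Intertwines.isRieffelInduced {Φ : ModuleRep A V} {Θ : ModuleRep B W}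
    {T : X.E → Φ.H →L[ℂ] Θ.H} (hT : X.Intertwines Φ.idealRep Θ.idealRep T)
    (hΘ : Θ.IsNondegenerate) : IsRieffelInduced X Φ Θ := by
  let t : X.E ⊗[ℂ] Φ.H →ₗ[ℂ] Θ.H := TensorProduct.lift
    { toFun := fun x => (T x : Φ.H →ₗ[ℂ] Θ.H)
      map_add' := fun x y => by rw [hT.isGramFamily.map_add hT.total]; rfl
      map_smul' := fun c x => by rw [hT.isGramFamily.map_smul hT.total]; rfl }
  let s : W ⊗[ℂ] (X.E ⊗[ℂ] Φ.H) →ₗ[ℂ] Θ.K := TensorProduct.lift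
    { toFun := fun w => (Θ.Φ w : Θ.H →ₗ[ℂ] Θ.K) ∘ₗ t
      map_add' := fun w w' => by rw [Θ.isGramFamily.map_add hΘ.hasTotalRange]; rfl
      map_smul' := fun c w => by rw [Θ.isGramFamily.map_smul hΘ.hasTotalRange]; rfl }
  have ht : ∀ x h, t (x ⊗ₜ h) = T x h := fun x h => TensorProduct.lift.tmul _ _
  have hs : ∀ w z, s (w ⊗ₜ z) = Θ.Φ w (t z) := fun w z => TensorProduct.lift.tmul _ _
  have htd : DenseRange t := by
    refine hT.total.dense.mono (Submodule.span_le.mpr ?_ : _ ≤ LinearMap.range t)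
    rintro _ ⟨x, h, rfl⟩
    exact ⟨x ⊗ₜ h, ht x h⟩
  refine ⟨t, s, htd, fun x y h k => ?_, ?_, fun w w' x y h k => ?_, fun b x h => ?_,
    fun w x h => (hs _ _).symm⟩
  · rw [ht, ht, hT.isGramFamily.inner_apply]
    rfl
  · refine dense_iff_closure_eq.mpr (Set.eq_univ_of_forall fun k => ?_)
    refine mem_of_isClosed_of_dense_span hΘ.hasTotalRange
      (S := (LinearMap.range s).topologicalClosure) isClosed_closure ?_ k
    rintro _ ⟨w, l, rfl⟩
    refine map_mem_closure (Θ.Φ w).continuous (htd l) ?_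
    rintro _ ⟨z, rfl⟩
    exact ⟨w ⊗ₜ z, hs w z⟩
  · rw [hs, hs, ht, ht, Θ.isGramFamily.inner_apply, hT.apply_lact, hT.isGramFamily.inner_apply]
    rfl
  · rw [ht, ht, ← ModuleRep.idealRep_apply, hT.apply_lact]
    rfl

theorem exists_isRieffelInduced (X : ImprimitivityModule (innerIdeal A V) (innerIdeal B W))
    (Φ : NondegRep A V) : ∃ Θ : NondegRep B W, IsRieffelInduced X Φ.1 Θ.1 := by
  obtain ⟨L, i₁, i₂, i₃, ρ, T, hρ, hT⟩ := X.exists_intertwines Φ.1.idealRep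
    Φ.1.continuous_idealRep Φ.2.hasTotalRange_idealRep
  obtain ⟨Θ, U, hU⟩ := exists_nondegRep ρ hρ hT.hasTotalRange_right
  exact ⟨Θ, (hT.congr U hU Φ.1.continuous_idealRep).isRieffelInduced Θ.2⟩

/-- Every non-degenerate representation of `W` is induced, namely from the representation induced
from it along the conjugate module. -/
theorem exists_isRieffelInduced_left (X : ImprimitivityModule (innerIdeal A V) (innerIdeal B W))
    (Θ : NondegRep B W) : ∃ Φ : NondegRep A V, IsRieffelInduced X Φ.1 Θ.1 := by
  obtain ⟨Φ, hΦ⟩ := exists_isRieffelInduced X.symm Θ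
  obtain ⟨S, hS⟩ := hΦ.exists_intertwines Θ.2
  exact ⟨Φ, hS.of_symm.isRieffelInduced Θ.2⟩

/-- Representations induced from two representations are unitarily equivalent if and only if these
are. -/
theorem IsRieffelInduced.unitarilyEquivalent_iff {Φ₁ Φ₂ : NondegRep A V} {Θ₁ Θ₂ : NondegRep B W}
    (h₁ : IsRieffelInduced X Φ₁.1 Θ₁.1) (h₂ : IsRieffelInduced X Φ₂.1 Θ₂.1) :
    Φ₁.1.UnitarilyEquivalent Φ₂.1 ↔ Θ₁.1.UnitarilyEquivalent Θ₂.1 := by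
  obtain ⟨T₁, hT₁⟩ := h₁.exists_intertwines Φ₁.2
  obtain ⟨T₂, hT₂⟩ := h₂.exists_intertwines Φ₂.2
  rw [ModuleRep.unitarilyEquivalent_iff Φ₁.2 Φ₂.2, ModuleRep.unitarilyEquivalent_iff Θ₁.2 Θ₂.2]
  constructor
  · rintro ⟨U, hU⟩
    exact hT₁.exists_unitary hT₂ U hU
  · rintro ⟨U, hU⟩
    exact hT₁.symm.exists_unitary hT₂.symm U hU

end RieffelInduction

theorem theorem4p5 {A B V W : Type u} [LocallyCStarAlgebra A] [LocallyCStarAlgebra B]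
    [AddCommGroup V] [Module ℂ V] [UniformSpace V] [HilbertModule A V]
    [AddCommGroup W] [Module ℂ W] [UniformSpace W] [HilbertModule B W]
    (hVW : MoritaEquivalent A B V W) :
    StronglyMoritaEquivalent (innerIdeal A V) (innerIdeal B W) ∧
    ∀ X : ImprimitivityModule (innerIdeal A V) (innerIdeal B W),
      (∀ Φ : NondegRep A V, ∃ Θ : NondegRep B W, IsRieffelInduced X Φ.1 Θ.1) ∧
      ∃ F : RepClass A V ≃ RepClass B W, ∀ (Φ : NondegRep A V) (Θ : NondegRep B W),
        IsRieffelInduced X Φ.1 Θ.1 → F Φ.toClass = Θ.toClass := by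
  refine ⟨hVW.stronglyMoritaEquivalent_innerIdeal, fun X => ⟨exists_isRieffelInduced X, ?_⟩⟩
  choose ind hind using exists_isRieffelInduced X
  let f : RepClass A V → RepClass B W := Quotient.lift (fun Φ => (ind Φ).toClass)
    fun Φ₁ Φ₂ h => Quotient.sound (((hind Φ₁).unitarilyEquivalent_iff (hind Φ₂)).mp h)
  have hf : ∀ (Φ : NondegRep A V) (Θ : NondegRep B W), IsRieffelInduced X Φ.1 Θ.1 →
      f Φ.toClass = Θ.toClass := fun Φ Θ h =>
    Quotient.sound (((hind Φ).unitarilyEquivalent_iff h).mp (Setoid.refl Φ))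
  have hbij : Function.Bijective f := by
    refine ⟨fun a b => ?_, fun b => ?_⟩
    · refine Quotient.inductionOn₂ a b fun Φ₁ Φ₂ h => ?_
      exact Quotient.sound (((hind Φ₁).unitarilyEquivalent_iff (hind Φ₂)).mpr (Quotient.exact h))
    · refine Quotient.inductionOn b fun Θ => ?_
      obtain ⟨Φ, hΦ⟩ := exists_isRieffelInduced_left X Θ
      exact ⟨Φ.toClass, hf Φ Θ hΦ⟩
  exact ⟨Equiv.ofBijective f hbij, hf⟩
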